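/- **Conventions.** Let $\mathbb K\in\{\mathbb R,\mathbb C\}$, let $(D,\mathcal A,\mu)$ be a measure space, and let $J:H\to L^2(\mu)$ be a bounded linear embedding of a normed space $H$ into $L^2(\mu)=L^2(D,\mathcal A,\mu;\mathbb K)$. We approximate $Jf$ in $L^2(\mu)$ for $f$ in the closed unit ball $F$ of $H$. A *deterministic algorithm* collects finitely many pieces of information about the input, each measurement being chosen from a class $\Lambda$ adaptively, i.e. depending on the values already obtained, with an adaptive stopping rule; its output in $L^2(\mu)$ is an arbitrary function of the collected information. Its cost is the maximal number of measurements over all inputs (in an optimal representation of the algorithm). A *randomized algorithm* is a family $(A^\omega)_{\omega\in\Omega}$ of deterministic algorithms, indexed by a probability space, such that $(f,\omega)\mapsto\|Jf-A^\omega(f)\|_{L^2(\mu)}$ is measurable; its cost is the supremum over $\omega$ of the costs of the $A^\omega$. The error of a deterministic algorithm $A$ is $\sup_f\|Jf-A(f)\|_{L^2(\mu)}$, and the error of a randomized algorithm is $\sup_{f}\big(\mathbb E\|Jf-A^\omega(f)\|^2_{L^2(\mu)}\big)^{1/2}$. The $n$-th minimal error is the infimum of the errors of all algorithms of cost at most $n$.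 We denote it by * $e^{\rm all,det}(n)$ and $e^{\rm all,ran}(n)$ for deterministic and randomized algorithms, respectively, with linear information, where $\Lambda$ consists of all continuous linear functionals on $H$; * $e^{\rm std,ran}_{\mathcal F}(n)$ for randomized algorithms with standard information (function values $g\mapsto g(x)$, $x\in D$). Here $\mathcal F$ is a linear space of measurable functions $g:D\to\mathbb K$; the inputs are the functions $g\in\mathcal F$ that represent $Jf$ for some $f\in F$, and the error is the supremum over all these inputs. Measurability of the error in (input, $\omega$) is required along every family of inputs, parametrized by $F$, for which the represented element of $F$ is a measurable function of the parameter and the function value is a jointly measurable function of the parameter and the point $x\in D$. For sequences in $[0,\infty]$, $a(n)\asymp b(n)$ for $n\ge n_0$ means that there are $c>0$ and $C<\infty$ with $c\,b(n)\le a(n)\le C\,b(n)$ for all $n\ge n_0$. **Theorem.** 1. Let $d,r\ge1$ be integers and let $D$ be the $d$-torus $(\mathbb R/\mathbb Z)^d$ or the $d$-cube $[0,1]^d$ with Lebesgue measure. Let $H=H^r_{\rm mix}(D)$ be the space of all complex-valued $f\in L^2(D)$ with weak derivatives $\mathrm D^\alpha f\in L^2(D)$ for all $\alpha\in\{0,\dots,r\}^d$,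 with the scalar product $\sum_{\alpha\in\{0,\dots,r\}^d}\langle \mathrm D^\alpha f,\mathrm D^\alpha g\rangle_{L^2}$ and its natural embedding into $L^2(D)$. Let $\mathcal F$ be the space of continuous functions on $D$, or any linear space of measurable functions on $D$ that contains all continuous functions. Then, for $n\ge2$, $$e^{\rm std,ran}_{\mathcal F}(n)\;\asymp\; n^{-r}\,(\ln n)^{r(d-1)},$$ and likewise $e^{\rm all,det}(n)\asymp n^{-r}(\ln n)^{r(d-1)}$ and $e^{\rm all,ran}(n)\asymp n^{-r}(\ln n)^{r(d-1)}$. 2. Let $H$ be an infinite-dimensional Hilbert space over $\mathbb K$ and let $J:H\to L^2(\mu)$ be linear, injective and compact, where $\mu$ is an arbitrary measure. Let $\sigma(1)\ge\sigma(2)\ge\dots$ be the singular values of $J$, that is, the square roots of the eigenvalues of $J^*J$ counted with multiplicity, and assume that $\sigma(2n)\asymp\sigma(n)$ for $n\ge1$. Then, for every linear space $\mathcal F$ of measurable functions on $D$ that contains a representative of $Jf$ for every $f\in H$, we have for $n\ge1$ $$e^{\rm all,ran}(n)\;\asymp\;e^{\rm all,det}(n)\;\asymp\;e^{\rm std,ran}_{\mathcal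 F}(n).$$ -/

import Mathlib

open MeasureTheory
open scoped ENNReal

universe u₀ h₀ k₀

/-! ## Problems, minimal errors, weak equivalence -/

/-- A problem: a collection of algorithms, each of which has an error and a cost. -/
structure Problem where
  Alg : Type*
  err : Alg → ℝ≥0∞
  cost : Alg → ℕ∞

/-- The `n`-th minimal error: the infimum of the errors of all algorithms of cost at most `n`. -/
noncomputable def Problem.minError (P : Problem) (n : ℕ) : ℝ≥0∞ :=
  ⨅ (A : P.Alg) (_ : P.cost A ≤ n), P.err A

/-- `a(n) ≍ b(n)` for `n ≥ n₀`: each sequence is at most a positive finite constant times the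
other one. -/
def WeakEquiv (n₀ : ℕ) (a b : ℕ → ℝ≥0∞) : Prop :=
  ∃ c C : ℝ≥0∞, 0 < c ∧ C < ⊤ ∧ ∀ n, n₀ ≤ n → c * b n ≤ a n ∧ a n ≤ C * b n

/-! ## Information and algorithms -/

section Algorithms

variable {𝕂 F G : Type*}

/-- The list of the first `n` pieces of information about `f`: the next measurement may depend on
the information `y` collected so far. -/
def infoHistory (L : List 𝕂 → F → 𝕂) (f : F) : ℕ → List 𝕂
  | 0 => []
  | n + 1 => infoHistory L f n ++ [L (infoHistory L f n) f]

/-- A (possibly adaptive) information mapping based on the class `Λ` of measurements: after having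
collected the information `y`, one stops if `T y = false`, and otherwise takes the measurement
`L y ∈ Λ`. -/
structure InformationMap (Λ : Set (F → 𝕂)) where
  L : List 𝕂 → F → 𝕂
  mem : ∀ y, L y ∈ Λ
  T : List 𝕂 → Bool
  terminates : ∀ f, ∃ n, T (infoHistory L f n) = false

variable {Λ : Set (F → 𝕂)}

/-- The number of measurements taken for the input `f`. -/
def InformationMap.count (N : InformationMap Λ) (f : F) : ℕ := Nat.find (N.terminates f)

/-- The information collected about the input `f`. -/
def InformationMap.info (N : InformationMap Λ) (f : F) : List 𝕂 := infoHistory N.L f (N.count f)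

/-- The worst case cost of an information mapping. -/
noncomputable def InformationMap.cost (N : InformationMap Λ) : ℕ∞ := ⨆ f, (N.count f : ℕ∞)

/-- `A` is a deterministic algorithm based on `Λ`: its output is a function `φ` of the collected
information. -/
def IsDetAlgorithm (Λ : Set (F → 𝕂)) (A : F → G) : Prop :=
  ∃ (N : InformationMap Λ) (φ : List 𝕂 → G), A = φ ∘ N.info

/-- The worst case cost of a deterministic algorithm, in an optimal representation. -/
noncomputable def detCost (Λ : Set (F → 𝕂)) (A : F → G) : ℕ∞ :=
  ⨅ (N : InformationMap Λ) (_ : ∃ φ : List 𝕂 → G, A = φ ∘ N.info), N.cost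

/-- The problem of approximating `S` by deterministic algorithms based on `Λ`, in the worst case
setting. -/
noncomputable def detProblem [MetricSpace G] (S : F → G) (Λ : Set (F → 𝕂)) : Problem where
  Alg := {A : F → G // IsDetAlgorithm Λ A}
  err A := ⨆ f, edist (S f) (A.1 f)
  cost A := detCost Λ A.1

/-- A randomized algorithm based on `Λ`: a family of deterministic algorithms indexed by a
probability space such that the error is jointly measurable in input and random element.
Measurability in the input is tested along a given set `plots` of parametrizations `s : P → F`,
where `P` is a topological space with its Borel σ-algebra. For `P = F` and `plots = {id}` this is
joint measurability of `(f, ω) ↦ dist (S f, A^ω f)` on `F × Ω`. -/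
structure RandomizedAlgorithm.{w, u, v, k, p} {𝕂 : Type k} {F : Type u} {G : Type v}
    [MetricSpace G] (S : F → G) (Λ : Set (F → 𝕂))
    {P : Type p} [TopologicalSpace P] (plots : Set (P → F)) where
  Ω : Type w
  mΩ : MeasurableSpace Ω
  prob : Measure Ω
  isProb : IsProbabilityMeasure prob
  A : Ω → F → G
  isAlg : ∀ ω, IsDetAlgorithm Λ (A ω)
  meas : ∀ s ∈ plots, @Measurable (P × Ω) ℝ (@Prod.instMeasurableSpace P Ω (borel P) mΩ) _
    (fun z => dist (S (s z.1)) (A z.2 (s z.1)))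

/-- The problem of approximating `S` by randomized algorithms based on `Λ`: the error is the
largest root mean square error over all inputs, the cost is the largest cost over all
realizations. -/
noncomputable def ranProblem.{w, u, v, k, p} {𝕂 : Type k} {F : Type u} {G : Type v}
    [MetricSpace G] (S : F → G) (Λ : Set (F → 𝕂))
    {P : Type p} [TopologicalSpace P] (plots : Set (P → F)) : Problem where
  Alg := RandomizedAlgorithm.{w} S Λ plots
  err A := ⨆ f, (@lintegral A.Ω A.mΩ A.prob (fun ω => edist (S f) (A.A ω f) ^ 2)) ^ (1 / 2 : ℝ)
  cost A := ⨆ ω, detCost Λ (A.A ω)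

end Algorithms

/-! ## `L²`-approximation on the unit ball of a normed space `H` embedded by `J` into `L²(μ)` -/

section Approximation

variable {𝕂 H D : Type*} [RCLike 𝕂] [NormedAddCommGroup H] [NormedSpace 𝕂 H]
  [MeasurableSpace D] {μ : Measure D}

/-- The closed unit ball of `H`. -/
abbrev UnitBall (H : Type*) [NormedAddCommGroup H] : Type _ := ↥(Metric.closedBall (0 : H) 1)

/-- The embedding, restricted to the unit ball. -/
noncomputable def ballApp (J : H →L[𝕂] Lp 𝕂 2 μ) (f : UnitBall H) : Lp 𝕂 2 μ := J f

/-- Linear information: all continuous linear functionals on `H`. -/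
def linInfo (𝕂 H : Type*) [RCLike 𝕂] [NormedAddCommGroup H] [NormedSpace 𝕂 H] :
    Set (UnitBall H → 𝕂) :=
  {ℓ | ∃ g : H →L[𝕂] 𝕂, ∀ f, ℓ f = g f}

/-- Deterministic approximation with linear information. -/
noncomputable def linDetProblem (J : H →L[𝕂] Lp 𝕂 2 μ) : Problem :=
  detProblem (ballApp J) (linInfo 𝕂 H)

/-- Randomized approximation with linear information. -/
noncomputable def linRanProblem.{w, k, h, u} {𝕂 : Type k} {H : Type h} {D : Type u} [RCLike 𝕂]
    [NormedAddCommGroup H] [NormedSpace 𝕂 H] [MeasurableSpace D] {μ : Measure D}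
    (J : H →L[𝕂] Lp 𝕂 2 μ) : Problem :=
  ranProblem.{w} (ballApp J) (linInfo 𝕂 H) {(id : UnitBall H → UnitBall H)}

/-- The inputs for standard information. Elements of `L²(μ)` are equivalence classes; a function
value needs an actual function. An input is an element `f` of the unit ball together with a
function `g : D → 𝕂` that represents it and belongs to the class `𝓕` of admissible functions.
(If `𝓕` is a space of functions in which representatives are unique, for instance continuous
functions on a cube, then this is just the unit ball, viewed as a set of functions.) -/
def FunctionInput (J : H →L[𝕂] Lp 𝕂 2 μ) (𝓕 : Set (D → 𝕂)) : Type _ :=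
  {q : UnitBall H × (D → 𝕂) // q.2 ∈ 𝓕 ∧ q.2 =ᵐ[μ] J q.1}

/-- The solution operator: the class in `L²(μ)` of the input function. -/
noncomputable def inputApp (J : H →L[𝕂] Lp 𝕂 2 μ) (𝓕 : Set (D → 𝕂)) (q : FunctionInput J 𝓕) : Lp 𝕂 2 μ :=
  J q.1.1

/-- Standard information: the evaluations `g ↦ g x` for `x ∈ D`. -/
def stdInfo (J : H →L[𝕂] Lp 𝕂 2 μ) (𝓕 : Set (D → 𝕂)) : Set (FunctionInput J 𝓕 → 𝕂) :=
  {ℓ | ∃ x : D, ∀ q, ℓ q = q.1.2 x}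

/-- Measurable families of inputs, parametrized by the unit ball: the element of the unit ball
depends measurably on the parameter, and the function value depends measurably on the parameter
and the point.
(If representatives are unique and the evaluation `(f, x) ↦ f x` is jointly measurable, then the
identity of the unit ball is such a family, and measurability along all such families is
measurability on the unit ball.) -/
def measurableFamilies (J : H →L[𝕂] Lp 𝕂 2 μ) (𝓕 : Set (D → 𝕂)) :
    Set (UnitBall H → FunctionInput J 𝓕) :=
  {s | @Measurable _ _ (borel (UnitBall H)) (borel (UnitBall H)) (fun t => (s t).1.1) ∧
    @Measurable (UnitBall H × D) 𝕂 (@Prod.instMeasurableSpace _ D (borel (UnitBall H)) _) _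
      (fun z => (s z.1).1.2 z.2)}

/-- Randomized approximation with standard information. -/
noncomputable def stdRanProblem.{w, k, h, u} {𝕂 : Type k} {H : Type h} {D : Type u} [RCLike 𝕂]
    [NormedAddCommGroup H] [NormedSpace 𝕂 H] [MeasurableSpace D] {μ : Measure D}
    (J : H →L[𝕂] Lp 𝕂 2 μ) (𝓕 : Set (D → 𝕂)) : Problem :=
  ranProblem.{w} (inputApp J 𝓕) (stdInfo J 𝓕) (measurableFamilies J 𝓕)

end Approximation

/-! ## Singular values -/

/-- The `n`-th largest singular value (`n ≥ 1`, counted with multiplicity) of an operator `J`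
between Hilbert spaces: the largest `s > 0` such that there are `n` orthonormal eigenvectors of
`J* J` with eigenvalues `t² ≥ s²`; it is `0` if there are less than `n` positive ones. -/
noncomputable def singularValue {𝕂 H G : Type*} [RCLike 𝕂]
    [NormedAddCommGroup H] [InnerProductSpace 𝕂 H] [CompleteSpace H]
    [NormedAddCommGroup G] [InnerProductSpace 𝕂 G] [CompleteSpace G]
    (J : H →L[𝕂] G) (n : ℕ) : ℝ :=
  sSup {s : ℝ | 0 < s ∧ ∃ v : Fin n → H, Orthonormal 𝕂 v ∧
    ∀ i, ∃ t : ℝ, s ≤ t ∧ ContinuousLinearMap.adjoint J (J (v i)) = ((t ^ 2 : ℝ) : 𝕂) • v i}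

/-! ## Sobolev spaces of mixed smoothness -/

/-- The partial derivative in direction of the `i`-th coordinate. -/
noncomputable def partialDeriv {d : ℕ} (i : Fin d) (φ : (Fin d → ℝ) → ℂ) : (Fin d → ℝ) → ℂ :=
  fun x => fderiv ℝ φ x (Pi.single i 1)

/-- The partial derivative `D^α φ` for a multi-index `α`. -/
noncomputable def multiDeriv {d : ℕ} (α : Fin d → ℕ) (φ : (Fin d → ℝ) → ℂ) : (Fin d → ℝ) → ℂ :=
  (List.finRange d).foldr (fun i g => (partialDeriv i)^[α i] g) φ

theorem contDiff_partialDeriv {d : ℕ} (i : Fin d) {φ : (Fin d → ℝ) → ℂ}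
    (h : ContDiff ℝ (⊤ : ℕ∞) φ) : ContDiff ℝ (⊤ : ℕ∞) (partialDeriv i φ) := by
  unfold partialDeriv
  exact (h.fderiv_right (m := ((⊤ : ℕ∞) : WithTop ℕ∞)) (by simp)).clm_apply contDiff_const

theorem contDiff_multiDeriv {d : ℕ} (α : Fin d → ℕ) {φ : (Fin d → ℝ) → ℂ}
    (h : ContDiff ℝ (⊤ : ℕ∞) φ) : ContDiff ℝ (⊤ : ℕ∞) (multiDeriv α φ) := by
  unfold multiDeriv
  induction List.finRange d with
  | nil => simpa using h
  | cons i l ih =>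
    rw [List.foldr_cons]
    generalize α i = k
    induction k with
    | zero => simpa using ih
    | succ k hk =>
      rw [Function.iterate_succ_apply']
      exact contDiff_partialDeriv i hk

/-- A domain `D` with measurable coordinates in the cube `[0,1]^d`, and the class of smooth test
functions (in coordinates) that defines weak derivatives on it. -/
structure SobolevDomain (d : ℕ) (D : Type*) [MeasurableSpace D] where
  coord : D → (Fin d → ℝ)
  measurable_coord : Measurable coord
  coord_mem : ∀ x, coord x ∈ Set.Icc (0 : Fin d → ℝ) 1
  test : Set ((Fin d → ℝ) → ℂ)
  smooth : ∀ φ ∈ test, ContDiff ℝ (⊤ : ℕ∞) φ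

/-- The cube `[0,1]^d` with test functions in `C_c^∞((0,1)^d)`. -/
noncomputable def cubeDomain (d : ℕ) : SobolevDomain d ↥(Set.Icc (0 : Fin d → ℝ) 1) where
  coord := Subtype.val
  measurable_coord := measurable_subtype_coe
  coord_mem x := x.2
  test := {φ | ContDiff ℝ (⊤ : ℕ∞) φ ∧ HasCompactSupport φ ∧
    tsupport φ ⊆ {x | ∀ i, 0 < x i ∧ x i < 1}}
  smooth _ h := h.1

/-- Lebesgue measure on the cube. -/
noncomputable def cubeMeasure (d : ℕ) : Measure ↥(Set.Icc (0 : Fin d → ℝ) 1) :=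
  Measure.comap Subtype.val volume

instance (d : ℕ) : IsFiniteMeasure (cubeMeasure d) := by
  refine ⟨?_⟩
  unfold cubeMeasure
  rw [comap_subtype_coe_apply measurableSet_Icc]
  refine lt_of_le_of_lt (measure_mono (t := Set.Icc (0 : Fin d → ℝ) 1) ?_)
    isCompact_Icc.measure_lt_top
  rintro _ ⟨x, _, rfl⟩
  exact x.2

/-- The torus `(ℝ/ℤ)^d`, represented by `[0,1)^d`, with smooth `1`-periodic test functions. -/
noncomputable def torusDomain (d : ℕ) : SobolevDomain d (Fin d → UnitAddCircle) where
  coord x i := (AddCircle.equivIco 1 0 (x i) : ℝ)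
  measurable_coord := by
    refine measurable_pi_lambda _ fun i => ?_
    exact measurable_subtype_coe.comp
      ((AddCircle.measurableEquivIco 1 0).measurable.comp (measurable_pi_apply i))
  coord_mem x := by
    refine ⟨fun i => (AddCircle.equivIco (1 : ℝ) 0 (x i)).2.1, fun i => ?_⟩
    have := (AddCircle.equivIco (1 : ℝ) 0 (x i)).2.2
    simp only [zero_add] at this
    exact this.le
  test := {φ | ContDiff ℝ (⊤ : ℕ∞) φ ∧ ∀ (x : Fin d → ℝ) (i : Fin d),
    φ (x + Pi.single i 1) = φ x}
  smooth _ h := h.1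

section Sobolev

variable {d : ℕ} {D : Type*} [MeasurableSpace D]

/-- `v` is the weak derivative of `u` of order `α`:
`∫ u D^α φ = (-1)^|α| ∫ v φ` for all test functions `φ`. -/
def IsWeakDeriv (E : SobolevDomain d D) (μ : Measure D) (α : Fin d → ℕ) (u v : D → ℂ) : Prop :=
  ∀ φ ∈ E.test, ∫ x, u x * multiDeriv α φ (E.coord x) ∂μ =
    (-1) ^ (∑ i, α i) * ∫ x, v x * φ (E.coord x) ∂μ

theorem integrable_mul_coord (E : SobolevDomain d D) (μ : Measure D) [IsFiniteMeasure μ]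
    {ψ : (Fin d → ℝ) → ℂ} (hψ : Continuous ψ) (u : Lp ℂ 2 μ) :
    Integrable (fun x => u x * ψ (E.coord x)) μ := by
  obtain ⟨C, hC⟩ := (isCompact_Icc (a := (0 : Fin d → ℝ)) (b := 1)).exists_bound_of_continuousOn
    hψ.continuousOn
  exact ((Lp.memLp u).integrable (by norm_num)).mul_bdd (c := C)
    (hψ.measurable.comp E.measurable_coord).aestronglyMeasurable
    (Filter.Eventually.of_forall fun x => hC _ (E.coord_mem x))

/-- The Sobolev space of mixed smoothness `r`: an element is the family `(D^α f)` of all weak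
derivatives, `α ∈ {0,…,r}^d`, of a function `f ∈ L²(μ)`, all of which are in `L²(μ)`. As a subspace
of the Hilbert sum it carries the scalar product `⟪f, g⟫ = ∑_α ⟪D^α f, D^α g⟫`. -/
noncomputable def mixedSobolev (E : SobolevDomain d D) (μ : Measure D) [IsFiniteMeasure μ]
    (r : ℕ) : Submodule ℂ (PiLp 2 (fun _ : Fin d → Fin (r + 1) => Lp ℂ 2 μ)) where
  carrier := {u | ∀ α : Fin d → Fin (r + 1),
    IsWeakDeriv E μ (fun i => (α i : ℕ)) (u 0) (u α)}
  zero_mem' := by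
    intro α φ _
    have h0 : ((0 : Lp ℂ 2 μ) : D → ℂ) =ᵐ[μ] 0 := Lp.coeFn_zero _ _ _
    have h1 : ∀ ψ : (Fin d → ℝ) → ℂ,
        ∫ x, ((0 : Lp ℂ 2 μ) : D → ℂ) x * ψ (E.coord x) ∂μ = 0 := by
      intro ψ
      rw [integral_congr_ae (g := fun _ => (0 : ℂ))]
      · simp
      · filter_upwards [h0] with x hx
        rw [hx]
        simp
    simp only [PiLp.zero_apply]
    rw [h1, h1, mul_zero]
  add_mem' := by
    intro u v hu hv α φ hφ
    have key : ∀ (a b : Lp ℂ 2 μ) {ψ : (Fin d → ℝ) → ℂ}, Continuous ψ →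
        ∫ x, ((a + b : Lp ℂ 2 μ) : D → ℂ) x * ψ (E.coord x) ∂μ =
          ∫ x, a x * ψ (E.coord x) ∂μ + ∫ x, b x * ψ (E.coord x) ∂μ := by
      intro a b ψ hψ
      rw [← integral_add (integrable_mul_coord E μ hψ a) (integrable_mul_coord E μ hψ b)]
      refine integral_congr_ae ?_
      filter_upwards [Lp.coeFn_add a b] with x hx
      rw [hx, Pi.add_apply, add_mul]
    have hs := E.smooth φ hφ
    simp only [PiLp.add_apply]
    rw [key _ _ (contDiff_multiDeriv _ hs).continuous, key _ _ hs.continuous, hu α φ hφ,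
      hv α φ hφ, mul_add]
  smul_mem' := by
    intro c u hu α φ hφ
    have key : ∀ (a : Lp ℂ 2 μ) (ψ : (Fin d → ℝ) → ℂ),
        ∫ x, ((c • a : Lp ℂ 2 μ) : D → ℂ) x * ψ (E.coord x) ∂μ =
          c * ∫ x, a x * ψ (E.coord x) ∂μ := by
      intro a ψ
      rw [← integral_const_mul]
      refine integral_congr_ae ?_
      filter_upwards [Lp.coeFn_smul c a] with x hx
      rw [hx, Pi.smul_apply, smul_eq_mul, mul_assoc]
    simp only [PiLp.smul_apply]
    rw [key, key, hu α φ hφ]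
    ring

/-- The embedding of the Sobolev space of mixed smoothness into `L²(μ)`. -/
noncomputable def mixedEmbedding (E : SobolevDomain d D) (μ : Measure D) [IsFiniteMeasure μ]
    (r : ℕ) : ↥(mixedSobolev E μ r) →L[ℂ] Lp ℂ 2 μ :=
  (PiLp.proj 2 (fun _ : Fin d → Fin (r + 1) => Lp ℂ 2 μ) 0).comp (mixedSobolev E μ r).subtypeL

end Sobolev

/-- The rate `n^{-r} (ln n)^{r(d-1)}` (for `d ≥ 1`). -/
noncomputable def mixedRate (d r n : ℕ) : ℝ≥0∞ :=
  ENNReal.ofReal (((n : ℝ) ^ r)⁻¹ * Real.log n ^ (r * (d - 1)))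

/-- The order of convergence on the unit ball of the Sobolev space of mixed smoothness `r` on `D`:
the minimal errors with randomized standard information are of order `n^{-r} (ln n)^{r(d-1)}`, and
so are those with deterministic or randomized linear information. Function values may be those of
the continuous representatives, or more generally of the representatives in any linear space of
measurable functions containing the continuous ones. -/
def MixedOrder {d : ℕ} {D : Type} [TopologicalSpace D] [MeasurableSpace D]
    (E : SobolevDomain d D) (μ : Measure D) [IsFiniteMeasure μ] (r : ℕ) : Prop :=
  (∀ 𝓕 : Submodule ℂ (D → ℂ), (∀ g : D → ℂ, Continuous g → g ∈ 𝓕) → (∀ g ∈ 𝓕, Measurable g) →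
    WeakEquiv 2 (stdRanProblem.{0} (mixedEmbedding E μ r) (𝓕 : Set (D → ℂ))).minError
      (mixedRate d r)) ∧
  WeakEquiv 2 (linDetProblem (mixedEmbedding E μ r)).minError (mixedRate d r) ∧
  WeakEquiv 2 (linRanProblem.{0} (mixedEmbedding E μ r)).minError (mixedRate d r)

/-!
All minimal errors are compared with the same quantities.

*Lower bounds.* Suppose that `J` maps `4 n` orthonormal vectors of `H` to orthogonal vectors of norm
at least `σ`. Then no algorithm of cost `n` has an error below `σ / 64`, whatever information it uses
(`le_minError_linDetProblem`, `le_minError_linRanProblem`, `le_minError_stdRanProblem`). The inputs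
are the real combinations of these vectors with Gaussian coefficients, cut off to the unit ball. The
set of coefficients on which a deterministic algorithm of cost `n` is accurate to within a small
multiple of `σ` is cut by `n` adaptive measurements, each of real rank at most two, into pieces of
small diameter (`Thin`). Slicing the Gaussian measure along the measurements shows that the measure
of such a set is exponentially small in `n` (`Thin.gaussianVolume_le`). For a randomized algorithm one
averages over the input (`le_minError_ranProblem`). Real-linearity of the measurements along this
family of inputs is all that is used, so function values, which are not functionals on `H`, are
covered as well.

*Upper bounds.* Orthogonal projections onto spans of finitely many vectors `e i` of an orthonormal
family are algorithms with linear information. For function values, take nested index sets `Λ k` with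
projection errors `τ k` that decrease at most geometrically. The coefficients of the residual of the
previous level are estimated from independent samples, drawn from the density that averages
`|e i|²` over `Λ k`. With a fixed multiple of `|Λ k|` samples this yields the error `C τ k` on level
`k`, at a total cost of order `∑ i ≤ k, |Λ i|` (`exists_minError_stdRanProblem_le`).

*Hilbert spaces.* A compact injective `J` has a singular system (`exists_singular_system`). The right
singular vectors serve for the lower bounds, the left ones for the upper bounds, and the doubling
condition on the singular values bridges the constants (`hasOrder_singularValue`).

*Mixed smoothness.* The torus and the cube are treated at once (`IsUnitCubeDomain`). The upper bounds
use tensor products of Legendre polynomials `P_l = D^l (x (1 - x))^l` on both domains, so that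
periodicity plays no role. The antiderivative of order `a ≤ l` of `P_l` that vanishes at the endpoints
is `(x (1 - x))^a` times a Jacobi polynomial, and it is a limit of test functions on `(0,1)`
(`exists_testApprox_legendre`). Hence the Legendre coefficients of `f` are, up to explicit factors,
the Jacobi coefficients of a weak derivative of `f`, and Bessel's inequality gives the decay
`∏ (l i + 1)^(-r)` in the square mean (`sum_pow_mul_inner_legendreLp_sq_le`). The projection onto the
hyperbolic cross of level `k` therefore has an error of order `2^(-k r)`. Conversely, exponentials
with frequencies in the hyperbolic cross are orthogonal in the Sobolev space and in `L²`, on the cube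
as well as on the torus, and have Sobolev norms of order at most `2^(k r)`
(`le_minError_mixedEmbedding`). A hyperbolic cross of level `k` has about `2^k (k + 1)^(d - 1)`
elements, which turns `2^(-k r)` into the rate `n^(-r) (log n)^(r (d - 1))` (`hasOrder_logRate`).
-/

/-! ### Gaussian measure of balls and slices -/

section Gaussian

variable {V : Type*} [NormedAddCommGroup V] [InnerProductSpace ℝ V] [FiniteDimensional ℝ V]
  [MeasurableSpace V] [BorelSpace V]

/-- The centred Gaussian measure on a Euclidean space `V`, with density `exp (-π ‖x‖²)`. With this
normalization it is a probability measure in every dimension. -/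
noncomputable def gaussianVolume (V : Type*) [NormedAddCommGroup V] [InnerProductSpace ℝ V]
    [FiniteDimensional ℝ V] [MeasurableSpace V] [BorelSpace V] : Measure V :=
  volume.withDensity fun x => ENNReal.ofReal (Real.exp (-Real.pi * ‖x‖ ^ 2))

theorem lintegral_exp_neg_mul_sq_norm {b : ℝ} (hb : 0 < b) :
    ∫⁻ x : V, ENNReal.ofReal (Real.exp (-b * ‖x‖ ^ 2)) =
      ENNReal.ofReal ((Real.pi / b) ^ (Module.finrank ℝ V / 2 : ℝ)) := by
  have h := GaussianFourier.integral_rexp_neg_mul_sq_norm (V := V) hb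
  rw [← h, ofReal_integral_eq_lintegral_ofReal]
  · refine Integrable.of_integral_ne_zero ?_
    rw [h]
    have := Real.pi_pos
    positivity
  · exact Filter.Eventually.of_forall fun x => (Real.exp_pos _).le

theorem rpow_half_natCast_four (m : ℕ) : (4 : ℝ) ^ (m / 2 : ℝ) = 2 ^ m := by
  rw [show (4 : ℝ) = 2 ^ (2 : ℝ) by norm_num, ← Real.rpow_mul (by norm_num),
    mul_div_cancel₀ _ (by norm_num), Real.rpow_natCast]

instance : IsProbabilityMeasure (gaussianVolume V) := by
  refine ⟨?_⟩
  rw [gaussianVolume, withDensity_apply _ MeasurableSet.univ, Measure.restrict_univ,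
    lintegral_exp_neg_mul_sq_norm Real.pi_pos, div_self Real.pi_pos.ne', Real.one_rpow,
    ENNReal.ofReal_one]

/-- Balls of a fixed radius have exponentially small Gaussian measure in the dimension, wherever
their centre is. -/
theorem gaussianVolume_closedBall_mul_le (a : V) (ρ : ℝ) :
    gaussianVolume V (Metric.closedBall a ρ) * 2 ^ Module.finrank ℝ V ≤
      ENNReal.ofReal (Real.exp (3 * Real.pi * ρ ^ 2)) := by
  set K := ENNReal.ofReal (Real.exp (3 * Real.pi * ρ ^ 2))
  have h1 : gaussianVolume V (Metric.closedBall a ρ) ≤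
      ∫⁻ x : V, K * ENNReal.ofReal (Real.exp (-(4 * Real.pi) * ‖x - (3 / 4 : ℝ) • a‖ ^ 2)) := by
    rw [gaussianVolume, withDensity_apply _ Metric.isClosed_closedBall.measurableSet,
      ← lintegral_indicator Metric.isClosed_closedBall.measurableSet]
    refine lintegral_mono fun x => ?_
    by_cases hx : x ∈ Metric.closedBall a ρ
    · rw [Set.indicator_of_mem hx, ← ENNReal.ofReal_mul (Real.exp_pos _).le, ← Real.exp_add]
      refine ENNReal.ofReal_le_ofReal (Real.exp_le_exp.2 ?_)
      -- complete the square in `3 ‖x - a‖² + ‖x‖²`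
      have e1 : ‖x - (3 / 4 : ℝ) • a‖ ^ 2 =
          ‖x‖ ^ 2 - 2 * (3 / 4) * inner ℝ x a + (3 / 4) ^ 2 * ‖a‖ ^ 2 := by
        rw [norm_sub_sq_real, inner_smul_right, norm_smul]
        simp [mul_pow]
        ring
      have e2 := norm_sub_sq_real x a
      have e3 : ‖x - a‖ ^ 2 ≤ ρ ^ 2 := by
        rw [mem_closedBall_iff_norm] at hx
        gcongr
      have hp := Real.pi_pos
      have e4 : 3 * ‖x - a‖ ^ 2 + ‖x‖ ^ 2 ≥ 4 * ‖x - (3 / 4 : ℝ) • a‖ ^ 2 := by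
        rw [e1, e2]
        nlinarith [sq_nonneg ‖a‖]
      nlinarith
    · rw [Set.indicator_of_notMem hx]
      exact zero_le
  have h2 : (∫⁻ x : V, K * ENNReal.ofReal (Real.exp (-(4 * Real.pi) * ‖x - (3 / 4 : ℝ) • a‖ ^ 2)))
      * 2 ^ Module.finrank ℝ V = K := by
    rw [lintegral_const_mul _ (by fun_prop),
      lintegral_sub_right_eq_self (fun x : V => ENNReal.ofReal (Real.exp (-(4 * Real.pi) * ‖x‖ ^ 2))),
      lintegral_exp_neg_mul_sq_norm (by have := Real.pi_pos; positivity), mul_assoc]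
    have h3 : Real.pi / (4 * Real.pi) = 4⁻¹ := by
      have := Real.pi_pos.ne'
      field_simp
    rw [h3, Real.inv_rpow (by norm_num), rpow_half_natCast_four,
      ENNReal.ofReal_inv_of_pos (by positivity), ENNReal.ofReal_pow (by norm_num),
      ENNReal.ofReal_ofNat, ENNReal.inv_mul_cancel (by simp) (by simp), mul_one]
  exact (mul_le_mul_left h1 _).trans h2.le

theorem gaussianVolume_compl_closedBall_le {R : ℝ} (hR : 0 ≤ R) :
    gaussianVolume V (Metric.closedBall 0 R)ᶜ ≤
      ENNReal.ofReal (Real.exp (-(3 / 4 * Real.pi * R ^ 2))) * 2 ^ Module.finrank ℝ V := by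
  have hm := (Metric.isClosed_closedBall (x := (0 : V)) (ε := R)).measurableSet.compl
  have h1 : gaussianVolume V (Metric.closedBall 0 R)ᶜ ≤
      ∫⁻ x : V, ENNReal.ofReal (Real.exp (-(3 / 4 * Real.pi * R ^ 2))) *
        ENNReal.ofReal (Real.exp (-(Real.pi / 4) * ‖x‖ ^ 2)) := by
    rw [gaussianVolume, withDensity_apply _ hm, ← lintegral_indicator hm]
    refine lintegral_mono fun x => ?_
    by_cases hx : x ∈ (Metric.closedBall (0 : V) R)ᶜ
    · rw [Set.indicator_of_mem hx, ← ENNReal.ofReal_mul (Real.exp_pos _).le, ← Real.exp_add]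
      refine ENNReal.ofReal_le_ofReal (Real.exp_le_exp.2 ?_)
      have e3 : R ^ 2 ≤ ‖x‖ ^ 2 := by
        rw [Set.mem_compl_iff, mem_closedBall_zero_iff, not_le] at hx
        gcongr
      have hp := Real.pi_pos
      nlinarith
    · rw [Set.indicator_of_notMem hx]
      exact zero_le
  refine h1.trans (le_of_eq ?_)
  rw [lintegral_const_mul _ (by fun_prop),
    lintegral_exp_neg_mul_sq_norm (by have := Real.pi_pos; positivity)]
  have h3 : Real.pi / (Real.pi / 4) = 4 := by
    have := Real.pi_pos.ne'
    field_simp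
  rw [h3, rpow_half_natCast_four, ENNReal.ofReal_pow (by norm_num), ENNReal.ofReal_ofNat]

/-- The Gaussian measure is the product of its marginals on orthogonal subspaces: slicing along
the translates of `W`. -/
theorem gaussianVolume_eq_lintegral_slices (W : Submodule ℝ V) {E : Set V} (hE : MeasurableSet E) :
    gaussianVolume V E = ∫⁻ u : Wᗮ, ENNReal.ofReal (Real.exp (-Real.pi * ‖u‖ ^ 2)) *
      gaussianVolume W {w : W | (w : V) + u ∈ E} := by
  set f : V → ℝ≥0∞ := fun x => ENNReal.ofReal (Real.exp (-Real.pi * ‖x‖ ^ 2)) with hf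
  have hfm : Measurable f := by fun_prop
  have hmp := (WithLp.volume_preserving_ofLp W Wᗮ).comp W.orthogonalDecomposition.measurePreserving
  have hadd : Measurable fun z : W × Wᗮ => (z.1 : V) + z.2 := by fun_prop
  have hF : Measurable fun z : W × Wᗮ => E.indicator f ((z.1 : V) + z.2) :=
    (hfm.indicator hE).comp hadd
  have h1 := hmp.lintegral_comp hF
  simp only [Function.comp_apply, Submodule.orthogonalDecomposition_apply] at h1
  rw [gaussianVolume, withDensity_apply _ hE, ← lintegral_indicator hE]
  have h2 : ∀ x : V, E.indicator f x = E.indicator f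
      ((W.orthogonalProjectionOnto x : V) + Wᗮ.orthogonalProjectionOnto x) := by
    intro x
    congr 1
    exact (W.starProjection_add_starProjection_orthogonal x).symm
  rw [lintegral_congr h2, h1, Measure.volume_eq_prod, lintegral_prod_symm' _ hF]
  refine lintegral_congr fun u => ?_
  have hm : MeasurableSet {w : W | (w : V) + u ∈ E} :=
    hE.preimage (by fun_prop : Measurable fun w : W => (w : V) + u)
  rw [gaussianVolume, withDensity_apply _ hm, ← lintegral_indicator hm,
    ← lintegral_const_mul _ (Measurable.indicator (by fun_prop) hm)]
  refine lintegral_congr fun w => ?_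
  by_cases hw : (w : V) + u ∈ E
  · rw [Set.indicator_of_mem hw, Set.indicator_of_mem (by exact hw), hf,
      ← ENNReal.ofReal_mul (Real.exp_pos _).le, ← Real.exp_add]
    have h3 : ‖(w : V) + u‖ ^ 2 = ‖w‖ ^ 2 + ‖u‖ ^ 2 := by
      have := norm_add_sq_eq_norm_sq_add_norm_sq_of_inner_eq_zero (w : V) (u : V)
        (W.inner_right_of_mem_orthogonal w.2 u.2)
      simpa [sq] using this
    simp only [h3]
    ring_nf
  · rw [Set.indicator_of_notMem hw, Set.indicator_of_notMem (by exact hw), mul_zero]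

end Gaussian

/-! ### Sets resolved by few adaptive measurements -/

section Thin

variable {𝕂 : Type*} [RCLike 𝕂]

/-- `Thin 𝕂 ρ k E`: one can adaptively ask for the values of `k` real-linear maps into `𝕂` such that
any two points of `E` with the same answers have distance at most `ρ`. -/
def Thin (𝕂 : Type*) [RCLike 𝕂] {V : Type*} [NormedAddCommGroup V] [InnerProductSpace ℝ V]
    (ρ : ℝ) : ℕ → Set V → Prop
  | 0, E => ∀ x ∈ E, ∀ y ∈ E, dist x y ≤ ρ
  | k + 1, E => ∃ ℓ : V →ₗ[ℝ] 𝕂, ∀ y, Thin 𝕂 ρ k (E ∩ {x | ℓ x = y})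

variable {V : Type*} [NormedAddCommGroup V] [InnerProductSpace ℝ V] {ρ : ℝ}

theorem Thin.mono {k : ℕ} {E E' : Set V} (h : Thin 𝕂 ρ k E) (hE : E' ⊆ E) : Thin 𝕂 ρ k E' := by
  induction k generalizing E E' with
  | zero => exact fun x hx y hy => h x (hE hx) y (hE hy)
  | succ k ih =>
    obtain ⟨ℓ, hℓ⟩ := h
    exact ⟨ℓ, fun y => ih (hℓ y) (Set.inter_subset_inter_left _ hE)⟩

theorem Thin.slice {k : ℕ} {E : Set V} (h : Thin 𝕂 ρ k E) (W : Submodule ℝ V) (u : V) :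
    Thin 𝕂 ρ k {w : W | (w : V) + u ∈ E} := by
  induction k generalizing E with
  | zero =>
    intro x hx y hy
    have := h _ hx _ hy
    rwa [dist_add_right] at this
  | succ k ih =>
    obtain ⟨ℓ, hℓ⟩ := h
    refine ⟨ℓ ∘ₗ W.subtype, fun y => (ih (hℓ (y + ℓ u))).mono ?_⟩
    rintro w ⟨hw, hy⟩
    refine ⟨hw, ?_⟩
    simp only [Set.mem_ofPred_eq, LinearMap.comp_apply, Submodule.subtype_apply] at hy ⊢
    rw [map_add, hy]

theorem finrank_real_rclike_le : Module.finrank ℝ 𝕂 ≤ 2 := by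
  have h : Submodule.span ℝ ({1, RCLike.I} : Set 𝕂) = ⊤ := by
    refine eq_top_iff.2 fun z _ => ?_
    rw [Submodule.mem_span_pair]
    refine ⟨RCLike.re z, RCLike.im z, ?_⟩
    rw [RCLike.real_smul_eq_coe_mul, RCLike.real_smul_eq_coe_mul, mul_one, RCLike.re_add_im]
  classical
  have h2 := finrank_span_finset_le_card (R := ℝ) ({1, RCLike.I} : Finset 𝕂)
  rw [Finset.coe_pair, Set.finrank, h, finrank_top] at h2
  exact h2.trans (Finset.card_le_two)

/-- A measurable set that is determined up to distance `ρ` by `k` adaptive measurements has small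
Gaussian measure: each measurement costs at most two real dimensions. -/
theorem Thin.gaussianVolume_le [FiniteDimensional ℝ V] [MeasurableSpace V] [BorelSpace V]
    {k : ℕ} {E : Set V} (h : Thin 𝕂 ρ k E) (hE : MeasurableSet E) :
    gaussianVolume V E * 2 ^ Module.finrank ℝ V ≤
      ENNReal.ofReal (Real.exp (3 * Real.pi * ρ ^ 2)) * 4 ^ k := by
  induction k generalizing V with
  | zero =>
    rcases E.eq_empty_or_nonempty with rfl | ⟨a, ha⟩
    · simp
    · rw [pow_zero, mul_one]
      refine le_trans ?_ (gaussianVolume_closedBall_mul_le a ρ)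
      gcongr
      exact fun x hx => h x hx a ha
  | succ k ih =>
    obtain ⟨ℓ, hℓ⟩ := h
    set W := LinearMap.ker ℓ
    have hdim : Module.finrank ℝ V ≤ Module.finrank ℝ W + 2 := by
      have h1 := LinearMap.finrank_range_add_finrank_ker ℓ
      have h2 := (Submodule.finrank_le (LinearMap.range ℓ)).trans (finrank_real_rclike_le (𝕂 := 𝕂))
      have : Module.finrank ℝ W = Module.finrank ℝ (LinearMap.ker ℓ) := rfl
      omega
    have key : ∀ u : Wᗮ, gaussianVolume W {w : W | (w : V) + u ∈ E} * 2 ^ Module.finrank ℝ W ≤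
        ENNReal.ofReal (Real.exp (3 * Real.pi * ρ ^ 2)) * 4 ^ k := by
      intro u
      refine ih (((hℓ (ℓ u)).slice W u).mono ?_)
        (hE.preimage (by fun_prop : Measurable fun w : W => (w : V) + u))
      intro w hw
      refine ⟨hw, ?_⟩
      have := w.2
      rw [LinearMap.mem_ker] at this
      simp [this]
    calc gaussianVolume V E * 2 ^ Module.finrank ℝ V
        ≤ gaussianVolume V E * 2 ^ (Module.finrank ℝ W + 2) := by
          gcongr
          norm_num
      _ = ∫⁻ u : Wᗮ, ENNReal.ofReal (Real.exp (-Real.pi * ‖u‖ ^ 2)) *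
            gaussianVolume W {w : W | (w : V) + u ∈ E} * 2 ^ (Module.finrank ℝ W + 2) := by
          rw [gaussianVolume_eq_lintegral_slices W hE, lintegral_mul_const']
          simp
      _ ≤ ∫⁻ u : Wᗮ, ENNReal.ofReal (Real.exp (-Real.pi * ‖u‖ ^ 2)) *
            (ENNReal.ofReal (Real.exp (3 * Real.pi * ρ ^ 2)) * 4 ^ (k + 1)) := by
          refine lintegral_mono fun u => ?_
          rw [mul_assoc]
          refine mul_le_mul_right ?_ _
          calc _ = gaussianVolume W {w : W | (w : V) + u ∈ E} * 2 ^ Module.finrank ℝ W * 4 := by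
                rw [pow_add, mul_assoc]; norm_num
            _ ≤ _ := by
                rw [pow_succ 4 k, ← mul_assoc]
                exact mul_le_mul_left (key u) 4
      _ = _ := by
          rw [lintegral_mul_const _ (by fun_prop), lintegral_exp_neg_mul_sq_norm Real.pi_pos,
            div_self Real.pi_pos.ne', Real.one_rpow, ENNReal.ofReal_one, one_mul]

end Thin

/-! ### Adaptive information of bounded cost -/

section Information

variable {𝕂 F G : Type*} {Λ : Set (F → 𝕂)}

theorem length_infoHistory (L : List 𝕂 → F → 𝕂) (f : F) (n : ℕ) :
    (infoHistory L f n).length = n := by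
  induction n with
  | zero => rfl
  | succ n ih => simp [infoHistory, ih]

theorem infoHistory_eq_of_le {L : List 𝕂 → F → 𝕂} {f g : F} {n : ℕ}
    (h : infoHistory L f n = infoHistory L g n) {i : ℕ} (hi : i ≤ n) :
    infoHistory L f i = infoHistory L g i := by
  induction n with
  | zero => rw [Nat.le_zero.1 hi]; rfl
  | succ n ih =>
    rcases hi.eq_or_lt with rfl | hlt
    · exact h
    · refine ih ?_ (Nat.lt_succ_iff.1 hlt)
      exact List.append_inj_left h (by rw [length_infoHistory, length_infoHistory])

theorem InformationMap.info_eq (N : InformationMap Λ) {f g : F} {n : ℕ}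
    (h : infoHistory N.L f n = infoHistory N.L g n) (hf : N.count f ≤ n) :
    N.info f = N.info g := by
  have h1 : N.count f = N.count g := by
    refine le_antisymm ?_ ?_
    · rcases le_or_gt (N.count g) n with hg | hg
      · refine Nat.find_min' _ ?_
        rw [infoHistory_eq_of_le h hg]
        exact Nat.find_spec (N.terminates g)
      · exact hf.trans hg.le
    · refine Nat.find_min' _ ?_
      rw [← infoHistory_eq_of_le h hf]
      exact Nat.find_spec (N.terminates f)
  rw [InformationMap.info, InformationMap.info, ← h1, infoHistory_eq_of_le h hf]

/-- The infimum in the definition of the cost is attained. -/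
theorem exists_informationMap_of_detCost_le {A : F → G} {n : ℕ} (h : detCost Λ A ≤ n) :
    ∃ (N : InformationMap Λ) (φ : List 𝕂 → G), A = φ ∘ N.info ∧ ∀ f, N.count f ≤ n := by
  have h1 : detCost Λ A < (n : ℕ∞) + 1 := by
    rw [ENat.lt_add_one_iff (by simp)]
    exact h
  simp only [detCost, iInf_lt_iff] at h1
  obtain ⟨N, ⟨φ, hφ⟩, hN⟩ := h1
  rw [ENat.lt_add_one_iff (by simp)] at hN
  exact ⟨N, φ, hφ, fun f => by exact_mod_cast (le_iSup (fun f => (N.count f : ℕ∞)) f).trans hN⟩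

end Information

/-! ### Lower bounds from Gaussian inputs -/

section LowerBound

variable {𝕂 F G : Type*} [RCLike 𝕂] [MetricSpace G] {Λ : Set (F → 𝕂)} {S : F → G}
  {V : Type*} [NormedAddCommGroup V] [InnerProductSpace ℝ V]

/-- The inputs on which an algorithm using `n` measurements is accurate form a thin set. -/
theorem thin_of_detCost_le {A : F → G} {n : ℕ} (hA : detCost Λ A ≤ n) {s : V → F} {E : Set V}
    {c δ : ℝ} (hc : 0 < c) (hlin : ∀ ℓ ∈ Λ, ∃ ℓ' : V →ₗ[ℝ] 𝕂, ∀ x ∈ E, ℓ (s x) = ℓ' x)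
    (hS : ∀ x ∈ E, ∀ y ∈ E, c * dist x y ≤ dist (S (s x)) (S (s y)))
    (hE : ∀ x ∈ E, dist (S (s x)) (A (s x)) ≤ δ) : Thin 𝕂 (2 * δ / c) n E := by
  obtain ⟨N, φ, rfl, hN⟩ := exists_informationMap_of_detCost_le hA
  suffices H : ∀ k j, j + k = n → ∀ y, Thin 𝕂 (2 * δ / c) k
      {x | x ∈ E ∧ infoHistory N.L (s x) j = y} by
    refine (H n 0 (zero_add n) []).mono fun x hx => ⟨hx, rfl⟩
  intro k
  induction k with
  | zero =>
    rintro j rfl y x ⟨hx, hxy⟩ x' ⟨hx', hxy'⟩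
    have h1 : N.info (s x) = N.info (s x') := N.info_eq (hxy.trans hxy'.symm) (hN _)
    have h2 := hE x hx
    have h3 := hE x' hx'
    simp only [Function.comp_apply] at h2 h3
    rw [← h1] at h3
    rw [le_div_iff₀ hc, mul_comm]
    linarith [hS x hx x' hx', dist_triangle_right (S (s x)) (S (s x')) (φ (N.info (s x)))]
  | succ k ih =>
    intro j hj y
    obtain ⟨ℓ, hℓ⟩ := hlin _ (N.mem y)
    refine ⟨ℓ, fun z => (ih (j + 1) (by omega) (y ++ [z])).mono ?_⟩
    rintro x ⟨⟨hx, hxy⟩, hz⟩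
    refine ⟨hx, ?_⟩
    rw [infoHistory, hxy, hℓ x hx, show ℓ x = z from hz]

variable [FiniteDimensional ℝ V] [MeasurableSpace V] [BorelSpace V]

/-- In dimension `4 n`, sets resolved up to `√(n / 40)` by `n` measurements carry at most a third of
the Gaussian mass: `exp (3 π / 40) ≤ 4 / 3`, and `(4 / 3) * 4 / 2 ^ 4 = 1 / 3`. -/
theorem Thin.gaussianVolume_real_le {n : ℕ} (hn : 1 ≤ n) (hV : Module.finrank ℝ V = 4 * n)
    {E : Set V} (h : Thin 𝕂 (√(n / 40)) n E) (hE : MeasurableSet E) :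
    (gaussianVolume V).real E ≤ 1 / 3 := by
  have h1 := h.gaussianVolume_le hE
  have h2 := ENNReal.toReal_mono (ENNReal.mul_ne_top ENNReal.ofReal_ne_top (by finiteness)) h1
  rw [ENNReal.toReal_mul, ENNReal.toReal_mul, ENNReal.toReal_ofReal (Real.exp_pos _).le, hV,
    ENNReal.toReal_pow, ENNReal.toReal_pow, Real.sq_sqrt (by positivity)] at h2
  simp only [ENNReal.toReal_ofNat] at h2
  change (gaussianVolume V).real E * _ ≤ _ at h2
  have h3 : Real.exp (3 * Real.pi * (n / 40)) ≤ (4 / 3) ^ n := by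
    have h4 : 3 * Real.pi * (n / 40) ≤ n * (1 / 4) := by
      have := Real.pi_lt_d2
      have hn' : (0 : ℝ) ≤ n := by positivity
      nlinarith
    refine (Real.exp_le_exp.2 h4).trans ?_
    rw [Real.exp_nat_mul]
    gcongr
    have h5 : Real.exp (1 / 4) ^ 4 ≤ (4 / 3) ^ 4 := by
      rw [← Real.exp_nat_mul]
      have := Real.exp_one_lt_d9
      norm_num at this ⊢
      linarith
    exact le_of_pow_le_pow_left₀ (by norm_num) (by norm_num) h5
  have h6 : (gaussianVolume V).real E * 16 ^ n ≤ (1 / 3) ^ n * 16 ^ n := by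
    calc _ = (gaussianVolume V).real E * 2 ^ (4 * n) := by rw [pow_mul]; norm_num
      _ ≤ _ := h2
      _ ≤ (4 / 3) ^ n * 4 ^ n := by gcongr
      _ = _ := by rw [← mul_pow, ← mul_pow]; norm_num
  refine (le_of_mul_le_mul_right h6 (by positivity)).trans ?_
  calc (1 / 3 : ℝ) ^ n ≤ (1 / 3) ^ 1 := pow_le_pow_of_le_one (by norm_num) (by norm_num) hn
    _ = 1 / 3 := pow_one _

/-- The ball of radius `2 √n` carries most of the Gaussian mass in dimension `4 n`. -/
theorem gaussianVolume_real_closedBall_ge {n : ℕ} (hn : 1 ≤ n) (hV : Module.finrank ℝ V = 4 * n) :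
    5 / 6 ≤ (gaussianVolume V).real (Metric.closedBall 0 (2 * √n)) := by
  have hm : MeasurableSet (Metric.closedBall (0 : V) (2 * √n)) :=
    Metric.isClosed_closedBall.measurableSet
  have h1 := gaussianVolume_compl_closedBall_le (V := V) (R := 2 * √n) (by positivity)
  have h2 := ENNReal.toReal_mono (ENNReal.mul_ne_top ENNReal.ofReal_ne_top (by finiteness)) h1
  rw [ENNReal.toReal_mul, ENNReal.toReal_ofReal (Real.exp_pos _).le, hV,
    ENNReal.toReal_pow, mul_pow, Real.sq_sqrt (by positivity)] at h2
  simp only [ENNReal.toReal_ofNat] at h2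
  change (gaussianVolume V).real _ ≤ _ at h2
  have h3 : Real.exp (-(3 / 4 * Real.pi * (2 ^ 2 * n))) ≤ (1 / 96) ^ n := by
    have h4 : -(3 / 4 * Real.pi * (2 ^ 2 * n)) ≤ n * (-9) := by
      have := Real.pi_gt_three
      have hn' : (0 : ℝ) ≤ n := by positivity
      nlinarith
    refine (Real.exp_le_exp.2 h4).trans ?_
    rw [Real.exp_nat_mul]
    gcongr
    rw [Real.exp_neg, one_div]
    gcongr
    have h5 : (2 : ℝ) ^ 9 ≤ Real.exp 1 ^ 9 := by
      gcongr
      have := Real.exp_one_gt_d9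
      linarith
    rw [← Real.exp_nat_mul] at h5
    norm_num at h5 ⊢
    linarith
  have h6 : (gaussianVolume V).real (Metric.closedBall 0 (2 * √n))ᶜ ≤ 1 / 6 := by
    calc _ ≤ _ := h2
      _ ≤ (1 / 96) ^ n * 2 ^ (4 * n) := by gcongr
      _ = (1 / 6) ^ n := by rw [pow_mul, ← mul_pow]; norm_num
      _ ≤ (1 / 6) ^ 1 := pow_le_pow_of_le_one (by norm_num) (by norm_num) hn
      _ = 1 / 6 := pow_one _
  rw [probReal_compl_eq_one_sub hm] at h6
  linarith

/-- Lower bound for deterministic algorithms: if the class of inputs contains a linear image of a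
ball of dimension `4 n` on which the solution operator expands distances by at least `c`, then `n`
measurements leave an error of order `c √n`. -/
theorem le_minError_detProblem {n : ℕ} (hn : 1 ≤ n) (hV : Module.finrank ℝ V = 4 * n) {s : V → F}
    {c : ℝ} (hc : 0 < c)
    (hlin : ∀ ℓ ∈ Λ, ∃ ℓ' : V →ₗ[ℝ] 𝕂, ∀ x ∈ Metric.closedBall 0 (2 * √n), ℓ (s x) = ℓ' x)
    (hS : ∀ x ∈ Metric.closedBall 0 (2 * √n), ∀ y ∈ Metric.closedBall 0 (2 * √n),
      c * dist x y ≤ dist (S (s x)) (S (s y))) :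
    ENNReal.ofReal (c * √(n / 40) / 2) ≤ (detProblem S Λ).minError n := by
  refine le_iInf₂ fun A hA => ?_
  by_contra! hlt
  have hm : MeasurableSet (Metric.closedBall (0 : V) (2 * √n)) :=
    Metric.isClosed_closedBall.measurableSet
  have hthin : Thin 𝕂 (√(n / 40)) n (Metric.closedBall (0 : V) (2 * √n)) := by
    have := thin_of_detCost_le (S := S) (δ := c * √(n / 40) / 2) hA hc hlin hS fun x _ => ?_
    · convert this using 1
      field_simp
    · have h1 : edist (S (s x)) (A.1 (s x)) ≤ ENNReal.ofReal (c * √(n / 40) / 2) :=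
        (le_iSup (fun f => edist (S f) (A.1 f)) (s x)).trans hlt.le
      rw [edist_dist] at h1
      exact (ENNReal.ofReal_le_ofReal_iff (by positivity)).1 h1
  have h1 := hthin.gaussianVolume_real_le hn hV hm
  have h2 := gaussianVolume_real_closedBall_ge hn hV
  linarith

/-- Lower bound for randomized algorithms: averaging over a Gaussian input reduces the claim to
deterministic algorithms, each of which is accurate only on a thin set of inputs. -/
theorem le_minError_ranProblem.{w} {P : Type*} [TopologicalSpace P] {plots : Set (P → F)} {n : ℕ}
    (hn : 1 ≤ n) (hV : Module.finrank ℝ V = 4 * n) {κ : V → P}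
    (hκ : @Measurable V P _ (borel P) κ) {p : P → F} (hp : p ∈ plots) {c : ℝ} (hc : 0 < c)
    (hlin : ∀ ℓ ∈ Λ, ∃ ℓ' : V →ₗ[ℝ] 𝕂, ∀ x ∈ Metric.closedBall 0 (2 * √n), ℓ (p (κ x)) = ℓ' x)
    (hS : ∀ x ∈ Metric.closedBall 0 (2 * √n), ∀ y ∈ Metric.closedBall 0 (2 * √n),
      c * dist x y ≤ dist (S (p (κ x))) (S (p (κ y)))) :
    ENNReal.ofReal (c * √(n / 40) / 4) ≤ (ranProblem.{w} S Λ plots).minError n := by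
  refine le_iInf₂ fun A hA => ?_
  let _ := A.mΩ
  have := A.isProb
  let _ : MeasurableSpace P := borel P
  set δ := c * √(n / 40) / 2 with hδ
  have hδ0 : 0 < δ := by
    have : (0 : ℝ) < n := by exact_mod_cast hn
    positivity
  set B := Metric.closedBall (0 : V) (2 * √n)
  have hB : MeasurableSet B := Metric.isClosed_closedBall.measurableSet
  set e : V × A.Ω → ℝ := fun z => dist (S (p (κ z.1))) (A.A z.2 (p (κ z.1))) with he
  have hem : Measurable e :=
    (A.meas p hp).comp ((hκ.comp measurable_fst).prodMk measurable_snd)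
  set err := (ranProblem.{w} S Λ plots).err A
  -- the mean square error is at most `err ^ 2` for each input
  have h1 : ∀ x, ∫⁻ ω, ENNReal.ofReal (e (x, ω)) ^ 2 ∂A.prob ≤ err ^ 2 := by
    intro x
    have h2 : (∫⁻ ω, edist (S (p (κ x))) (A.A ω (p (κ x))) ^ 2 ∂A.prob) ^ (1 / 2 : ℝ) ≤ err :=
      le_iSup (fun f => (∫⁻ ω, edist (S f) (A.A ω f) ^ 2 ∂A.prob) ^ (1 / 2 : ℝ)) (p (κ x))
    have h3 := pow_le_pow_left' h2 2
    rw [← ENNReal.rpow_natCast, ← ENNReal.rpow_mul] at h3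
    norm_num at h3
    simpa [he, edist_dist] using h3
  -- for each realization, the average error over the ball is large
  have h2 : ∀ ω, ENNReal.ofReal (δ ^ 2 / 2) ≤
      ∫⁻ x in B, ENNReal.ofReal (e (x, ω)) ^ 2 ∂gaussianVolume V := by
    intro ω
    have hcost : detCost Λ (A.A ω) ≤ n := (le_iSup (fun ω => detCost Λ (A.A ω)) ω).trans hA
    have heω : Measurable fun x => e (x, ω) := hem.comp (measurable_id.prodMk measurable_const)
    have hE : MeasurableSet (B ∩ {x | e (x, ω) ≤ δ}) :=
      hB.inter (measurableSet_le heω measurable_const)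
    have hthin : Thin 𝕂 (√(n / 40)) n (B ∩ {x | e (x, ω) ≤ δ}) := by
      have := thin_of_detCost_le (S := S) (s := fun x => p (κ x)) (δ := δ)
        (E := B ∩ {x | e (x, ω) ≤ δ}) hcost hc
        (fun ℓ hℓ => (hlin ℓ hℓ).imp fun ℓ' h x hx => h x hx.1)
        (fun x hx y hy => hS x hx.1 y hy.1) (fun x hx => hx.2)
      convert this using 1
      rw [hδ]
      field_simp
    have h3 := hthin.gaussianVolume_real_le hn hV hE
    have h4 := gaussianVolume_real_closedBall_ge hn hV
    have h5 : 1 / 2 ≤ (gaussianVolume V).real (B \ (B ∩ {x | e (x, ω) ≤ δ})) := by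
      rw [measureReal_sdiff Set.inter_subset_left hE]
      linarith
    calc ENNReal.ofReal (δ ^ 2 / 2)
        ≤ ENNReal.ofReal (δ ^ 2) * gaussianVolume V (B \ (B ∩ {x | e (x, ω) ≤ δ})) := by
          rw [← ofReal_measureReal, ← ENNReal.ofReal_mul (by positivity)]
          refine ENNReal.ofReal_le_ofReal ?_
          nlinarith [sq_nonneg δ]
      _ = ∫⁻ x in B \ (B ∩ {x | e (x, ω) ≤ δ}), ENNReal.ofReal (δ ^ 2) ∂gaussianVolume V := by
          rw [setLIntegral_const]
      _ ≤ ∫⁻ x in B \ (B ∩ {x | e (x, ω) ≤ δ}), ENNReal.ofReal (e (x, ω)) ^ 2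
            ∂gaussianVolume V := by
          refine setLIntegral_mono (by fun_prop) fun x hx => ?_
          have h6 : δ ≤ e (x, ω) := by
            by_contra! h7
            exact hx.2 ⟨hx.1, h7.le⟩
          rw [← ENNReal.ofReal_pow (hδ0.le.trans h6)]
          gcongr
      _ ≤ _ := lintegral_mono_set Set.sdiff_subset
  have h3 : ENNReal.ofReal (δ ^ 2 / 2) ≤ err ^ 2 := by
    calc ENNReal.ofReal (δ ^ 2 / 2) = ∫⁻ _, ENNReal.ofReal (δ ^ 2 / 2) ∂A.prob := by simp
      _ ≤ ∫⁻ ω, ∫⁻ x in B, ENNReal.ofReal (e (x, ω)) ^ 2 ∂gaussianVolume V ∂A.prob :=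
          lintegral_mono h2
      _ = ∫⁻ x in B, ∫⁻ ω, ENNReal.ofReal (e (x, ω)) ^ 2 ∂A.prob ∂gaussianVolume V := by
          rw [lintegral_lintegral_swap]
          exact ((hem.comp measurable_swap).ennreal_ofReal.pow_const 2).aemeasurable
      _ ≤ ∫⁻ x in B, err ^ 2 ∂gaussianVolume V := lintegral_mono h1
      _ ≤ err ^ 2 := by
          rw [setLIntegral_const]
          exact mul_le_of_le_one_right' prob_le_one
  have h4 : ENNReal.ofReal (c * √(n / 40) / 4) ^ 2 ≤ err ^ 2 := by
    refine le_trans ?_ h3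
    rw [← ENNReal.ofReal_pow (by positivity)]
    refine ENNReal.ofReal_le_ofReal ?_
    rw [hδ]
    nlinarith [sq_nonneg (c * √(n / 40))]
  exact (ENNReal.pow_right_strictMono two_ne_zero).le_iff_le.1 h4

end LowerBound

/-! ### Lower bounds for embeddings with orthogonal images -/

section HilbertLowerBound

variable {𝕂 H D : Type*} [RCLike 𝕂] [NormedAddCommGroup H] [InnerProductSpace 𝕂 H]
  [MeasurableSpace D] {μ : Measure D} {n : ℕ}

theorem Orthonormal.norm_sq_sum_smul {ι : Type*} {v : ι → H} (hv : Orthonormal 𝕂 v) (s : Finset ι)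
    (c : ι → 𝕂) : ‖∑ i ∈ s, c i • v i‖ ^ 2 = ∑ i ∈ s, ‖c i‖ ^ 2 := by
  have h1 : ((‖∑ i ∈ s, c i • v i‖ ^ 2 : ℝ) : 𝕂) = ((∑ i ∈ s, ‖c i‖ ^ 2 : ℝ) : 𝕂) := by
    push_cast
    rw [← inner_self_eq_norm_sq_to_K (𝕜 := 𝕂), hv.inner_sum]
    simp [RCLike.conj_mul]
  exact_mod_cast h1

theorem exists_realLinear_eq_sum {m : ℕ} (a : Fin m → 𝕂) :
    ∃ ℓ : EuclideanSpace ℝ (Fin m) →ₗ[ℝ] 𝕂, ∀ x, ℓ x = ∑ i, (x i : 𝕂) * a i := by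
  refine ⟨∑ i, (EuclideanSpace.proj i : EuclideanSpace ℝ (Fin m) →L[ℝ] ℝ).toLinearMap.smulRight
    (a i), fun x => ?_⟩
  simp [RCLike.real_smul_eq_coe_mul]

theorem Orthonormal.norm_sum_ofReal_smul {m : ℕ} {v : Fin m → H} (hv : Orthonormal 𝕂 v)
    (x : EuclideanSpace ℝ (Fin m)) : ‖∑ i, (x i : 𝕂) • v i‖ = ‖x‖ := by
  rw [← sq_eq_sq₀ (norm_nonneg _) (norm_nonneg _), hv.norm_sq_sum_smul, EuclideanSpace.norm_sq_eq]
  simp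

/-- The scaled coordinate map from the ball of radius `2 √n` onto the real span of `v` in the unit
ball of `H`, continued to the whole space by radial retraction. -/
noncomputable def ballEmbedding {v : Fin (4 * n) → H} (hv : Orthonormal 𝕂 v)
    (x : EuclideanSpace ℝ (Fin (4 * n))) : UnitBall H :=
  ⟨∑ i, (((max (2 * √n) ‖x‖)⁻¹ • x) i : 𝕂) • v i, by
    rw [mem_closedBall_zero_iff, hv.norm_sum_ofReal_smul, norm_smul, norm_inv, Real.norm_eq_abs,
      abs_of_nonneg (le_max_of_le_right (norm_nonneg x))]
    exact inv_mul_le_one_of_le₀ (le_max_right _ _) (le_max_of_le_right (norm_nonneg x))⟩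

theorem ballEmbedding_coe {v : Fin (4 * n) → H} (hv : Orthonormal 𝕂 v)
    {x : EuclideanSpace ℝ (Fin (4 * n))} (hx : x ∈ Metric.closedBall 0 (2 * √n)) :
    (ballEmbedding hv x : H) = ∑ i, (x i : 𝕂) • (((2 * √n)⁻¹ : ℝ) : 𝕂) • v i := by
  rw [mem_closedBall_zero_iff] at hx
  simp only [ballEmbedding, max_eq_left hx, PiLp.smul_apply, smul_eq_mul, smul_smul]
  refine Finset.sum_congr rfl fun i _ => ?_
  push_cast
  ring_nf

theorem continuous_ballEmbedding (hn : 1 ≤ n) {v : Fin (4 * n) → H} (hv : Orthonormal 𝕂 v) :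
    Continuous (ballEmbedding hv) := by
  have h0 : ∀ x : EuclideanSpace ℝ (Fin (4 * n)), max (2 * √n) ‖x‖ ≠ 0 := by
    intro x
    have : (0 : ℝ) < n := by exact_mod_cast hn
    have : 0 < 2 * √n := by positivity
    exact (lt_max_of_lt_left this).ne'
  have h1 : Continuous fun x : EuclideanSpace ℝ (Fin (4 * n)) => (max (2 * √n) ‖x‖)⁻¹ • x :=
    ((continuous_const.max continuous_norm).inv₀ h0).smul continuous_id
  refine Continuous.subtype_mk (continuous_finsetSum _ fun i _ => Continuous.smul ?_
    continuous_const) _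
  exact RCLike.continuous_ofReal.comp ((EuclideanSpace.proj (𝕜 := ℝ) i).continuous.comp h1)

theorem measurable_ballEmbedding (hn : 1 ≤ n) {v : Fin (4 * n) → H} (hv : Orthonormal 𝕂 v) :
    @Measurable _ _ _ (borel (UnitBall H)) (ballEmbedding hv) := by
  let _ : MeasurableSpace (UnitBall H) := borel _
  have : BorelSpace (UnitBall H) := ⟨rfl⟩
  exact (continuous_ballEmbedding hn hv).measurable

variable {J : H →L[𝕂] Lp 𝕂 2 μ} {v : Fin (4 * n) → H} {σ : ℝ}

theorem norm_sum_smul_ge {m : ℕ} {G : Type*} [NormedAddCommGroup G] [InnerProductSpace 𝕂 G]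
    {w : Fin m → G} (hw : ∀ i j, i ≠ j → inner 𝕂 (w i) (w j) = 0) (hσ : 0 ≤ σ)
    (hσw : ∀ i, σ ≤ ‖w i‖) (x : EuclideanSpace ℝ (Fin m)) :
    σ * ‖x‖ ≤ ‖∑ i, (x i : 𝕂) • w i‖ := by
  refine le_of_sq_le_sq ?_ (norm_nonneg _)
  have h1 : ‖∑ i, (x i : 𝕂) • w i‖ ^ 2 = ∑ i, ‖x i‖ ^ 2 * ‖w i‖ ^ 2 := by
    have h2 : ((‖∑ i, (x i : 𝕂) • w i‖ ^ 2 : ℝ) : 𝕂) =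
        ((∑ i, ‖x i‖ ^ 2 * ‖w i‖ ^ 2 : ℝ) : 𝕂) := by
      push_cast
      rw [← inner_self_eq_norm_sq_to_K (𝕜 := 𝕂), sum_inner]
      refine Finset.sum_congr rfl fun i _ => ?_
      rw [inner_sum, Finset.sum_eq_single i]
      · rw [inner_smul_left, inner_smul_right, inner_self_eq_norm_sq_to_K, RCLike.conj_ofReal,
          ← mul_assoc, ← sq]
        congr 1
        rw [← RCLike.ofReal_pow, ← RCLike.ofReal_pow, Real.norm_eq_abs, sq_abs]
      · intro j _ hj
        rw [inner_smul_left, inner_smul_right, hw i j hj.symm, mul_zero, mul_zero]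
      · simp
    exact_mod_cast h2
  rw [h1, mul_pow, EuclideanSpace.norm_sq_eq, Finset.mul_sum]
  refine Finset.sum_le_sum fun i _ => ?_
  rw [mul_comm]
  have := hσw i
  gcongr

/-- Distances in the ball are expanded by at least `σ / (2 √n)` under the solution operator. -/
theorem ballEmbedding_expands (hn : 1 ≤ n) (hv : Orthonormal 𝕂 v)
    (hJ : ∀ i j, i ≠ j → inner 𝕂 (J (v i)) (J (v j)) = 0) (hσ : 0 < σ)
    (hσv : ∀ i, σ ≤ ‖J (v i)‖) :
    ∀ x ∈ Metric.closedBall 0 (2 * √n), ∀ y ∈ Metric.closedBall 0 (2 * √n),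
      σ * (2 * √n)⁻¹ * dist x y ≤ dist (J (ballEmbedding hv x)) (J (ballEmbedding hv y)) := by
  intro x hx y hy
  have hn0 : (0 : ℝ) < n := by exact_mod_cast hn
  rw [dist_eq_norm, dist_eq_norm, ← map_sub, ballEmbedding_coe hv hx, ballEmbedding_coe hv hy,
    ← Finset.sum_sub_distrib, map_sum]
  have h1 : ∀ i, J ((x i : 𝕂) • (((2 * √n)⁻¹ : ℝ) : 𝕂) • v i -
      (y i : 𝕂) • (((2 * √n)⁻¹ : ℝ) : 𝕂) • v i) =
      ((x - y) i : 𝕂) • (((2 * √n)⁻¹ : ℝ) : 𝕂) • J (v i) := by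
    intro i
    rw [← sub_smul, map_smul, map_smul]
    simp
  simp only [h1]
  refine norm_sum_smul_ge (fun i j hij => ?_) (by positivity) (fun i => ?_) _
  · rw [inner_smul_left, inner_smul_right, hJ i j hij, mul_zero, mul_zero]
  · rw [norm_smul, RCLike.norm_ofReal, abs_of_pos (by positivity), mul_comm]
    exact mul_le_mul_of_nonneg_left (hσv i) (by positivity)

theorem linInfo_ballEmbedding (hv : Orthonormal 𝕂 v) {ℓ : UnitBall H → 𝕂}
    (hℓ : ℓ ∈ linInfo 𝕂 H) : ∃ ℓ' : EuclideanSpace ℝ (Fin (4 * n)) →ₗ[ℝ] 𝕂,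
      ∀ x ∈ Metric.closedBall 0 (2 * √n), ℓ (ballEmbedding hv x) = ℓ' x := by
  obtain ⟨g, hg⟩ := hℓ
  obtain ⟨ℓ', hℓ'⟩ := exists_realLinear_eq_sum fun i => g ((((2 * √n)⁻¹ : ℝ) : 𝕂) • v i)
  refine ⟨ℓ', fun x hx => ?_⟩
  rw [hg, hℓ', ballEmbedding_coe hv hx, map_sum]
  simp only [map_smul, smul_eq_mul]

theorem div_le_mul_sqrt (hn : 1 ≤ n) (hσ : 0 < σ) :
    σ / 64 ≤ σ * (2 * √n)⁻¹ * √(n / 40) / 4 := by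
  have hn0 : (0 : ℝ) < n := by exact_mod_cast hn
  rw [Real.sqrt_div hn0.le]
  have h1 : √(40 : ℝ) ≤ 8 := by
    rw [Real.sqrt_le_left (by norm_num)]
    norm_num
  have h2 : σ * (2 * √n)⁻¹ * (√n / √40) / 4 = σ / (8 * √40) := by
    have : √(n : ℝ) ≠ 0 := by positivity
    field_simp
    norm_num
  rw [h2]
  gcongr
  linarith

/-- If `J` maps `4 n` orthonormal vectors to orthogonal vectors of norm at least `σ`, then the error
of deterministic algorithms with `n` linear measurements is at least of order `σ`. -/
theorem le_minError_linDetProblem (hn : 1 ≤ n) (hv : Orthonormal 𝕂 v)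
    (hJ : ∀ i j, i ≠ j → inner 𝕂 (J (v i)) (J (v j)) = 0) (hσ : 0 < σ)
    (hσv : ∀ i, σ ≤ ‖J (v i)‖) :
    ENNReal.ofReal (σ / 64) ≤ (linDetProblem J).minError n := by
  have hn0 : (0 : ℝ) < n := by exact_mod_cast hn
  refine le_trans (ENNReal.ofReal_le_ofReal ?_) (le_minError_detProblem (𝕂 := 𝕂)
    (V := EuclideanSpace ℝ (Fin (4 * n))) hn (by simp) (s := ballEmbedding hv)
    (c := σ * (2 * √n)⁻¹) (by positivity) (fun ℓ hℓ => linInfo_ballEmbedding hv hℓ)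
    (ballEmbedding_expands hn hv hJ hσ hσv))
  refine (div_le_mul_sqrt hn hσ).trans ?_
  gcongr
  norm_num

/-- The same lower bound for randomized algorithms with linear information. -/
theorem le_minError_linRanProblem.{w} (hn : 1 ≤ n) (hv : Orthonormal 𝕂 v)
    (hJ : ∀ i j, i ≠ j → inner 𝕂 (J (v i)) (J (v j)) = 0) (hσ : 0 < σ)
    (hσv : ∀ i, σ ≤ ‖J (v i)‖) :
    ENNReal.ofReal (σ / 64) ≤ (linRanProblem.{w} J).minError n := by
  have hn0 : (0 : ℝ) < n := by exact_mod_cast hn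
  exact (ENNReal.ofReal_le_ofReal (div_le_mul_sqrt hn hσ)).trans (le_minError_ranProblem (𝕂 := 𝕂)
    (V := EuclideanSpace ℝ (Fin (4 * n))) hn (by simp) (measurable_ballEmbedding hn hv)
    (Set.mem_singleton _) (by positivity) (fun ℓ hℓ => linInfo_ballEmbedding hv hℓ)
    (ballEmbedding_expands hn hv hJ hσ hσv))

/-- The family of function inputs that projects onto the span of an orthonormal family and uses a
fixed representative of each basis vector. -/
noncomputable def projectionFamily {m : ℕ} {v : Fin m → H} (hv : Orthonormal 𝕂 v)
    {𝓕 : Submodule 𝕂 (D → 𝕂)} {g : Fin m → D → 𝕂} (hg : ∀ i, g i ∈ 𝓕)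
    (hgJ : ∀ i, g i =ᵐ[μ] J (v i)) (t : UnitBall H) : FunctionInput J (𝓕 : Set (D → 𝕂)) :=
  ⟨(⟨∑ i, inner 𝕂 (v i) (t : H) • v i, by
      rw [mem_closedBall_zero_iff, ← sq_le_one_iff₀ (norm_nonneg _), hv.norm_sq_sum_smul]
      refine (hv.sum_inner_products_le (t : H)).trans ?_
      have := mem_closedBall_zero_iff.1 t.2
      exact pow_le_one₀ (norm_nonneg _) this⟩,
    ∑ i, inner 𝕂 (v i) (t : H) • g i),
    show ∑ i, inner 𝕂 (v i) (t : H) • g i ∈ 𝓕 from 𝓕.sum_mem fun i _ => 𝓕.smul_mem _ (hg i), by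
      have h1 : ∀ i, ∀ᵐ x ∂μ, (inner 𝕂 (v i) (t : H) • J (v i) : Lp 𝕂 2 μ) x =
          inner 𝕂 (v i) (t : H) * g i x := by
        intro i
        filter_upwards [Lp.coeFn_smul (inner 𝕂 (v i) (t : H)) (J (v i)), hgJ i] with x h2 h3
        rw [h2, Pi.smul_apply, h3, smul_eq_mul]
      filter_upwards [ae_all_iff.2 h1, Lp.coeFn_finsetSum Finset.univ
        fun i => (inner 𝕂 (v i) (t : H) • J (v i) : Lp 𝕂 2 μ)] with x h2 h3
      simp only [map_sum, map_smul]
      rw [h3]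
      simp [h2]⟩

theorem projectionFamily_mem {m : ℕ} {v : Fin m → H} (hv : Orthonormal 𝕂 v)
    {𝓕 : Submodule 𝕂 (D → 𝕂)} {g : Fin m → D → 𝕂} (hg : ∀ i, g i ∈ 𝓕)
    (hgJ : ∀ i, g i =ᵐ[μ] J (v i)) (hgm : ∀ i, Measurable (g i)) :
    projectionFamily hv hg hgJ ∈ measurableFamilies J (𝓕 : Set (D → 𝕂)) := by
  let _ : MeasurableSpace (UnitBall H) := borel _
  have : BorelSpace (UnitBall H) := ⟨rfl⟩
  have hc : ∀ i, Continuous fun t : UnitBall H => inner 𝕂 (v i) (t : H) := fun i =>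
    continuous_const.inner continuous_subtype_val
  refine ⟨?_, ?_⟩
  · have : Continuous fun t => (projectionFamily hv hg hgJ t).1.1 :=
      Continuous.subtype_mk (by fun_prop : Continuous fun t : UnitBall H =>
        ∑ i, inner 𝕂 (v i) (t : H) • v i) _
    exact this.measurable
  · simp only [projectionFamily, Finset.sum_apply, Pi.smul_apply, smul_eq_mul]
    refine Finset.measurable_fun_sum _ fun i _ => ?_
    exact ((hc i).measurable.comp measurable_fst).mul ((hgm i).comp measurable_snd)

theorem projectionFamily_ballEmbedding (hv : Orthonormal 𝕂 v)
    {𝓕 : Submodule 𝕂 (D → 𝕂)} {g : Fin (4 * n) → D → 𝕂} (hg : ∀ i, g i ∈ 𝓕)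
    (hgJ : ∀ i, g i =ᵐ[μ] J (v i)) (x : EuclideanSpace ℝ (Fin (4 * n))) :
    (projectionFamily hv hg hgJ (ballEmbedding hv x)).1.1 = ballEmbedding hv x ∧
      (projectionFamily hv hg hgJ (ballEmbedding hv x)).1.2 =
        ∑ i, (((max (2 * √n) ‖x‖)⁻¹ • x) i : 𝕂) • g i := by
  have h1 : ∀ i, inner 𝕂 (v i) (ballEmbedding hv x : H) =
      (((max (2 * √n) ‖x‖)⁻¹ • x) i : 𝕂) := by
    intro i
    rw [ballEmbedding, hv.inner_right_fintype]
  refine ⟨Subtype.ext ?_, ?_⟩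
  · simp only [projectionFamily, h1]
    rfl
  · simp only [projectionFamily, h1]

/-- The same lower bound for randomized algorithms that use function values. Evaluations need not be
continuous on `H`, but along a linear choice of representatives of the span of `v` they are
linear functionals. -/
theorem le_minError_stdRanProblem.{w} (hn : 1 ≤ n) (hv : Orthonormal 𝕂 v)
    (hJ : ∀ i j, i ≠ j → inner 𝕂 (J (v i)) (J (v j)) = 0) (hσ : 0 < σ)
    (hσv : ∀ i, σ ≤ ‖J (v i)‖) {𝓕 : Submodule 𝕂 (D → 𝕂)} {g : Fin (4 * n) → D → 𝕂}
    (hg : ∀ i, g i ∈ 𝓕) (hgJ : ∀ i, g i =ᵐ[μ] J (v i)) (hgm : ∀ i, Measurable (g i)) :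
    ENNReal.ofReal (σ / 64) ≤ (stdRanProblem.{w} J (𝓕 : Set (D → 𝕂))).minError n := by
  have hn0 : (0 : ℝ) < n := by exact_mod_cast hn
  refine (ENNReal.ofReal_le_ofReal (div_le_mul_sqrt hn hσ)).trans (le_minError_ranProblem (𝕂 := 𝕂)
    (V := EuclideanSpace ℝ (Fin (4 * n))) hn (by simp) (measurable_ballEmbedding hn hv)
    (projectionFamily_mem hv hg hgJ hgm) (by positivity) ?_ ?_)
  · rintro ℓ ⟨z, hz⟩
    obtain ⟨ℓ', hℓ'⟩ := exists_realLinear_eq_sum fun i => (((2 * √n)⁻¹ : ℝ) : 𝕂) * g i z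
    refine ⟨ℓ', fun x hx => ?_⟩
    rw [mem_closedBall_zero_iff] at hx
    rw [hz, (projectionFamily_ballEmbedding hv hg hgJ x).2, hℓ', Finset.sum_apply, max_eq_left hx]
    refine Finset.sum_congr rfl fun i _ => ?_
    simp only [PiLp.smul_apply, smul_eq_mul, Pi.smul_apply]
    push_cast
    ring
  · intro x hx y hy
    simp only [inputApp, (projectionFamily_ballEmbedding hv hg hgJ _).1]
    exact ballEmbedding_expands hn hv hJ hσ hσv x hx y hy

end HilbertLowerBound

/-! ### Nonadaptive algorithms -/

section Nonadaptive

variable {𝕂 F G : Type*} {Λ : Set (F → 𝕂)}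

/-- Every function of the values of finitely many measurements, fixed in advance, is a deterministic
algorithm, and its cost is at most their number. The measurement `ℓ₀` only fills the unused part of
an information mapping. -/
theorem isDetAlgorithm_of_nonadaptive [Zero 𝕂] {κ : Type*} [Fintype κ] {ℓ : κ → F → 𝕂}
    (hℓ : ∀ k, ℓ k ∈ Λ) {ℓ₀ : F → 𝕂} (hℓ₀ : ℓ₀ ∈ Λ) (Φ : (κ → 𝕂) → G) :
    IsDetAlgorithm Λ (fun f => Φ fun k => ℓ k f) ∧
      detCost Λ (fun f => Φ fun k => ℓ k f) ≤ (Fintype.card κ : ℕ∞) := by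
  set n := Fintype.card κ
  let ε := Fintype.equivFin κ
  let L : List 𝕂 → F → 𝕂 := fun y => if h : y.length < n then ℓ (ε.symm ⟨y.length, h⟩) else ℓ₀
  let N : InformationMap Λ :=
    { L := L
      mem := fun y => by
        by_cases h : y.length < n
        · simpa only [L, dif_pos h] using hℓ _
        · simpa only [L, dif_neg h] using hℓ₀
      T := fun y => decide (y.length < n)
      terminates := fun f => ⟨n, by simp [length_infoHistory]⟩ }
  have hcount : ∀ f, N.count f = n := by
    intro f
    refine le_antisymm (Nat.find_min' _ (by simp [N, length_infoHistory])) ?_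
    have h1 : decide ((infoHistory L f (N.count f)).length < n) = false :=
      Nat.find_spec (N.terminates f)
    simpa only [length_infoHistory, decide_eq_false_iff_not, not_lt] using h1
  have hget : ∀ f j, ∀ i (hi : i < n), i < j →
      (infoHistory L f j)[i]? = some (ℓ (ε.symm ⟨i, hi⟩) f) := by
    intro f j
    induction j with
    | zero => intro i _ h; omega
    | succ j ih =>
      intro i hi hij
      rw [infoHistory]
      rcases (Nat.lt_succ_iff.1 hij).eq_or_lt with rfl | h
      · rw [List.getElem?_append_right (by rw [length_infoHistory]), length_infoHistory]
        simp [L, length_infoHistory, hi]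
      · rw [List.getElem?_append_left (by rwa [length_infoHistory])]
        exact ih i hi h
  have hA : (fun f => Φ fun k => ℓ k f) =
      (fun y : List 𝕂 => Φ fun k => (y[(ε k : ℕ)]?).getD 0) ∘ N.info := by
    funext f
    simp only [Function.comp_apply, InformationMap.info, hcount]
    congr 1
    funext k
    rw [hget f n (ε k) (ε k).2 (ε k).2]
    simp
  refine ⟨⟨N, _, hA⟩, ?_⟩
  refine (iInf₂_le N ⟨_, hA⟩).trans ?_
  simp [InformationMap.cost, hcount, n]

end Nonadaptive

/-! ### Projections as algorithms with linear information -/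

section LinearUpperBound

variable {𝕂 H D : Type*} [RCLike 𝕂] [NormedAddCommGroup H] [NormedSpace 𝕂 H]
  [MeasurableSpace D] {μ : Measure D} {J : H →L[𝕂] Lp 𝕂 2 μ} {ι : Type*} {τ : ℝ}

theorem isDetAlgorithm_projection (J : H →L[𝕂] Lp 𝕂 2 μ) (e : ι → Lp 𝕂 2 μ) (s : Finset ι) :
    IsDetAlgorithm (linInfo 𝕂 H) (fun f : UnitBall H => ∑ i ∈ s, inner 𝕂 (e i) (J f) • e i) ∧
      detCost (linInfo 𝕂 H) (fun f : UnitBall H => ∑ i ∈ s, inner 𝕂 (e i) (J f) • e i) ≤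
        (s.card : ℕ∞) := by
  have h := isDetAlgorithm_of_nonadaptive (Λ := linInfo 𝕂 H) (κ := s)
    (ℓ := fun i (f : UnitBall H) => inner 𝕂 (e i) (J f))
    (fun i => ⟨(innerSL 𝕂 (e i)).comp J, fun f => by simp⟩) (ℓ₀ := fun _ => 0)
    ⟨0, fun f => by simp⟩ (fun c => ∑ i : s, c i • e i)
  have h1 : (fun f : UnitBall H => ∑ i ∈ s, inner 𝕂 (e i) (J f) • e i) =
      fun f : UnitBall H => ∑ i : s, inner 𝕂 (e i) (J f) • e i := by
    funext f
    exact (Finset.sum_coe_sort s fun i => inner 𝕂 (e i) (J f) • e i).symm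
  rw [h1]
  simpa using h

theorem edist_projection_le {e : ι → Lp 𝕂 2 μ} {s : Finset ι} (hτ : 0 ≤ τ)
    (hs : ∀ f : H, ‖J f - ∑ i ∈ s, inner 𝕂 (e i) (J f) • e i‖ ≤ τ * ‖f‖) (f : UnitBall H) :
    edist (ballApp J f) (∑ i ∈ s, inner 𝕂 (e i) (J f) • e i) ≤ ENNReal.ofReal τ := by
  rw [edist_dist, dist_eq_norm]
  refine ENNReal.ofReal_le_ofReal ((hs f).trans ?_)
  exact mul_le_of_le_one_right hτ (mem_closedBall_zero_iff.1 f.2)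

theorem minError_linDetProblem_le {e : ι → Lp 𝕂 2 μ} {s : Finset ι} (hτ : 0 ≤ τ)
    (hs : ∀ f : H, ‖J f - ∑ i ∈ s, inner 𝕂 (e i) (J f) • e i‖ ≤ τ * ‖f‖) {n : ℕ}
    (hn : s.card ≤ n) : (linDetProblem J).minError n ≤ ENNReal.ofReal τ := by
  have h := isDetAlgorithm_projection J e s
  refine (iInf₂_le (show (linDetProblem J).Alg from ⟨_, h.1⟩) (h.2.trans (by exact_mod_cast hn))).trans ?_
  exact iSup_le (edist_projection_le hτ hs)

theorem minError_linRanProblem_le.{w} {e : ι → Lp 𝕂 2 μ} {s : Finset ι} (hτ : 0 ≤ τ)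
    (hs : ∀ f : H, ‖J f - ∑ i ∈ s, inner 𝕂 (e i) (J f) • e i‖ ≤ τ * ‖f‖) {n : ℕ}
    (hn : s.card ≤ n) : (linRanProblem.{w} J).minError n ≤ ENNReal.ofReal τ := by
  have h := isDetAlgorithm_projection J e s
  let A : RandomizedAlgorithm.{w} (ballApp J) (linInfo 𝕂 H) {(id : UnitBall H → UnitBall H)} :=
    { Ω := PUnit
      mΩ := ⊤
      prob := @Measure.dirac _ ⊤ PUnit.unit
      isProb := @Measure.dirac.isProbabilityMeasure _ ⊤ _
      A := fun _ f => ∑ i ∈ s, inner 𝕂 (e i) (J f) • e i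
      isAlg := fun _ => h.1
      meas := by
        rintro p rfl
        let _ : MeasurableSpace (UnitBall H) := borel _
        have : BorelSpace (UnitBall H) := ⟨rfl⟩
        have h1 : Continuous fun f : UnitBall H =>
            dist (ballApp J f) (∑ i ∈ s, inner 𝕂 (e i) (J f) • e i) := by
          unfold ballApp
          fun_prop
        exact h1.measurable.comp measurable_fst }
  refine (iInf₂_le A ?_).trans ?_
  · exact iSup_le fun _ => h.2.trans (by exact_mod_cast hn)
  · refine iSup_le fun f => ?_
    have h2 := edist_projection_le hτ hs f
    simp only [A]
    rw [lintegral_const, measure_univ, mul_one, ← ENNReal.rpow_natCast, ← ENNReal.rpow_mul]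
    norm_num
    exact h2

end LinearUpperBound

/-! ### Variance of sample means -/

section Variance

variable {𝕂 D : Type*} [RCLike 𝕂] [MeasurableSpace D] {κ : Measure D} [IsProbabilityMeasure κ]

theorem integral_norm_sub_integral_sq {F : D → 𝕂} (hF : MemLp F 2 κ) :
    ∫ x, ‖F x - ∫ y, F y ∂κ‖ ^ 2 ∂κ ≤ ∫ x, ‖F x‖ ^ 2 ∂κ := by
  set a := ∫ y, F y ∂κ with ha
  have hi : Integrable F κ := hF.integrable one_le_two
  have h1 : ∀ x, ‖F x - a‖ ^ 2 = ‖F x‖ ^ 2 - 2 * RCLike.re (starRingEnd 𝕂 a * F x) + ‖a‖ ^ 2 := by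
    intro x
    rw [@norm_sub_sq 𝕂, RCLike.inner_apply, ← RCLike.conj_re]
    simp
  have h2 : Integrable (fun x => RCLike.re (starRingEnd 𝕂 a * F x)) κ := (hi.const_mul _).re
  have h3 : Integrable (fun x => ‖F x‖ ^ 2) κ := hF.integrable_norm_pow two_ne_zero
  have h4 : ∫ x, RCLike.re (starRingEnd 𝕂 a * F x) ∂κ = ‖a‖ ^ 2 := by
    rw [integral_re (hi.const_mul _), integral_const_mul, ← ha, RCLike.conj_mul,
      ← RCLike.ofReal_pow, RCLike.ofReal_re]
  have h5 : ∫ x, ‖F x - a‖ ^ 2 ∂κ = ∫ x, ‖F x‖ ^ 2 ∂κ - 2 * ‖a‖ ^ 2 + ‖a‖ ^ 2 := by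
    simp only [h1]
    rw [integral_add (f := fun x => ‖F x‖ ^ 2 - 2 * RCLike.re (starRingEnd 𝕂 a * F x))
      (h3.sub (h2.const_mul 2)) (integrable_const _), integral_sub h3 (h2.const_mul 2),
      integral_const_mul, h4]
    simp
  rw [h5]
  nlinarith [sq_nonneg ‖a‖]

/-- The variance of the mean of `n` independent samples. -/
theorem integral_norm_average_sub_sq_le {F : D → 𝕂} (hFm : Measurable F) (hF : MemLp F 2 κ) {n : ℕ}
    (hn : 0 < n) :
    Integrable (fun x : Fin n → D => ‖∫ y, F y ∂κ - (n : 𝕂)⁻¹ * ∑ l, F (x l)‖ ^ 2)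
      (Measure.pi fun _ => κ) ∧
    ∫ x : Fin n → D, ‖∫ y, F y ∂κ - (n : 𝕂)⁻¹ * ∑ l, F (x l)‖ ^ 2 ∂(Measure.pi fun _ => κ) ≤
      (n : ℝ)⁻¹ * ∫ x, ‖F x‖ ^ 2 ∂κ := by
  set a := ∫ y, F y ∂κ with ha
  set ρ : Measure (Fin n → D) := Measure.pi fun _ => κ
  have hn0 : (n : 𝕂) ≠ 0 := by exact_mod_cast hn.ne'
  let Y : D → 𝕂 := fun x => F x - a
  have hYm : Measurable Y := hFm.sub_const a
  have hY : MemLp Y 2 κ := hF.sub (memLp_const a)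
  have hY0 : ∫ x, Y x ∂κ = 0 := by
    rw [integral_sub (hF.integrable one_le_two) (integrable_const a)]
    simp [ha]
  have hmp : ∀ l : Fin n, MeasurePreserving (fun x : Fin n → D => x l) ρ κ := fun l =>
    measurePreserving_eval _ l
  have hYl : ∀ l, MemLp (fun x : Fin n → D => Y (x l)) 2 ρ := fun l =>
    hY.comp_measurePreserving (hmp l)
  have hint : ∀ l k, Integrable (fun x : Fin n → D => starRingEnd 𝕂 (Y (x l)) * Y (x k)) ρ :=
    fun l k => MemLp.integrable_mul ((hYl l).star) (hYl k)
  have hterm : ∀ l k, ∫ x : Fin n → D, starRingEnd 𝕂 (Y (x l)) * Y (x k) ∂ρ =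
      if l = k then ((∫ x, ‖Y x‖ ^ 2 ∂κ : ℝ) : 𝕂) else 0 := by
    intro l k
    split_ifs with hlk
    · subst hlk
      have h1 : ∀ x, starRingEnd 𝕂 (Y x) * Y x = ((‖Y x‖ ^ 2 : ℝ) : 𝕂) := fun x => by
        rw [RCLike.conj_mul, RCLike.ofReal_pow]
      simp only [h1]
      rw [← integral_ofReal, ← (hmp l).map_eq, integral_map (measurable_pi_apply l).aemeasurable]
      exact (RCLike.continuous_ofReal.measurable.comp
        (hYm.norm.pow_const 2)).aestronglyMeasurable
    · have hind := ProbabilityTheory.iIndepFun_pi (μ := fun _ : Fin n => κ) (X := fun _ => Y)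
        (fun _ => hYm.aemeasurable)
      have h1 := (hind.indepFun hlk).comp (φ := starRingEnd 𝕂) (ψ := id)
        RCLike.continuous_conj.measurable measurable_id
      have h2 := h1.integral_fun_mul_eq_mul_integral
        ((RCLike.continuous_conj.measurable.comp
          (hYm.comp (measurable_pi_apply l))).aestronglyMeasurable)
        ((hYm.comp (measurable_pi_apply k)).aestronglyMeasurable)
      simp only [Function.comp_apply, id] at h2
      rw [h2]
      have h3 : ∫ x : Fin n → D, Y (x k) ∂ρ = 0 := by
        rw [← hY0, ← (hmp k).map_eq, integral_map (measurable_pi_apply k).aemeasurable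
          hYm.aestronglyMeasurable]
      rw [h3, mul_zero]
  have hpt : ∀ x : Fin n → D, a - (n : 𝕂)⁻¹ * ∑ l, F (x l) = -((n : 𝕂)⁻¹ * ∑ l, Y (x l)) := by
    intro x
    simp only [Y, Finset.sum_sub_distrib, Finset.sum_const, Finset.card_univ, Fintype.card_fin,
      nsmul_eq_mul]
    field_simp
    ring
  have hsum : MemLp (fun x : Fin n → D => a - (n : 𝕂)⁻¹ * ∑ l, F (x l)) 2 ρ := by
    simp only [hpt]
    exact ((memLp_finsetSum _ fun l _ => hYl l).const_mul _).neg
  refine ⟨hsum.integrable_norm_pow two_ne_zero, ?_⟩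
  have h4 : ((∫ x : Fin n → D, ‖∑ l, Y (x l)‖ ^ 2 ∂ρ : ℝ) : 𝕂) =
      ((n * ∫ x, ‖Y x‖ ^ 2 ∂κ : ℝ) : 𝕂) := by
    rw [← integral_ofReal]
    have h5 : ∀ x : Fin n → D, ((‖∑ l, Y (x l)‖ ^ 2 : ℝ) : 𝕂) =
        ∑ l, ∑ k, starRingEnd 𝕂 (Y (x l)) * Y (x k) := by
      intro x
      rw [RCLike.ofReal_pow, ← RCLike.conj_mul, map_sum, Finset.sum_mul_sum]
    simp only [h5]
    rw [integral_finsetSum _ fun l _ => integrable_finsetSum _ fun k _ => hint l k]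
    simp only [integral_finsetSum _ fun k _ => hint _ k, hterm]
    simp
  have h5 : ∫ x : Fin n → D, ‖∑ l, Y (x l)‖ ^ 2 ∂ρ = n * ∫ x, ‖Y x‖ ^ 2 ∂κ := by
    exact_mod_cast h4
  have h6 := integral_norm_sub_integral_sq hF
  simp only [hpt, norm_neg, norm_mul, mul_pow, norm_inv, RCLike.norm_natCast]
  rw [integral_const_mul, h5]
  have hn1 : (n : ℝ) ≠ 0 := by exact_mod_cast hn.ne'
  calc _ = (n : ℝ)⁻¹ * ∫ x, ‖Y x‖ ^ 2 ∂κ := by field_simp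
    _ ≤ _ := by gcongr

end Variance

/-! ### Importance sampling of coefficients -/

section ImportanceSampling

variable {𝕂 D : Type*} [RCLike 𝕂] [MeasurableSpace D] {μ : Measure D} {ι : Type*}

theorem Orthonormal.inner_sub_projection_eq_zero {G : Type*} [NormedAddCommGroup G]
    [InnerProductSpace 𝕂 G] {e : ι → G} (he : Orthonormal 𝕂 e) {t : Finset ι} (z : G) {i : ι}
    (hi : i ∈ t) : inner 𝕂 (e i) (z - ∑ j ∈ t, inner 𝕂 (e j) z • e j) = 0 := by
  rw [inner_sub_right, he.inner_right_sum _ hi, sub_self]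

theorem Orthonormal.norm_sub_sum_sq {G : Type*} [NormedAddCommGroup G] [InnerProductSpace 𝕂 G]
    {e : ι → G} (he : Orthonormal 𝕂 e) (t : Finset ι) (z : G) (c : ι → 𝕂) :
    ‖z - ∑ i ∈ t, c i • e i‖ ^ 2 =
      ‖z - ∑ i ∈ t, inner 𝕂 (e i) z • e i‖ ^ 2 + ∑ i ∈ t, ‖inner 𝕂 (e i) z - c i‖ ^ 2 := by
  have h1 : z - ∑ i ∈ t, c i • e i = (z - ∑ i ∈ t, inner 𝕂 (e i) z • e i) +
      ∑ i ∈ t, (inner 𝕂 (e i) z - c i) • e i := by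
    simp only [sub_smul, Finset.sum_sub_distrib]
    abel
  have h2 : inner 𝕂 (z - ∑ i ∈ t, inner 𝕂 (e i) z • e i)
      (∑ i ∈ t, (inner 𝕂 (e i) z - c i) • e i) = 0 := by
    rw [inner_sum]
    refine Finset.sum_eq_zero fun i hi => ?_
    rw [inner_smul_right, inner_eq_zero_symm.1 (he.inner_sub_projection_eq_zero z hi), mul_zero]
  rw [h1, sq, norm_add_sq_eq_norm_sq_add_norm_sq_of_inner_eq_zero _ _ h2, ← sq, ← sq,
    he.norm_sq_sum_smul]

theorem lintegral_enorm_sq_eq {z : Lp 𝕂 2 μ} {h : D → 𝕂} (hz : h =ᵐ[μ] z) :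
    ∫⁻ x, ‖h x‖ₑ ^ 2 ∂μ = ENNReal.ofReal (‖z‖ ^ 2) := by
  have h1 : ENNReal.ofReal ‖z‖ = eLpNorm h 2 μ := by
    rw [Lp.norm_def, ENNReal.ofReal_toReal (Lp.eLpNorm_ne_top z), eLpNorm_congr_ae hz]
  rw [ENNReal.ofReal_pow (norm_nonneg _), h1,
    eLpNorm_eq_lintegral_rpow_enorm_toReal two_ne_zero ENNReal.ofNat_ne_top]
  rw [← ENNReal.rpow_natCast, ← ENNReal.rpow_mul]
  norm_num

/-- Importance sampling for the coefficients with respect to finitely many orthonormal vectors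
`e i`, `i ∈ t`: for the probability density `u = (#t)⁻¹ ∑ |e i|²` and the weights
`conj (e i) / u`, the weighted function values have the coefficients as their mean, and their
second moments add up to at most `#t ‖z‖²`. -/
theorem exists_importance_sampling {e : ι → Lp 𝕂 2 μ} (he : Orthonormal 𝕂 e) {t : Finset ι}
    (ht : t.Nonempty) :
    ∃ κ : Measure D, IsProbabilityMeasure κ ∧ ∃ w : ι → D → 𝕂, (∀ i, Measurable (w i)) ∧
      ∀ (z : Lp 𝕂 2 μ) (h : D → 𝕂), Measurable h → h =ᵐ[μ] z →
        (∀ i ∈ t, MemLp (fun x => h x * w i x) 2 κ ∧ ∫ x, h x * w i x ∂κ = inner 𝕂 (e i) z) ∧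
        ∑ i ∈ t, ∫ x, ‖h x * w i x‖ ^ 2 ∂κ ≤ t.card * ‖z‖ ^ 2 := by
  have hem : ∀ i, Measurable (e i : D → 𝕂) := fun i => (Lp.stronglyMeasurable (e i)).measurable
  have hm0 : (0 : ℝ) < t.card := by exact_mod_cast ht.card_pos
  let u : D → ℝ := fun x => (t.card : ℝ)⁻¹ * ∑ i ∈ t, ‖(e i : D → 𝕂) x‖ ^ 2
  have hu0 : ∀ x, 0 ≤ u x := fun x => by positivity
  have hum : Measurable u :=
    (Finset.measurable_fun_sum _ fun i _ => (hem i).norm.pow_const 2).const_mul _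
  -- Where `u` vanishes, the junk value `0⁻¹ = 0` in the weights is harmless, as all `e i` vanish.
  have hue : ∀ x, u x = 0 → ∀ i ∈ t, (e i : D → 𝕂) x = 0 := by
    intro x hx i hi
    have h1 : ∑ i ∈ t, ‖(e i : D → 𝕂) x‖ ^ 2 = 0 := by
      rcases mul_eq_zero.1 hx with h | h
      · exact absurd h (inv_ne_zero hm0.ne')
      · exact h
    have := (Finset.sum_eq_zero_iff_of_nonneg fun i _ => by positivity).1 h1 i hi
    simpa using this
  let κ : Measure D := μ.withDensity fun x => ENNReal.ofReal (u x)
  have hprob : IsProbabilityMeasure κ := by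
    refine ⟨?_⟩
    rw [withDensity_apply _ MeasurableSet.univ, Measure.restrict_univ]
    have h1 : ∀ x, ENNReal.ofReal (u x) =
        ENNReal.ofReal (t.card : ℝ)⁻¹ * ∑ i ∈ t, ‖(e i : D → 𝕂) x‖ₑ ^ 2 := by
      intro x
      rw [ENNReal.ofReal_mul (by positivity), ENNReal.ofReal_sum_of_nonneg fun i _ => by positivity]
      congr 1
      refine Finset.sum_congr rfl fun i _ => ?_
      rw [ENNReal.ofReal_pow (norm_nonneg _), ofReal_norm]
    simp only [h1]
    rw [lintegral_const_mul _ (Finset.measurable_fun_sum _ fun i _ => by have := hem i; fun_prop),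
      lintegral_finsetSum _ fun i _ => by have := hem i; fun_prop]
    have h2 : ∀ i ∈ t, ∫⁻ x, ‖(e i : D → 𝕂) x‖ₑ ^ 2 ∂μ = 1 := by
      intro i _
      rw [lintegral_enorm_sq_eq (z := e i) Filter.EventuallyEq.rfl, he.1 i]
      simp
    rw [Finset.sum_congr rfl h2, Finset.sum_const, nsmul_eq_mul, mul_one, ← ENNReal.ofReal_natCast,
      ← ENNReal.ofReal_mul (by positivity), inv_mul_cancel₀ hm0.ne', ENNReal.ofReal_one]
  let w : ι → D → 𝕂 := fun i x => starRingEnd 𝕂 ((e i : D → 𝕂) x) * ((u x)⁻¹ : ℝ)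
  have hwm : ∀ i, Measurable (w i) := fun i =>
    (RCLike.continuous_conj.measurable.comp (hem i)).mul
      (RCLike.continuous_ofReal.measurable.comp hum.inv)
  refine ⟨κ, hprob, w, hwm, fun z h hhm hhz => ?_⟩
  have hhw : ∀ i, Measurable fun x => h x * w i x := fun i => hhm.mul (hwm i)
  -- the weighted second moments, summed over `t`
  have hsq : ∑ i ∈ t, ∫⁻ x, ‖h x * w i x‖ₑ ^ 2 ∂κ ≤ ENNReal.ofReal (t.card * ‖z‖ ^ 2) := by
    have h1 : ∀ x, ENNReal.ofReal (u x) * ∑ i ∈ t, ‖h x * w i x‖ₑ ^ 2 ≤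
        ENNReal.ofReal t.card * ‖h x‖ₑ ^ 2 := by
      intro x
      have h2 : u x * ∑ i ∈ t, ‖h x * w i x‖ ^ 2 ≤ t.card * ‖h x‖ ^ 2 := by
        have h3 : ∑ i ∈ t, ‖h x * w i x‖ ^ 2 =
            ‖h x‖ ^ 2 * (u x)⁻¹ ^ 2 * ∑ i ∈ t, ‖(e i : D → 𝕂) x‖ ^ 2 := by
          rw [Finset.mul_sum]
          refine Finset.sum_congr rfl fun i _ => ?_
          simp only [w, norm_mul, RCLike.norm_conj, RCLike.norm_ofReal, mul_pow, sq_abs]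
          ring
        have h4 : ∑ i ∈ t, ‖(e i : D → 𝕂) x‖ ^ 2 = t.card * u x := by
          simp only [u]
          rw [mul_inv_cancel_left₀ hm0.ne']
        rw [h3, h4]
        rcases (hu0 x).eq_or_lt with h5 | h5
        · rw [← h5, zero_mul]
          exact mul_nonneg hm0.le (sq_nonneg _)
        · have h6 : ∀ a b c : ℝ, 0 < a → a * (b * a⁻¹ ^ 2 * (c * a)) = c * b := by
            intro a b c ha
            field_simp
          exact (h6 _ _ _ h5).le
      have h3 := ENNReal.ofReal_le_ofReal h2
      rw [ENNReal.ofReal_mul (hu0 x), ENNReal.ofReal_mul hm0.le,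
        ENNReal.ofReal_sum_of_nonneg fun i _ => by positivity,
        ENNReal.ofReal_pow (norm_nonneg _), ofReal_norm] at h3
      refine le_trans (le_of_eq ?_) h3
      congr 1
      refine Finset.sum_congr rfl fun i _ => ?_
      rw [ENNReal.ofReal_pow (norm_nonneg _), ofReal_norm]
    rw [← lintegral_finsetSum _ fun i _ => (hhw i).enorm.pow_const 2]
    rw [lintegral_withDensity_eq_lintegral_mul _ hum.ennreal_ofReal
      (Finset.measurable_fun_sum _ fun i _ => (hhw i).enorm.pow_const 2)]
    refine (lintegral_mono fun x => h1 x).trans (le_of_eq ?_)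
    rw [lintegral_const_mul _ (by fun_prop), lintegral_enorm_sq_eq hhz,
      ENNReal.ofReal_mul (by positivity)]
  have hfin : ∀ i ∈ t, ∫⁻ x, ‖h x * w i x‖ₑ ^ 2 ∂κ < ⊤ := fun i hi =>
    ((Finset.single_le_sum (fun i _ => zero_le) hi).trans hsq).trans_lt ENNReal.ofReal_lt_top
  have hmem : ∀ i ∈ t, MemLp (fun x => h x * w i x) 2 κ := by
    intro i hi
    refine ⟨(hhm.mul (hwm i)).aestronglyMeasurable, ?_⟩
    rw [eLpNorm_lt_top_iff_lintegral_rpow_enorm_lt_top two_ne_zero ENNReal.ofNat_ne_top]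
    simpa using hfin i hi
  refine ⟨fun i hi => ⟨hmem i hi, ?_⟩, ?_⟩
  · rw [integral_withDensity_eq_integral_toReal_smul hum.ennreal_ofReal
      (Filter.Eventually.of_forall fun x => ENNReal.ofReal_lt_top), L2.inner_def]
    refine integral_congr_ae ?_
    filter_upwards [hhz] with x hx
    rw [ENNReal.toReal_ofReal (hu0 x), RCLike.inner_apply, ← hx, RCLike.real_smul_eq_coe_mul]
    by_cases h5 : u x = 0
    · simp [h5, hue x h5 i hi]
    · have h6 : (u x : 𝕂) ≠ 0 := by exact_mod_cast h5
      simp only [w]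
      push_cast
      field_simp
  · have h1 : ∀ i ∈ t, ENNReal.ofReal (∫ x, ‖h x * w i x‖ ^ 2 ∂κ) =
        ∫⁻ x, ‖h x * w i x‖ₑ ^ 2 ∂κ := by
      intro i hi
      rw [ofReal_integral_eq_lintegral_ofReal ((hmem i hi).integrable_norm_pow two_ne_zero)
        (Filter.Eventually.of_forall fun x => by positivity)]
      refine lintegral_congr fun x => ?_
      rw [ENNReal.ofReal_pow (norm_nonneg _), ofReal_norm]
    rw [← Finset.sum_congr rfl h1, ← ENNReal.ofReal_sum_of_nonneg fun i _ =>
      integral_nonneg fun x => by positivity] at hsq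
    exact (ENNReal.ofReal_le_ofReal_iff (by positivity)).1 hsq

/-- One level of the multilevel method: with `n` independent samples, the mean square error of the
estimated projection is the projection error plus a variance of at most `#t / n * ‖z‖²`. -/
theorem exists_sampled_projection {e : ι → Lp 𝕂 2 μ} (he : Orthonormal 𝕂 e) {t : Finset ι}
    (ht : t.Nonempty) :
    ∃ κ : Measure D, IsProbabilityMeasure κ ∧ ∃ w : ι → D → 𝕂, (∀ i, Measurable (w i)) ∧
      ∀ (z : Lp 𝕂 2 μ) (h : D → 𝕂), Measurable h → h =ᵐ[μ] z → ∀ n : ℕ, 0 < n →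
        ∫⁻ x : Fin n → D, edist z (∑ i ∈ t, ((n : 𝕂)⁻¹ * ∑ l, h (x l) * w i (x l)) • e i) ^ 2
          ∂(Measure.pi fun _ => κ) ≤
        ENNReal.ofReal (‖z - ∑ i ∈ t, inner 𝕂 (e i) z • e i‖ ^ 2) +
          ENNReal.ofReal (t.card / n) * ENNReal.ofReal (‖z‖ ^ 2) := by
  obtain ⟨κ, hκ, w, hwm, H⟩ := exists_importance_sampling he ht
  refine ⟨κ, hκ, w, hwm, fun z h hhm hhz n hn => ?_⟩
  obtain ⟨H1, H2⟩ := H z h hhm hhz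
  have h1 : ∀ i ∈ t, _ := fun i hi =>
    integral_norm_average_sub_sq_le (F := fun x => h x * w i x) (hhm.mul (hwm i)) (H1 i hi).1 hn
  have h2 : ∀ x : Fin n → D,
      edist z (∑ i ∈ t, ((n : 𝕂)⁻¹ * ∑ l, h (x l) * w i (x l)) • e i) ^ 2 =
        ENNReal.ofReal (‖z - ∑ i ∈ t, inner 𝕂 (e i) z • e i‖ ^ 2 +
        ∑ i ∈ t, ‖∫ y, h y * w i y ∂κ - (n : 𝕂)⁻¹ * ∑ l, h (x l) * w i (x l)‖ ^ 2) := by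
    intro x
    rw [edist_dist, dist_eq_norm, ← ENNReal.ofReal_pow (norm_nonneg _), he.norm_sub_sum_sq]
    congr 2
    refine Finset.sum_congr rfl fun i hi => ?_
    rw [(H1 i hi).2]
  simp only [h2]
  have hint : Integrable (fun x : Fin n → D => ∑ i ∈ t,
      ‖∫ y, h y * w i y ∂κ - (n : 𝕂)⁻¹ * ∑ l, h (x l) * w i (x l)‖ ^ 2)
      (Measure.pi fun _ => κ) := integrable_finsetSum _ fun i hi => (h1 i hi).1
  rw [← ofReal_integral_eq_lintegral_ofReal (f := fun x : Fin n → D =>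
      ‖z - ∑ i ∈ t, inner 𝕂 (e i) z • e i‖ ^ 2 + ∑ i ∈ t,
        ‖∫ y, h y * w i y ∂κ - (n : 𝕂)⁻¹ * ∑ l, h (x l) * w i (x l)‖ ^ 2)
    ((integrable_const _).add hint) (Filter.Eventually.of_forall fun x => by positivity), ← ENNReal.ofReal_mul (by positivity),
    ← ENNReal.ofReal_add (by positivity) (by positivity)]
  refine ENNReal.ofReal_le_ofReal ?_
  rw [integral_add (integrable_const _) hint, integral_finsetSum _ fun i hi => (h1 i hi).1]
  have h3 : ∑ i ∈ t, ∫ x : Fin n → D,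
      ‖∫ y, h y * w i y ∂κ - (n : 𝕂)⁻¹ * ∑ l, h (x l) * w i (x l)‖ ^ 2
      ∂(Measure.pi fun _ => κ) ≤ t.card / n * ‖z‖ ^ 2 := by
    calc _ ≤ ∑ i ∈ t, (n : ℝ)⁻¹ * ∫ x, ‖h x * w i x‖ ^ 2 ∂κ :=
          Finset.sum_le_sum fun i hi => (h1 i hi).2
      _ = (n : ℝ)⁻¹ * ∑ i ∈ t, ∫ x, ‖h x * w i x‖ ^ 2 ∂κ := by rw [Finset.mul_sum]
      _ ≤ (n : ℝ)⁻¹ * (t.card * ‖z‖ ^ 2) := by gcongr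
      _ = _ := by ring
  simpa using h3

end ImportanceSampling

/-! ### Multilevel sampling methods -/

section SamplingMethod

/-- A randomized nonadaptive sampling method with values in the span of vectors indexed by `ι`: the
function is sampled at the random points `pts k`, `k : κ`, and the `i`-th coefficient of the output
is a measurable function of the random element and the values. -/
structure SamplingMethod (𝕂 : Type k₀) [RCLike 𝕂] (D : Type u₀) [MeasurableSpace D]
    (ι : Type*) where
  Ω : Type u₀
  mΩ : MeasurableSpace Ω
  prob : Measure Ω
  isProb : IsProbabilityMeasure prob
  κ : Type
  fκ : Fintype κ
  pts : κ → Ω → D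
  measurable_pts : ∀ k, Measurable (pts k)
  coeff : ι → Ω → (κ → 𝕂) → 𝕂
  measurable_coeff : ∀ i, Measurable fun z : Ω × (κ → 𝕂) => coeff i z.1 z.2

namespace SamplingMethod

attribute [instance] mΩ isProb fκ

variable {𝕂 : Type k₀} [RCLike 𝕂] {D : Type u₀} [MeasurableSpace D] {ι : Type*}
  {μ : Measure D}

/-- The `i`-th coefficient of the output for the function `g`. -/
def coeffAt (M : SamplingMethod 𝕂 D ι) (i : ι) (ω : M.Ω) (g : D → 𝕂) : 𝕂 :=
  M.coeff i ω fun k => g (M.pts k ω)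

/-- The output for the function `g`, in the span of `e i`, `i ∈ s`. -/
noncomputable def out (M : SamplingMethod 𝕂 D ι) (e : ι → Lp 𝕂 2 μ) (s : Finset ι) (ω : M.Ω)
    (g : D → 𝕂) : Lp 𝕂 2 μ :=
  ∑ i ∈ s, M.coeffAt i ω g • e i

/-- The mean square error in approximating `y` by means of the values of its representative `g`. -/
noncomputable def mse (M : SamplingMethod 𝕂 D ι) (e : ι → Lp 𝕂 2 μ) (s : Finset ι)
    (y : Lp 𝕂 2 μ) (g : D → 𝕂) : ℝ≥0∞ :=
  ∫⁻ ω, edist y (M.out e s ω g) ^ 2 ∂M.prob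

theorem measurable_coeffAt (M : SamplingMethod 𝕂 D ι) {g : D → 𝕂} (hg : Measurable g) (i : ι) :
    Measurable fun ω => M.coeffAt i ω g :=
  (M.measurable_coeff i).comp (measurable_id.prodMk
    (measurable_pi_lambda _ fun k => hg.comp (M.measurable_pts k)))

theorem measurable_sum_smul {α : Type*} [MeasurableSpace α] {e : ι → Lp 𝕂 2 μ} {s : Finset ι}
    {c : ι → α → 𝕂} (hc : ∀ i, Measurable (c i)) (y : Lp 𝕂 2 μ) :
    Measurable fun a => edist y (∑ i ∈ s, c i a • e i) ^ 2 := by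
  have h1 : Measurable fun b : s → 𝕂 => edist y (∑ i : s, b i • e i) ^ 2 := by
    refine Measurable.pow_const ?_ 2
    exact (by fun_prop : Continuous fun b : s → 𝕂 => edist y (∑ i : s, b i • e i)).measurable
  have h2 : Measurable fun a => fun i : s => c i a := measurable_pi_lambda _ fun i => hc i
  have h3 := h1.comp h2
  convert h3 using 1
  funext a
  simp only [Function.comp_apply]
  rw [Finset.sum_coe_sort s fun i => c i a • e i]

/-- The empty method, which outputs zero. -/
noncomputable def zero (𝕂 : Type k₀) [RCLike 𝕂] (D : Type u₀) [MeasurableSpace D]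
    (ι : Type*) : SamplingMethod 𝕂 D ι where
  Ω := PUnit
  mΩ := ⊤
  prob := @Measure.dirac _ ⊤ PUnit.unit
  isProb := @Measure.dirac.isProbabilityMeasure _ ⊤ _
  κ := Empty
  fκ := inferInstance
  pts k := k.elim
  measurable_pts k := k.elim
  coeff _ _ _ := 0
  measurable_coeff _ := measurable_const

open Classical in
/-- The method that adds to the output of `M` an estimate of the projection of the residual, from
`n` new independent points with distribution `ρ` and with the weights `w`. -/
noncomputable def refined (M : SamplingMethod 𝕂 D ι) (e : ι → Lp 𝕂 2 μ) (s : Finset ι)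
    (ρ : Measure D) [hρ : IsProbabilityMeasure ρ] {w : ι → D → 𝕂} (hw : ∀ i, Measurable (w i))
    (n : ℕ) : SamplingMethod 𝕂 D ι where
  Ω := M.Ω × (Fin n → D)
  mΩ := inferInstance
  prob := M.prob.prod (Measure.pi fun _ => ρ)
  isProb := inferInstance
  κ := M.κ ⊕ Fin n
  fκ := inferInstance
  pts k ω := Sum.elim (fun k => M.pts k ω.1) ω.2 k
  measurable_pts k := by
    cases k with
    | inl k => exact (M.measurable_pts k).comp measurable_fst
    | inr l => exact (measurable_pi_apply l).comp measurable_snd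
  coeff i ω v := (if i ∈ s then M.coeff i ω.1 (v ∘ Sum.inl) else 0) +
    (n : 𝕂)⁻¹ * ∑ l, (v (Sum.inr l) - ∑ j ∈ s, M.coeff j ω.1 (v ∘ Sum.inl) *
      (e j : D → 𝕂) (ω.2 l)) * w i (ω.2 l)
  measurable_coeff i := by
    have h1 : ∀ j, Measurable fun z : (M.Ω × (Fin n → D)) × (M.κ ⊕ Fin n → 𝕂) =>
        M.coeff j z.1.1 (z.2 ∘ Sum.inl) := fun j =>
      (M.measurable_coeff j).comp ((measurable_fst.comp measurable_fst).prodMk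
        (measurable_pi_lambda _ fun k => (measurable_pi_apply _).comp measurable_snd))
    have h2 : ∀ l, Measurable fun z : (M.Ω × (Fin n → D)) × (M.κ ⊕ Fin n → 𝕂) => z.1.2 l :=
      fun l => (measurable_pi_apply l).comp (measurable_snd.comp measurable_fst)
    have h3 : ∀ l, Measurable fun z : (M.Ω × (Fin n → D)) × (M.κ ⊕ Fin n → 𝕂) =>
        z.2 (Sum.inr l) := fun l => (measurable_pi_apply _).comp measurable_snd
    have h4 : ∀ j, Measurable (e j : D → 𝕂) := fun j => (Lp.stronglyMeasurable (e j)).measurable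
    refine Measurable.add ?_ (Measurable.const_mul (Finset.measurable_fun_sum _ fun l _ => ?_) _)
    · split_ifs
      · exact h1 i
      · exact measurable_const
    · refine Measurable.mul (Measurable.sub (h3 l) ?_) ((hw i).comp (h2 l))
      exact Finset.measurable_fun_sum _ fun j _ => (h1 j).mul ((h4 j).comp (h2 l))

theorem out_refined (M : SamplingMethod 𝕂 D ι) (e : ι → Lp 𝕂 2 μ) {s t : Finset ι} (hst : s ⊆ t)
    (ρ : Measure D) [IsProbabilityMeasure ρ] {w : ι → D → 𝕂} (hw : ∀ i, Measurable (w i))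
    (n : ℕ) (ω : M.Ω) (x : Fin n → D) (g : D → 𝕂) :
    (M.refined e s ρ hw n).out e t (ω, x) g = M.out e s ω g +
      ∑ i ∈ t, ((n : 𝕂)⁻¹ * ∑ l, (g (x l) - ∑ j ∈ s, M.coeffAt j ω g * (e j : D → 𝕂) (x l)) *
        w i (x l)) • e i := by
  classical
  have h1 : ∀ i, (M.refined e s ρ hw n).coeffAt i (ω, x) g =
      (if i ∈ s then M.coeffAt i ω g else 0) + (n : 𝕂)⁻¹ * ∑ l, (g (x l) -
        ∑ j ∈ s, M.coeffAt j ω g * (e j : D → 𝕂) (x l)) * w i (x l) := by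
    intro i
    simp only [coeffAt, refined]
    congr
  simp only [out, h1, add_smul, Finset.sum_add_distrib]
  congr 1
  simp only [ite_smul, zero_smul]
  rw [Finset.sum_ite_mem, Finset.inter_eq_right.2 hst]

/-- The error recursion of the multilevel method. -/
theorem exists_refinement {e : ι → Lp 𝕂 2 μ} (he : Orthonormal 𝕂 e) (M : SamplingMethod 𝕂 D ι)
    {s t : Finset ι} (hst : s ⊆ t) (ht : t.Nonempty) {n : ℕ} (hn : 0 < n) :
    ∃ M' : SamplingMethod 𝕂 D ι, Fintype.card M'.κ = Fintype.card M.κ + n ∧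
      ∀ (y : Lp 𝕂 2 μ) (g : D → 𝕂), Measurable g → g =ᵐ[μ] y →
        M'.mse e t y g ≤ ENNReal.ofReal (‖y - ∑ i ∈ t, inner 𝕂 (e i) y • e i‖ ^ 2) +
          ENNReal.ofReal (t.card / n) * M.mse e s y g := by
  obtain ⟨ρ, hρ, w, hw, H⟩ := exists_sampled_projection he ht
  refine ⟨M.refined e s ρ hw n, ?_, fun y g hg hgy => ?_⟩
  · change Fintype.card (M.κ ⊕ Fin n) = _
    simp
  have hem : ∀ i, Measurable (e i : D → 𝕂) := fun i => (Lp.stronglyMeasurable (e i)).measurable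
  have hmeas : Measurable fun ω : M.Ω × (Fin n → D) =>
      edist y ((M.refined e s ρ hw n).out e t ω g) ^ 2 :=
    measurable_sum_smul (fun i => (M.refined e s ρ hw n).measurable_coeffAt hg i) y
  have h1 : (M.refined e s ρ hw n).mse e t y g =
      ∫⁻ ω, ∫⁻ x, edist y ((M.refined e s ρ hw n).out e t (ω, x) g) ^ 2
        ∂(Measure.pi fun _ : Fin n => ρ) ∂M.prob :=
    lintegral_prod _ hmeas.aemeasurable
  have h2 : ∀ ω, ∫⁻ x, edist y ((M.refined e s ρ hw n).out e t (ω, x) g) ^ 2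
        ∂(Measure.pi fun _ : Fin n => ρ) ≤
      ENNReal.ofReal (‖y - ∑ i ∈ t, inner 𝕂 (e i) y • e i‖ ^ 2) +
        ENNReal.ofReal (t.card / n) * edist y (M.out e s ω g) ^ 2 := by
    intro ω
    -- The residual `z` of the previous approximation has the representative `h`, whose values are
    -- available; averaging over the samples `x` approximates the projection of `z`.
    set z := y - M.out e s ω g with hz
    set h : D → 𝕂 := fun x => g x - ∑ j ∈ s, M.coeffAt j ω g * (e j : D → 𝕂) x with hh
    have hhm : Measurable h :=
      hg.sub (Finset.measurable_fun_sum _ fun j _ => (hem j).const_mul _)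
    have hhz : h =ᵐ[μ] z := by
      have h3 : ∀ j ∈ s, ∀ᵐ x ∂μ, (M.coeffAt j ω g • e j : Lp 𝕂 2 μ) x =
          M.coeffAt j ω g * (e j : D → 𝕂) x := by
        intro j _
        filter_upwards [Lp.coeFn_smul (M.coeffAt j ω g) (e j)] with x hx
        rw [hx, Pi.smul_apply, smul_eq_mul]
      filter_upwards [hgy, Lp.coeFn_sub y (M.out e s ω g),
        Lp.coeFn_finsetSum s fun j => (M.coeffAt j ω g • e j : Lp 𝕂 2 μ),
        (Filter.eventually_all_finset s).2 h3] with x h4 h5 h6 h7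
      change g x - _ = _
      rw [hz, h5, Pi.sub_apply, out, h6, h4, Finset.sum_apply, Finset.sum_congr rfl h7]
    have h3 : ∀ x : Fin n → D, edist y ((M.refined e s ρ hw n).out e t (ω, x) g) =
        edist z (∑ i ∈ t, ((n : 𝕂)⁻¹ * ∑ l, h (x l) * w i (x l)) • e i) := by
      intro x
      rw [M.out_refined e hst ρ hw, edist_dist, edist_dist, dist_eq_norm, dist_eq_norm, hz,
        sub_sub]
    -- The previous output lies in the span of the `e i`, `i ∈ t`, so the bias is that of `y`.
    have h4 : z - ∑ i ∈ t, inner 𝕂 (e i) z • e i = y - ∑ i ∈ t, inner 𝕂 (e i) y • e i := by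
      classical
      have h5 : ∑ i ∈ t, inner 𝕂 (e i) (M.out e s ω g) • e i = M.out e s ω g := by
        have h6 : ∀ i ∈ t, inner 𝕂 (e i) (M.out e s ω g) • e i =
            if i ∈ s then M.coeffAt i ω g • e i else 0 := by
          intro i _
          split_ifs with hi
          · rw [out, he.inner_right_sum _ hi]
          · rw [out, inner_sum, Finset.sum_eq_zero fun j hj => ?_, zero_smul]
            have hij : i ≠ j := fun hij => hi (hij ▸ hj)
            rw [inner_smul_right, he.2 hij, mul_zero]
        rw [Finset.sum_congr rfl h6, Finset.sum_ite_mem, Finset.inter_eq_right.2 hst, out]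
      simp only [hz, inner_sub_right, sub_smul, Finset.sum_sub_distrib, h5]
      abel
    have h5 := H z h hhm hhz n hn
    simp only [h3]
    refine h5.trans (le_of_eq ?_)
    rw [h4, edist_dist, dist_eq_norm, ENNReal.ofReal_pow (norm_nonneg z)]
  rw [h1]
  refine (lintegral_mono h2).trans (le_of_eq ?_)
  have hmeas' : Measurable fun ω : M.Ω => edist y (M.out e s ω g) ^ 2 :=
    measurable_sum_smul (fun i => M.measurable_coeffAt hg i) y
  rw [lintegral_add_left measurable_const, lintegral_const, measure_univ, mul_one,
    lintegral_const_mul _ hmeas', mse]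

/-- The multilevel method: if the projections onto the spans of `e i`, `i ∈ Λ k`, have errors `τ k`
that decay at most geometrically, then an oversampling factor `m` that beats the decay makes the
random error of every level as small as its projection error. -/
theorem exists_multilevel {e : ι → Lp 𝕂 2 μ} (he : Orthonormal 𝕂 e) {Λ : ℕ → Finset ι}
    (hΛ : Monotone Λ) (hΛ0 : (Λ 0).Nonempty) {τ : ℕ → ℝ} {B b K : ℝ}
    (hτ : ∀ k, 0 ≤ τ k) (hB : ∀ k, τ k ≤ B * τ (k + 1)) {m : ℕ} (hm : 0 < m)
    (hmB : 2 * B ^ 2 ≤ m) (hK : 2 ≤ K) (hK0 : τ 0 ^ 2 + b ^ 2 ≤ K * τ 0 ^ 2) (k : ℕ) :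
    ∃ M : SamplingMethod 𝕂 D ι, Fintype.card M.κ = m * ∑ i ∈ Finset.range (k + 1), (Λ i).card ∧
      ∀ (y : Lp 𝕂 2 μ) (g : D → 𝕂), Measurable g → g =ᵐ[μ] y → ‖y‖ ≤ b →
        (∀ k, ‖y - ∑ i ∈ Λ k, inner 𝕂 (e i) y • e i‖ ≤ τ k) →
        M.mse e (Λ k) y g ≤ ENNReal.ofReal (K * τ k ^ 2) := by
  have hne : ∀ k, (Λ k).Nonempty := fun k => hΛ0.mono (hΛ (Nat.zero_le k))
  have hm1 : (1 : ℝ) ≤ m := by exact_mod_cast hm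
  have hfac : ∀ k, ((Λ k).card : ℝ) / ((m * (Λ k).card : ℕ) : ℝ) = (m : ℝ)⁻¹ := by
    intro k
    have : ((Λ k).card : ℝ) ≠ 0 := by exact_mod_cast (hne k).card_pos.ne'
    push_cast
    field_simp
  induction k with
  | zero =>
    obtain ⟨M, hM, H⟩ := exists_refinement he (zero 𝕂 D ι) (Finset.empty_subset (Λ 0)) hΛ0
      (n := m * (Λ 0).card) (Nat.mul_pos hm hΛ0.card_pos)
    refine ⟨M, ?_, fun y g hg hgy hb hy => (H y g hg hgy).trans ?_⟩
    · rw [hM]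
      change Fintype.card Empty + _ = _
      simp
    · have h1 : (zero 𝕂 D ι).mse e ∅ y g = ENNReal.ofReal (‖y‖ ^ 2) := by
        simp only [mse, out, Finset.sum_empty]
        rw [lintegral_const, measure_univ, mul_one, edist_dist, dist_zero_right,
          ENNReal.ofReal_pow (norm_nonneg _)]
      rw [h1, hfac, ← ENNReal.ofReal_mul (by positivity),
        ← ENNReal.ofReal_add (by positivity) (by positivity)]
      refine ENNReal.ofReal_le_ofReal (le_trans ?_ hK0)
      have h2 := pow_le_pow_left₀ (norm_nonneg _) (hy 0) 2
      have h3 := pow_le_pow_left₀ (norm_nonneg _) hb 2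
      have h4 : (m : ℝ)⁻¹ * ‖y‖ ^ 2 ≤ ‖y‖ ^ 2 :=
        mul_le_of_le_one_left (by positivity) (inv_le_one_of_one_le₀ hm1)
      linarith
  | succ k ih =>
    obtain ⟨M, hM, H⟩ := ih
    obtain ⟨M', hM', H'⟩ := exists_refinement he M (hΛ (Nat.le_succ k)) (hne (k + 1))
      (n := m * (Λ (k + 1)).card) (Nat.mul_pos hm (hne (k + 1)).card_pos)
    refine ⟨M', ?_, fun y g hg hgy hb hy => (H' y g hg hgy).trans ?_⟩
    · rw [hM', hM, Finset.sum_range_succ _ (k + 1), mul_add]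
    · refine (add_le_add le_rfl (mul_le_mul_right (H y g hg hgy hb hy) _)).trans ?_
      rw [hfac, ← ENNReal.ofReal_mul (by positivity),
        ← ENNReal.ofReal_add (by positivity) (by positivity)]
      refine ENNReal.ofReal_le_ofReal ?_
      have h2 := pow_le_pow_left₀ (norm_nonneg _) (hy (k + 1)) 2
      have h3 := pow_le_pow_left₀ (hτ k) (hB k) 2
      have h4 : (m : ℝ)⁻¹ * (K * τ k ^ 2) ≤ K / 2 * τ (k + 1) ^ 2 := by
        rw [inv_mul_le_iff₀ (by positivity)]
        have h5 : K * τ k ^ 2 ≤ K * (B ^ 2 * τ (k + 1) ^ 2) := by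
          rw [← mul_pow]
          gcongr
        have h6 : 2 * B ^ 2 * (K / 2 * τ (k + 1) ^ 2) ≤ m * (K / 2 * τ (k + 1) ^ 2) := by
          gcongr
        linarith
      nlinarith [sq_nonneg (τ (k + 1))]

end SamplingMethod

end SamplingMethod

/-! ### Upper bounds for function values -/

section StandardUpperBound

variable {𝕂 : Type k₀} [RCLike 𝕂] {H : Type h₀} [NormedAddCommGroup H] [NormedSpace 𝕂 H]
  {D : Type u₀} [MeasurableSpace D] {μ : Measure D} {J : H →L[𝕂] Lp 𝕂 2 μ} {ι : Type*}

theorem minError_stdRanProblem_le [Nonempty D] {𝓕 : Set (D → 𝕂)} (h𝓕 : ∀ g ∈ 𝓕, Measurable g)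
    (M : SamplingMethod 𝕂 D ι) (e : ι → Lp 𝕂 2 μ) (s : Finset ι) {ε : ℝ} (hε : 0 ≤ ε)
    (hM : ∀ (f : H) (g : D → 𝕂), ‖f‖ ≤ 1 → Measurable g → g =ᵐ[μ] J f →
      M.mse e s (J f) g ≤ ENNReal.ofReal (ε ^ 2)) {n : ℕ} (hn : Fintype.card M.κ ≤ n) :
    (stdRanProblem.{u₀} J 𝓕).minError n ≤ ENNReal.ofReal ε := by
  obtain ⟨x₀⟩ := ‹Nonempty D›
  have hdet : ∀ ω, IsDetAlgorithm (stdInfo J 𝓕) (fun q => M.out e s ω q.1.2) ∧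
      detCost (stdInfo J 𝓕) (fun q => M.out e s ω q.1.2) ≤ (Fintype.card M.κ : ℕ∞) := fun ω =>
    isDetAlgorithm_of_nonadaptive (Λ := stdInfo J 𝓕)
      (ℓ := fun k (q : FunctionInput J 𝓕) => q.1.2 (M.pts k ω)) (fun k => ⟨_, fun q => rfl⟩)
      (ℓ₀ := fun q => q.1.2 x₀) ⟨x₀, fun q => rfl⟩ (fun v => ∑ i ∈ s, M.coeff i ω v • e i)
  let A : RandomizedAlgorithm.{u₀} (inputApp J 𝓕) (stdInfo J 𝓕) (measurableFamilies J 𝓕) :=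
    { Ω := M.Ω
      mΩ := M.mΩ
      prob := M.prob
      isProb := M.isProb
      A := fun ω q => M.out e s ω q.1.2
      isAlg := fun ω => (hdet ω).1
      meas := by
        rintro p ⟨hp1, hp2⟩
        let _ : MeasurableSpace (UnitBall H) := borel _
        have : BorelSpace (UnitBall H) := ⟨rfl⟩
        have h1 : Measurable fun z : UnitBall H × (s → 𝕂) =>
            dist (J z.1) (∑ i : s, z.2 i • e i) :=
          (by fun_prop : Continuous fun z : UnitBall H × (s → 𝕂) =>
            dist (J z.1) (∑ i : s, z.2 i • e i)).measurable
        have h2 : Measurable fun z : UnitBall H × M.Ω =>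
            fun i : s => M.coeffAt i z.2 (p z.1).1.2 := by
          refine measurable_pi_lambda _ fun i => ?_
          refine (M.measurable_coeff i).comp (measurable_snd.prodMk
            (measurable_pi_lambda _ fun k => ?_))
          exact hp2.comp (measurable_fst.prodMk ((M.measurable_pts k).comp measurable_snd))
        have h3 := h1.comp ((hp1.comp measurable_fst).prodMk h2)
        convert h3 using 1
        funext z
        simp only [Function.comp_apply, inputApp, SamplingMethod.out]
        rw [Finset.sum_coe_sort s fun i => M.coeffAt i z.2 (p z.1).1.2 • e i] }
  refine (iInf₂_le (show (stdRanProblem.{u₀} J 𝓕).Alg from A) ?_).trans ?_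
  · exact iSup_le fun ω => (hdet ω).2.trans (by exact_mod_cast hn)
  · refine iSup_le fun q => ?_
    have h1 := hM q.1.1 q.1.2 (mem_closedBall_zero_iff.1 q.1.1.2) (h𝓕 _ q.2.1) q.2.2
    have h2 := ENNReal.rpow_le_rpow h1 (by norm_num : (0 : ℝ) ≤ 1 / 2)
    refine h2.trans (le_of_eq ?_)
    rw [ENNReal.ofReal_pow hε, ← ENNReal.rpow_natCast, ← ENNReal.rpow_mul]
    norm_num

/-- Upper bound for randomized algorithms that use function values, from nested projections with
errors `τ k` on the unit ball. -/
theorem exists_minError_stdRanProblem_le [Nonempty D] {𝓕 : Set (D → 𝕂)}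
    (h𝓕 : ∀ g ∈ 𝓕, Measurable g) {e : ι → Lp 𝕂 2 μ} (he : Orthonormal 𝕂 e) {Λ : ℕ → Finset ι}
    (hΛ : Monotone Λ) (hΛ0 : (Λ 0).Nonempty) {τ : ℕ → ℝ} {B : ℝ} (hτ : ∀ k, 0 < τ k)
    (hB : ∀ k, τ k ≤ B * τ (k + 1))
    (hJ : ∀ k (f : H), ‖J f - ∑ i ∈ Λ k, inner 𝕂 (e i) (J f) • e i‖ ≤ τ k * ‖f‖) :
    ∃ (m : ℕ) (C : ℝ), 0 < m ∧ 0 < C ∧ ∀ k n, m * ∑ i ∈ Finset.range (k + 1), (Λ i).card ≤ n →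
      (stdRanProblem.{u₀} J 𝓕).minError n ≤ ENNReal.ofReal (C * τ k) := by
  obtain ⟨m, hm⟩ := exists_nat_ge (2 * B ^ 2 + 1)
  have hm0 : 0 < m := by
    have : (0 : ℝ) < m := by nlinarith [sq_nonneg B]
    exact_mod_cast this
  set b := ‖J‖
  set K : ℝ := 2 + b ^ 2 / τ 0 ^ 2 with hK
  have hK2 : 2 ≤ K := by
    have : 0 ≤ b ^ 2 / τ 0 ^ 2 := by positivity
    linarith
  have hK0 : τ 0 ^ 2 + b ^ 2 ≤ K * τ 0 ^ 2 := by
    have := (hτ 0).ne'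
    have h1 : K * τ 0 ^ 2 = 2 * τ 0 ^ 2 + b ^ 2 := by
      rw [hK]
      field_simp
    nlinarith [sq_nonneg (τ 0)]
  refine ⟨m, √K, hm0, by positivity, fun k n hn => ?_⟩
  obtain ⟨M, hM, hmse⟩ := SamplingMethod.exists_multilevel he hΛ hΛ0 (fun k => (hτ k).le) hB hm0
    (by linarith) hK2 hK0 k
  refine minError_stdRanProblem_le h𝓕 M e (Λ k) (mul_nonneg (by positivity) (hτ k).le) ?_
    (hM.le.trans hn)
  intro f g hf hg hgf
  rw [mul_pow, Real.sq_sqrt (by linarith)]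
  refine hmse _ g hg hgf ?_ fun k => ?_
  · exact (J.le_opNorm f).trans (mul_le_of_le_one_right (norm_nonneg _) hf)
  · exact (hJ k f).trans (mul_le_of_le_one_right (hτ k).le hf)

/-- This is the error of the zero algorithm. -/
theorem minError_stdRanProblem_le_norm [Nonempty D] {𝓕 : Set (D → 𝕂)}
    (h𝓕 : ∀ g ∈ 𝓕, Measurable g) (n : ℕ) :
    (stdRanProblem.{u₀} J 𝓕).minError n ≤ ENNReal.ofReal ‖J‖ := by
  refine minError_stdRanProblem_le h𝓕 (SamplingMethod.zero 𝕂 D ℕ) 0 ∅ (norm_nonneg _) ?_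
    (n := n) (by change Fintype.card Empty ≤ n; simp)
  intro f g hf _ _
  simp only [SamplingMethod.mse, SamplingMethod.out, Finset.sum_empty]
  rw [lintegral_const, measure_univ, mul_one, edist_dist, dist_zero_right,
    ← ENNReal.ofReal_pow (norm_nonneg _)]
  refine ENNReal.ofReal_le_ofReal ?_
  have := (J.le_opNorm f).trans (mul_le_of_le_one_right (norm_nonneg _) hf)
  gcongr

end StandardUpperBound

/-! ### Singular systems of compact operators -/

section SingularSystem

variable {𝕂 H G : Type*} [RCLike 𝕂] [NormedAddCommGroup H] [InnerProductSpace 𝕂 H]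
  [CompleteSpace H] [NormedAddCommGroup G] [InnerProductSpace 𝕂 G] [CompleteSpace G]
  {J : H →L[𝕂] G}

/-- The operator `J* J`. -/
noncomputable def gramOperator (J : H →L[𝕂] G) : H →L[𝕂] H :=
  (ContinuousLinearMap.adjoint J).comp J

theorem inner_gramOperator (J : H →L[𝕂] G) (f g : H) :
    inner 𝕂 (gramOperator J f) g = inner 𝕂 (J f) (J g) := by
  rw [gramOperator, ContinuousLinearMap.comp_apply, ContinuousLinearMap.adjoint_inner_left]

theorem gramOperator_isSymmetric (J : H →L[𝕂] G) :
    (gramOperator J : H →ₗ[𝕂] H).IsSymmetric := by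
  intro f g
  change inner 𝕂 (gramOperator J f) g = inner 𝕂 f (gramOperator J g)
  rw [inner_gramOperator, ← inner_conj_symm f, inner_gramOperator, inner_conj_symm]

/-- On the orthogonal complement of a finite-dimensional invariant subspace, the norm of a compact
injective operator is attained at an eigenvector of `J* J`. -/
theorem exists_singular_vector (hJ : IsCompactOperator J) (hinj : Function.Injective J)
    (hH : ¬ FiniteDimensional 𝕂 H) (W : Submodule 𝕂 H) [FiniteDimensional 𝕂 W]
    (hW : ∀ f ∈ W, gramOperator J f ∈ W) :
    ∃ (w : H) (t : ℝ), w ∈ Wᗮ ∧ ‖w‖ = 1 ∧ 0 < t ∧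
      gramOperator J w = ((t ^ 2 : ℝ) : 𝕂) • w ∧ ∀ f ∈ Wᗮ, ‖J f‖ ≤ t * ‖f‖ := by
  set T := gramOperator J
  have hTc : IsCompactOperator T := hJ.clm_comp (ContinuousLinearMap.adjoint J)
  have hinv : ∀ f ∈ Wᗮ, T f ∈ Wᗮ := by
    intro f hf g hg
    have := gramOperator_isSymmetric J g f
    change inner 𝕂 g (gramOperator J f) = 0
    rw [← show inner 𝕂 (gramOperator J g) f = inner 𝕂 g (gramOperator J f) from this]
    exact hf _ (hW g hg)
  have hWtop : Wᗮ ≠ ⊥ := by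
    intro h
    rw [Submodule.orthogonal_eq_bot_iff] at h
    exact hH (Module.Finite.of_surjective (W.subtype) fun x => ⟨⟨x, h ▸ Submodule.mem_top⟩, rfl⟩)
  let S : Wᗮ →L[𝕂] Wᗮ := T.restrict hinv
  have hS : ∀ f : Wᗮ, ((S f : Wᗮ) : H) = T f := fun f => rfl
  have hSc : IsCompactOperator S := hTc.restrict' hinv
  have hSs : (S : Wᗮ →ₗ[𝕂] Wᗮ).IsSymmetric :=
    (gramOperator_isSymmetric J).restrict_invariant hinv
  have hJS : ∀ f : Wᗮ, inner 𝕂 (S f) f = ((‖J f‖ ^ 2 : ℝ) : 𝕂) := by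
    intro f
    rw [Submodule.coe_inner, hS, inner_gramOperator, inner_self_eq_norm_sq_to_K, RCLike.ofReal_pow]
  have hS0 : 0 < ‖S‖ := by
    rw [norm_pos_iff]
    intro h0
    obtain ⟨f, hf, hf0⟩ := Submodule.exists_mem_ne_zero_of_ne_bot hWtop
    have h1 := hJS ⟨f, hf⟩
    rw [h0] at h1
    simp only [zero_apply, inner_zero_left] at h1
    have h2 : ‖J f‖ ^ 2 = 0 := by exact_mod_cast h1.symm
    have h3 : J f = 0 := by simpa using h2
    exact hf0 (hinj (h3.trans (map_zero J).symm))
  -- The norm of the self-adjoint `S` is its spectral radius, which is attained at a spectral value;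
  -- a nonzero spectral value of a compact operator is an eigenvalue.
  have hrad := S.spectralRadius_eq_nnnorm hSs.isSelfAdjoint
  have hne : (spectrum 𝕂 S).Nonempty := by
    by_contra h
    rw [Set.not_nonempty_iff_eq_empty] at h
    rw [spectralRadius, h] at hrad
    simp only [Set.mem_empty_iff_false, not_false_eq_true, iSup_neg, bot_eq_zero',
      ENNReal.iSup_zero] at hrad
    have : ‖S‖₊ = 0 := by exact_mod_cast hrad.symm
    exact hS0.ne' (by simpa using this)
  obtain ⟨ν, hν, hνn⟩ := spectrum.exists_nnnorm_eq_spectralRadius_of_nonempty hne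
  have hνS : ‖ν‖ = ‖S‖ := by
    rw [hrad] at hνn
    have : ‖ν‖₊ = ‖S‖₊ := by exact_mod_cast hνn
    exact congrArg NNReal.toReal this
  have hν0 : ν ≠ 0 := by
    rw [← norm_pos_iff, hνS]
    exact hS0
  obtain ⟨w, hw⟩ := ((hSc.hasEigenvalue_iff_mem_spectrum hν0).2 hν).exists_hasEigenvector
  have hw0 : ‖w‖ ≠ 0 := norm_ne_zero_iff.2 hw.2
  let w' : Wᗮ := ((‖w‖⁻¹ : ℝ) : 𝕂) • w
  have hw' : S w' = ν • w' := by
    have h1 : S w = ν • w := hw.apply_eq_smul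
    rw [map_smul, h1, smul_comm]
  have hw'n : ‖w'‖ = 1 := by
    rw [norm_smul, RCLike.norm_ofReal, abs_of_nonneg (by positivity), inv_mul_cancel₀ hw0]
  have hν2 : ν = ((‖J w'‖ ^ 2 : ℝ) : 𝕂) := by
    have h1 := hJS w'
    rw [hw', inner_smul_left, inner_self_eq_norm_sq_to_K, hw'n] at h1
    have h2 := congrArg (starRingEnd 𝕂) h1
    rw [RCLike.conj_ofReal] at h2
    simpa using h2
  have ht2 : ‖J w'‖ ^ 2 = ‖S‖ := by
    rw [← hνS, hν2, RCLike.norm_ofReal, abs_of_nonneg (by positivity)]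
  refine ⟨w', ‖J w'‖, w'.2, hw'n, ?_, ?_, fun f hf => ?_⟩
  · rcases (norm_nonneg (J w')).eq_or_lt with h | h
    · rw [← h] at ht2
      simp at ht2
      exact absurd ht2.symm hS0.ne'
    · exact h
  · rw [← hν2, ← hS, hw']
    rfl
  · refine le_of_sq_le_sq ?_ (by positivity)
    have h1 := congrArg RCLike.re (hJS ⟨f, hf⟩)
    rw [RCLike.ofReal_re] at h1
    rw [mul_pow, ht2]
    calc ‖J f‖ ^ 2 = _ := h1.symm
      _ ≤ ‖S ⟨f, hf⟩‖ * ‖(⟨f, hf⟩ : Wᗮ)‖ := re_inner_le_norm _ _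
      _ ≤ ‖S‖ * ‖(⟨f, hf⟩ : Wᗮ)‖ * ‖(⟨f, hf⟩ : Wᗮ)‖ := by gcongr; exact S.le_opNorm _
      _ = ‖S‖ * ‖f‖ ^ 2 := by rw [mul_assoc, ← sq]; rfl

/-- A compact injective operator on an infinite-dimensional Hilbert space has a singular system,
and the `n`-th singular value (counted from zero) bounds the operator on the orthogonal complement of
the first `n` vectors. -/
theorem exists_singular_system (hJ : IsCompactOperator J) (hinj : Function.Injective J)
    (hH : ¬ FiniteDimensional 𝕂 H) :
    ∃ (v : ℕ → H) (σ : ℕ → ℝ), Orthonormal 𝕂 v ∧ (∀ i, 0 < σ i) ∧ Antitone σ ∧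
      (∀ i, gramOperator J (v i) = ((σ i ^ 2 : ℝ) : 𝕂) • v i) ∧
      ∀ n f, (∀ i < n, inner 𝕂 (v i) f = 0) → ‖J f‖ ≤ σ n * ‖f‖ := by
  -- Enlarge a finite-dimensional invariant subspace by one maximal eigenvector at a time.
  let X := {W : Submodule 𝕂 H // FiniteDimensional 𝕂 W ∧ ∀ f ∈ W, gramOperator J f ∈ W}
  have hstep : ∀ W : X, ∃ p : H × ℝ, p.1 ∈ W.1ᗮ ∧ ‖p.1‖ = 1 ∧ 0 < p.2 ∧
      gramOperator J p.1 = ((p.2 ^ 2 : ℝ) : 𝕂) • p.1 ∧ ∀ f ∈ W.1ᗮ, ‖J f‖ ≤ p.2 * ‖f‖ := by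
    intro W
    have := W.2.1
    obtain ⟨w, t, h⟩ := exists_singular_vector hJ hinj hH W.1 W.2.2
    exact ⟨(w, t), h⟩
  choose p hp1 hp2 hp3 hp4 hp5 using hstep
  let next : X → X := fun W => ⟨W.1 ⊔ Submodule.span 𝕂 {(p W).1}, by
    have := W.2.1
    refine ⟨inferInstance, fun f hf => ?_⟩
    obtain ⟨a, ha, b, hb, rfl⟩ := Submodule.mem_sup.1 hf
    obtain ⟨c, rfl⟩ := Submodule.mem_span_singleton.1 hb
    rw [map_add, map_smul, hp4]
    refine Submodule.add_mem_sup (W.2.2 a ha) ?_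
    exact Submodule.smul_mem _ _ (Submodule.smul_mem _ _ (Submodule.mem_span_singleton_self _))⟩
  let Ws : ℕ → X := fun n => next^[n] ⟨⊥, inferInstance, by simp⟩
  have hWs : ∀ n, (Ws (n + 1)).1 = (Ws n).1 ⊔ Submodule.span 𝕂 {(p (Ws n)).1} := by
    intro n
    simp only [Ws, Function.iterate_succ_apply', next]
  have hmono : Monotone fun n => (Ws n).1 := monotone_nat_of_le_succ fun n => by
    rw [hWs]
    exact le_sup_left
  have hmem : ∀ m n, m < n → (p (Ws m)).1 ∈ (Ws n).1 := by
    intro m n hmn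
    refine hmono (Nat.succ_le_of_lt hmn) ?_
    change _ ∈ (Ws (m + 1)).1
    rw [hWs]
    exact Submodule.mem_sup_right (Submodule.mem_span_singleton_self _)
  have horth : ∀ n f, (∀ i < n, inner 𝕂 (p (Ws i)).1 f = 0) → f ∈ (Ws n).1ᗮ := by
    intro n f hf
    induction n with
    | zero => simp [Ws]
    | succ n ih =>
      rw [hWs, ← Submodule.inf_orthogonal]
      refine ⟨ih fun i hi => hf i (hi.trans (Nat.lt_succ_self n)), ?_⟩
      refine Submodule.mem_orthogonal_singleton_iff_inner_right.2 ?_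
      exact hf n (Nat.lt_succ_self n)
  have heig : ∀ n, ‖J (p (Ws n)).1‖ = (p (Ws n)).2 := by
    intro n
    have h1 : inner 𝕂 (gramOperator J (p (Ws n)).1) (p (Ws n)).1 =
        ((‖J (p (Ws n)).1‖ ^ 2 : ℝ) : 𝕂) := by
      rw [inner_gramOperator, inner_self_eq_norm_sq_to_K, RCLike.ofReal_pow]
    rw [hp4, inner_smul_left, inner_self_eq_norm_sq_to_K, hp2, RCLike.conj_ofReal] at h1
    simp only [map_one, one_pow, mul_one, RCLike.ofReal_inj] at h1
    exact ((sq_eq_sq₀ (hp3 _).le (norm_nonneg _)).1 h1).symm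
  refine ⟨fun n => (p (Ws n)).1, fun n => (p (Ws n)).2, ⟨fun n => hp2 _, ?_⟩, fun n => hp3 _, ?_,
    fun n => hp4 _, fun n f hf => hp5 _ f (horth n f hf)⟩
  · intro m n hmn
    rcases lt_or_gt_of_ne hmn with h | h
    · exact hp1 (Ws n) _ (hmem m n h)
    · exact inner_eq_zero_symm.1 (hp1 (Ws m) _ (hmem n m h))
  · refine antitone_nat_of_succ_le fun n => ?_
    have h1 := hp5 (Ws n) (p (Ws (n + 1))).1
      (Submodule.orthogonal_le (hmono (Nat.le_succ n)) (hp1 (Ws (n + 1))))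
    rwa [heig, hp2, mul_one] at h1

/-- The singular values as defined through eigenvectors agree with those of a singular system: `n + 1`
orthonormal eigenvectors span a space that meets the orthogonal complement of `v 0, …, v (n - 1)`. -/
theorem singularValue_eq {v : ℕ → H} {σ : ℕ → ℝ} (hv : Orthonormal 𝕂 v) (hσ : ∀ i, 0 < σ i)
    (hanti : Antitone σ) (heig : ∀ i, gramOperator J (v i) = ((σ i ^ 2 : ℝ) : 𝕂) • v i)
    (hbound : ∀ n f, (∀ i < n, inner 𝕂 (v i) f = 0) → ‖J f‖ ≤ σ n * ‖f‖) (n : ℕ) :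
    singularValue J (n + 1) = σ n := by
  refine IsGreatest.csSup_eq ⟨⟨hσ n, fun i => v i, hv.comp _ Fin.val_injective, fun i =>
    ⟨σ i, hanti (Nat.lt_succ_iff.1 i.2), heig i⟩⟩, ?_⟩
  rintro s ⟨hs, w, hw, hsw⟩
  choose t ht hwt using hsw
  -- some nonzero element of the span of `w` is orthogonal to the first `n` vectors `v i`
  let A : (Fin (n + 1) → 𝕂) →ₗ[𝕂] (Fin n → 𝕂) :=
    LinearMap.pi fun i => ∑ j, inner 𝕂 (v i) (w j) • LinearMap.proj j
  have hA : LinearMap.ker A ≠ ⊥ := LinearMap.ker_ne_bot_of_finrank_lt (by simp)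
  obtain ⟨c, hc, hc0⟩ := Submodule.exists_mem_ne_zero_of_ne_bot hA
  set f := ∑ j, c j • w j with hf
  have hf1 : ‖f‖ ^ 2 = ∑ j, ‖c j‖ ^ 2 := hw.norm_sq_sum_smul _ _
  have hf0 : 0 < ‖f‖ := by
    rw [norm_pos_iff]
    intro h0
    rw [h0, norm_zero, zero_pow two_ne_zero, eq_comm,
      Finset.sum_eq_zero_iff_of_nonneg fun _ _ => by positivity] at hf1
    exact hc0 (funext fun j => by simpa using hf1 j (Finset.mem_univ j))
  have h1 : ‖J f‖ ≤ σ n * ‖f‖ := by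
    refine hbound n f fun i hi => ?_
    have h2 := congrFun (LinearMap.mem_ker.1 hc) ⟨i, hi⟩
    simp only [A, LinearMap.pi_apply, LinearMap.sum_apply, LinearMap.smul_apply,
      LinearMap.proj_apply, smul_eq_mul, Pi.zero_apply] at h2
    rw [hf, inner_sum, ← h2]
    refine Finset.sum_congr rfl fun j _ => ?_
    rw [inner_smul_right, mul_comm]
  have h2 : ‖J f‖ ^ 2 = ∑ j, t j ^ 2 * ‖c j‖ ^ 2 := by
    have h3 : ((‖J f‖ ^ 2 : ℝ) : 𝕂) = ((∑ j, t j ^ 2 * ‖c j‖ ^ 2 : ℝ) : 𝕂) := by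
      rw [RCLike.ofReal_pow, ← inner_self_eq_norm_sq_to_K (𝕜 := 𝕂), ← inner_gramOperator]
      have h4 : gramOperator J f = ∑ j, (((t j ^ 2 : ℝ) : 𝕂) * c j) • w j := by
        rw [hf, map_sum]
        refine Finset.sum_congr rfl fun j _ => ?_
        rw [map_smul, show gramOperator J (w j) = _ from hwt j, smul_smul, mul_comm]
      rw [h4, hf, hw.inner_sum]
      push_cast
      refine Finset.sum_congr rfl fun j _ => ?_
      rw [map_mul, ← RCLike.ofReal_pow, RCLike.conj_ofReal, mul_assoc, RCLike.conj_mul]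
    exact_mod_cast h3
  have h3 : s * ‖f‖ ≤ ‖J f‖ := by
    refine le_of_sq_le_sq ?_ (norm_nonneg _)
    rw [mul_pow, hf1, h2, Finset.mul_sum]
    refine Finset.sum_le_sum fun j _ => ?_
    have := ht j
    gcongr
  exact le_of_mul_le_mul_right (h3.trans h1) hf0

theorem inner_map_singular {v : ℕ → H} {σ : ℕ → ℝ}
    (heig : ∀ i, gramOperator J (v i) = ((σ i ^ 2 : ℝ) : 𝕂) • v i) (i : ℕ) (f : H) :
    inner 𝕂 (J (v i)) (J f) = ((σ i ^ 2 : ℝ) : 𝕂) * inner 𝕂 (v i) f := by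
  rw [← inner_gramOperator, heig, inner_smul_left, RCLike.conj_ofReal]

theorem norm_map_singular {v : ℕ → H} {σ : ℕ → ℝ} (hv : Orthonormal 𝕂 v) (hσ : ∀ i, 0 < σ i)
    (heig : ∀ i, gramOperator J (v i) = ((σ i ^ 2 : ℝ) : 𝕂) • v i) (i : ℕ) :
    ‖J (v i)‖ = σ i := by
  have h1 := inner_map_singular heig i (v i)
  rw [inner_self_eq_norm_sq_to_K, inner_self_eq_norm_sq_to_K, hv.1 i, RCLike.ofReal_one, one_pow,
    mul_one, ← RCLike.ofReal_pow] at h1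
  exact (sq_eq_sq₀ (norm_nonneg _) (hσ i).le).1 (RCLike.ofReal_injective h1)

/-- The left singular vectors are orthonormal, and the projections onto their spans are optimal. -/
theorem orthonormal_left_singular {v : ℕ → H} {σ : ℕ → ℝ} (hv : Orthonormal 𝕂 v)
    (hσ : ∀ i, 0 < σ i) (heig : ∀ i, gramOperator J (v i) = ((σ i ^ 2 : ℝ) : 𝕂) • v i)
    (hbound : ∀ n f, (∀ i < n, inner 𝕂 (v i) f = 0) → ‖J f‖ ≤ σ n * ‖f‖) :
    Orthonormal 𝕂 (fun i => ((σ i)⁻¹ : 𝕂) • J (v i)) ∧ ∀ n f,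
      ‖J f - ∑ i ∈ Finset.range n, inner 𝕂 (((σ i)⁻¹ : 𝕂) • J (v i)) (J f) •
        ((σ i)⁻¹ : 𝕂) • J (v i)‖ ≤ σ n * ‖f‖ := by
  have hσ0 : ∀ i, (σ i : 𝕂) ≠ 0 := fun i => RCLike.ofReal_ne_zero.2 (hσ i).ne'
  refine ⟨⟨fun i => ?_, fun i j hij => ?_⟩, fun n f => ?_⟩
  · rw [norm_smul, norm_map_singular hv hσ heig, norm_inv, RCLike.norm_ofReal, abs_of_pos (hσ i),
      inv_mul_cancel₀ (hσ i).ne']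
  · change inner 𝕂 _ _ = 0
    rw [inner_smul_left, inner_smul_right, inner_map_singular heig, hv.2 hij, mul_zero, mul_zero,
      mul_zero]
  · have h1 : J f - ∑ i ∈ Finset.range n, inner 𝕂 (((σ i)⁻¹ : 𝕂) • J (v i)) (J f) •
        ((σ i)⁻¹ : 𝕂) • J (v i) = J (f - ∑ i ∈ Finset.range n, inner 𝕂 (v i) f • v i) := by
      rw [map_sub, map_sum]
      congr 1
      refine Finset.sum_congr rfl fun i _ => ?_
      rw [map_smul, inner_smul_left, inner_map_singular heig, smul_smul, map_inv₀,
        RCLike.conj_ofReal]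
      congr 1
      have := hσ0 i
      push_cast
      field_simp
    rw [h1]
    refine (hbound n _ fun i hi =>
      hv.inner_sub_projection_eq_zero f (Finset.mem_range.2 hi)).trans ?_
    refine mul_le_mul_of_nonneg_left ?_ (hσ n).le
    have h2 := hv.norm_sub_sum_sq (Finset.range n) f (fun _ => 0)
    simp only [zero_smul, Finset.sum_const_zero, sub_zero] at h2
    refine le_of_sq_le_sq ?_ (norm_nonneg _)
    rw [h2]
    exact le_add_of_nonneg_right (Finset.sum_nonneg fun _ _ => by positivity)

end SingularSystem

/-! ### Orders of convergence -/

section Order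

theorem minError_antitone (P : Problem) : Antitone P.minError := fun _ _ hmn =>
  le_iInf₂ fun A hA => iInf₂_le A (hA.trans (by exact_mod_cast hmn))

/-- The sequence `a` of extended nonnegative numbers is of the order of the real sequence `s`, with
real constants. -/
def HasOrder (n₀ : ℕ) (a : ℕ → ℝ≥0∞) (s : ℕ → ℝ) : Prop :=
  ∃ c C : ℝ, 0 < c ∧ 0 < C ∧ ∀ n, n₀ ≤ n →
    ENNReal.ofReal (c * s n) ≤ a n ∧ a n ≤ ENNReal.ofReal (C * s n)

theorem HasOrder.weakEquiv {n₀ : ℕ} {a b : ℕ → ℝ≥0∞} {s : ℕ → ℝ} (ha : HasOrder n₀ a s)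
    (hb : HasOrder n₀ b s) : WeakEquiv n₀ a b := by
  obtain ⟨c, C, hc, hC, h⟩ := ha
  obtain ⟨c', C', hc', hC', h'⟩ := hb
  refine ⟨ENNReal.ofReal (c / C'), ENNReal.ofReal (C / c'), ENNReal.ofReal_pos.2 (by positivity),
    ENNReal.ofReal_lt_top, fun n hn => ⟨?_, ?_⟩⟩
  · calc ENNReal.ofReal (c / C') * b n
        ≤ ENNReal.ofReal (c / C') * ENNReal.ofReal (C' * s n) := mul_le_mul_right (h' n hn).2 _
      _ = ENNReal.ofReal (c * s n) := by
          rw [← ENNReal.ofReal_mul (by positivity)]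
          congr 1
          field_simp
      _ ≤ a n := (h n hn).1
  · calc a n ≤ ENNReal.ofReal (C * s n) := (h n hn).2
      _ = ENNReal.ofReal (C / c') * ENNReal.ofReal (c' * s n) := by
          rw [← ENNReal.ofReal_mul (by positivity)]
          congr 1
          field_simp
      _ ≤ ENNReal.ofReal (C / c') * b n := mul_le_mul_right (h' n hn).1 _

theorem hasOrder_ofReal (n₀ : ℕ) (s : ℕ → ℝ) : HasOrder n₀ (fun n => ENNReal.ofReal (s n)) s :=
  ⟨1, 1, one_pos, one_pos, fun n _ => by simp⟩

/-- Upper bounds along dyadic numbers extend to all numbers, for sequences that decay at most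
polynomially. -/
theorem exists_le_of_dyadic {a : ℕ → ℝ≥0∞} (ha : Antitone a) {s : ℕ → ℝ} (hs : ∀ n, 1 ≤ n → 0 < s n)
    (hanti : ∀ m n, 1 ≤ m → m ≤ n → s n ≤ s m) {B : ℝ} (hB0 : 0 < B)
    (hB : ∀ n, 1 ≤ n → s n ≤ B * s (2 * n))
    {C C₀ : ℝ} (hC : 0 < C) (h0 : a 0 ≤ ENNReal.ofReal C₀) (p : ℕ)
    (h : ∀ k, a (2 ^ (k + p)) ≤ ENNReal.ofReal (C * s (2 ^ k))) :
    ∃ C' : ℝ, 0 < C' ∧ ∀ n, 1 ≤ n → a n ≤ ENNReal.ofReal (C' * s n) := by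
  have hiter : ∀ j n, 1 ≤ n → s n ≤ B ^ j * s (2 ^ j * n) := by
    intro j
    induction j with
    | zero => intro n _; simp
    | succ j ih =>
      intro n hn
      calc s n ≤ B ^ j * s (2 ^ j * n) := ih n hn
        _ ≤ B ^ j * (B * s (2 * (2 ^ j * n))) := by
            gcongr
            exact hB _ (Nat.one_le_iff_ne_zero.2 (by positivity))
        _ = B ^ (j + 1) * s (2 ^ (j + 1) * n) := by
            rw [pow_succ, pow_succ', mul_assoc, mul_assoc]
  have hp : 0 < s (2 ^ p) := hs _ Nat.one_le_two_pow
  refine ⟨C * B ^ (p + 1) + |C₀| / s (2 ^ p), by positivity, fun n hn => ?_⟩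
  have hsn := hs n hn
  rcases lt_or_ge n (2 ^ p) with hlt | hge
  · refine (ha (Nat.zero_le n)).trans (h0.trans (ENNReal.ofReal_le_ofReal ?_))
    have h1 : s (2 ^ p) ≤ s n := hanti n _ hn hlt.le
    have h2 : |C₀| ≤ |C₀| / s (2 ^ p) * s n := by
      rw [div_mul_eq_mul_div, le_div_iff₀ hp]
      gcongr
    have h3 : 0 ≤ C * B ^ (p + 1) * s n := by positivity
    linarith [le_abs_self C₀]
  · set k := Nat.log 2 n - p with hk
    have hkp : k + p = Nat.log 2 n := by
      have : p ≤ Nat.log 2 n := Nat.le_log_of_pow_le (by norm_num) hge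
      omega
    have h1 : 2 ^ (k + p) ≤ n := by
      rw [hkp]
      exact Nat.pow_log_le_self 2 (by omega)
    have h2 : n ≤ 2 ^ (p + 1) * 2 ^ k := by
      rw [← pow_add, show p + 1 + k = Nat.log 2 n + 1 by omega]
      exact (Nat.lt_pow_succ_log_self (by norm_num) n).le
    refine (ha h1).trans ((h k).trans (ENNReal.ofReal_le_ofReal ?_))
    have h3 : s (2 ^ k) ≤ B ^ (p + 1) * s n :=
      (hiter (p + 1) _ Nat.one_le_two_pow).trans (by gcongr; exact hanti n _ hn h2)
    have h4 : 0 ≤ |C₀| / s (2 ^ p) * s n := by positivity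
    nlinarith

end Order

/-! ### Compact embeddings of Hilbert spaces -/

section HilbertOrder

variable {𝕂 : Type k₀} [RCLike 𝕂] {D : Type u₀} [MeasurableSpace D] {μ : Measure D}
  {H : Type h₀} [NormedAddCommGroup H] [InnerProductSpace 𝕂 H]
  {J : H →L[𝕂] Lp 𝕂 2 μ}

theorem nonempty_of_infinite_dimensional (hinj : Function.Injective J)
    (hH : ¬ FiniteDimensional 𝕂 H) : Nonempty D := by
  by_contra hD
  rw [not_nonempty_iff] at hD
  have h1 : Subsingleton (Lp 𝕂 2 μ) :=
    ⟨fun f g => Lp.ext (Filter.Eventually.of_forall fun x => hD.elim x)⟩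
  have h2 : Subsingleton H := hinj.subsingleton
  exact hH inferInstance

variable [CompleteSpace H]

theorem exists_doubling_of_weakEquiv {s : ℕ → ℝ} (hs : ∀ n, 1 ≤ n → 0 < s n)
    (h : WeakEquiv 1 (fun n => ENNReal.ofReal (s (2 * n))) (fun n => ENNReal.ofReal (s n))) :
    ∃ B : ℝ, 0 < B ∧ ∀ n, 1 ≤ n → s n ≤ B * s (2 * n) := by
  obtain ⟨c, C, hc, -, h⟩ := h
  have hc0 : min c 1 ≠ 0 := (lt_min hc one_pos).ne'
  have hc1 : min c 1 ≠ ⊤ := ((min_le_right _ _).trans_lt ENNReal.one_lt_top).ne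
  have hpos : 0 < (min c 1).toReal := ENNReal.toReal_pos hc0 hc1
  refine ⟨((min c 1).toReal)⁻¹, by positivity, fun n hn => ?_⟩
  rw [le_inv_mul_iff₀ hpos]
  have h1 : ENNReal.ofReal ((min c 1).toReal * s n) ≤ ENNReal.ofReal (s (2 * n)) := by
    rw [ENNReal.ofReal_mul hpos.le, ENNReal.ofReal_toReal hc1]
    exact (mul_le_mul_left (min_le_left c 1) _).trans (h n hn).1
  exact (ENNReal.ofReal_le_ofReal_iff (hs (2 * n) (by omega)).le).1 h1

/-- For a compact embedding whose singular values decay at most polynomially, all three minimal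
errors are of the order of the singular values. -/
theorem hasOrder_singularValue (hH : ¬ FiniteDimensional 𝕂 H) (hinj : Function.Injective J)
    (hJ : IsCompactOperator J)
    (hdouble : WeakEquiv 1 (fun n => ENNReal.ofReal (singularValue J (2 * n)))
      (fun n => ENNReal.ofReal (singularValue J n)))
    (𝓕 : Submodule 𝕂 (D → 𝕂)) (h𝓕 : ∀ g ∈ 𝓕, Measurable g)
    (hrep : ∀ f : H, ∃ g ∈ 𝓕, g =ᵐ[μ] J f) :
    HasOrder 1 (linRanProblem.{u₀} J).minError (singularValue J) ∧
      HasOrder 1 (linDetProblem J).minError (singularValue J) ∧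
      HasOrder 1 (stdRanProblem.{u₀} J (𝓕 : Set (D → 𝕂))).minError (singularValue J) := by
  obtain ⟨v, σ, hv, hσ, hanti, heig, hbound⟩ := exists_singular_system hJ hinj hH
  have hsv := singularValue_eq hv hσ hanti heig hbound
  obtain ⟨he, hproj⟩ := orthonormal_left_singular hv hσ heig hbound
  set e : ℕ → Lp 𝕂 2 μ := fun i => ((σ i)⁻¹ : 𝕂) • J (v i)
  have hsv' : ∀ n, 1 ≤ n → singularValue J n = σ (n - 1) := fun n hn => by
    rw [← hsv, Nat.sub_add_cancel hn]
  have hspos : ∀ n, 1 ≤ n → 0 < singularValue J n := fun n hn => by rw [hsv' n hn]; exact hσ _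
  have hsanti : ∀ m n, 1 ≤ m → m ≤ n → singularValue J n ≤ singularValue J m := fun m n hm hmn => by
    rw [hsv' m hm, hsv' n (hm.trans hmn)]
    exact hanti (by omega)
  have hσs : ∀ n, 1 ≤ n → σ n ≤ singularValue J n := fun n hn => by
    rw [hsv' n hn]
    exact hanti (by omega)
  obtain ⟨B, hB0, hB⟩ := exists_doubling_of_weakEquiv hspos hdouble
  have hB4 : ∀ n, 1 ≤ n → 1 / (64 * B ^ 2) * singularValue J n ≤ singularValue J (4 * n) / 64 := by
    intro n hn
    have h1 := hB n hn
    have h2 := hB (2 * n) (by omega)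
    rw [← mul_assoc, show 2 * 2 = 4 from rfl] at h2
    have h3 : singularValue J n ≤ B * (B * singularValue J (4 * n)) :=
      h1.trans (by gcongr)
    rw [div_mul_eq_mul_div, one_mul, div_le_div_iff₀ (by positivity) (by norm_num)]
    nlinarith
  have hlow : ∀ n, 1 ≤ n → Orthonormal 𝕂 (fun i : Fin (4 * n) => v i) ∧
      (∀ i j : Fin (4 * n), i ≠ j → inner 𝕂 (J (v i)) (J (v j)) = 0) ∧
      0 < singularValue J (4 * n) ∧ ∀ i : Fin (4 * n), singularValue J (4 * n) ≤ ‖J (v i)‖ := by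
    intro n hn
    refine ⟨hv.comp _ Fin.val_injective, fun i j hij => ?_, hspos _ (by omega), fun i => ?_⟩
    · rw [inner_map_singular heig, hv.2 (fun h => hij (Fin.ext h)), mul_zero]
    · rw [norm_map_singular hv hσ heig, hsv' _ (by omega)]
      exact hanti (by have := i.2; omega)
  have hlin : ∀ n, 1 ≤ n → ∀ f : H, ‖J f - ∑ i ∈ Finset.range n, inner 𝕂 (e i) (J f) • e i‖ ≤
      singularValue J n * ‖f‖ := fun n hn f =>
    (hproj n f).trans (by gcongr; exact hσs n hn)
  refine ⟨⟨1 / (64 * B ^ 2), 1, by positivity, one_pos, fun n hn => ⟨?_, ?_⟩⟩,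
    ⟨1 / (64 * B ^ 2), 1, by positivity, one_pos, fun n hn => ⟨?_, ?_⟩⟩, ?_⟩
  · obtain ⟨h1, h2, h3, h4⟩ := hlow n hn
    exact (ENNReal.ofReal_le_ofReal (hB4 n hn)).trans (le_minError_linRanProblem hn h1 h2 h3 h4)
  · rw [one_mul]
    exact minError_linRanProblem_le (hspos n hn).le (hlin n hn) (Finset.card_range n).le
  · obtain ⟨h1, h2, h3, h4⟩ := hlow n hn
    exact (ENNReal.ofReal_le_ofReal (hB4 n hn)).trans (le_minError_linDetProblem hn h1 h2 h3 h4)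
  · rw [one_mul]
    exact minError_linDetProblem_le (hspos n hn).le (hlin n hn) (Finset.card_range n).le
  · have hD := nonempty_of_infinite_dimensional hinj hH
    obtain ⟨m, C, hm, hC, hstd⟩ := exists_minError_stdRanProblem_le (J := J) h𝓕 he
      (Λ := fun k => Finset.range (2 ^ k)) (τ := fun k => singularValue J (2 ^ k)) (B := B)
      (fun i j hij => Finset.range_mono (Nat.pow_le_pow_right (by norm_num) hij)) (by simp)
      (fun k => hspos _ Nat.one_le_two_pow)
      (fun k => by rw [pow_succ']; exact hB _ Nat.one_le_two_pow)
      (fun k f => hlin _ Nat.one_le_two_pow f)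
    have h0 := minError_stdRanProblem_le_norm (J := J) h𝓕 0
    obtain ⟨C', hC', hup⟩ := exists_le_of_dyadic (minError_antitone _) hspos hsanti hB0 hB hC h0
      (m + 1) fun k => hstd k (2 ^ (k + (m + 1))) (by
        simp only [Finset.card_range]
        have h1 : ∑ i ∈ Finset.range (k + 1), 2 ^ i ≤ 2 ^ (k + 1) := by
          have := Nat.geomSum_eq (le_refl 2) (k + 1)
          rw [this]
          exact (Nat.div_le_self _ _).trans (Nat.sub_le _ _)
        have h2 : m ≤ 2 ^ m := Nat.lt_two_pow_self.le
        calc m * ∑ i ∈ Finset.range (k + 1), 2 ^ i ≤ 2 ^ m * 2 ^ (k + 1) := Nat.mul_le_mul h2 h1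
          _ = 2 ^ (k + (m + 1)) := by rw [← pow_add]; congr 1; omega)
    refine ⟨1 / (64 * B ^ 2), C', by positivity, hC', fun n hn => ⟨?_, hup n hn⟩⟩
    obtain ⟨h1, h2, h3, h4⟩ := hlow n hn
    choose g hg𝓕 hgJ using fun i : Fin (4 * n) => hrep (v i)
    exact (ENNReal.ofReal_le_ofReal (hB4 n hn)).trans (le_minError_stdRanProblem hn h1 h2 h3 h4
      hg𝓕 hgJ fun i => h𝓕 _ (hg𝓕 i))

end HilbertOrder

/-! ### Legendre and Jacobi polynomials -/

section Legendre

open Polynomial Filter Topology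

/-- The polynomial `x (1 - x)`. The derivatives of its powers are the (shifted) Legendre and Jacobi
polynomials on `[0,1]`. -/
noncomputable def bumpPoly : ℝ[X] := X * (1 - X)

/-- The antiderivative of order `a` of the (unnormalized, shifted) Legendre polynomial
`D^l (x (1 - x))^l` that vanishes to order `a` at the endpoints of `[0,1]`. -/
noncomputable def legendre (l a : ℕ) : ℝ[X] := derivative^[l - a] (bumpPoly ^ l)

/-- The cofactor of `(x (1 - x))^a` in `legendre l a`, a Jacobi polynomial. -/
noncomputable def jacobi (l a : ℕ) : ℝ[X] := legendre l a / bumpPoly ^ a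

/-- The squared norm of `jacobi l a` with respect to the weight `(x (1 - x))^a`. -/
noncomputable def jacobiNorm (l a : ℕ) : ℝ :=
  (l - a).factorial * (2 * l).descFactorial (l - a) * ∫ x in (0 : ℝ)..1, (bumpPoly ^ l).eval x

theorem eval_bumpPoly (x : ℝ) : bumpPoly.eval x = x * (1 - x) := by simp [bumpPoly]

theorem bumpPoly_eq : bumpPoly = C (-1) * X ^ 2 + C 1 * X + C 0 := by
  simp only [bumpPoly, C_neg, C_1, C_0]
  ring

theorem natDegree_bumpPoly : bumpPoly.natDegree = 2 := by
  rw [bumpPoly_eq]; exact natDegree_quadratic (by norm_num)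

theorem leadingCoeff_bumpPoly : bumpPoly.leadingCoeff = -1 := by
  rw [bumpPoly_eq]; exact leadingCoeff_quadratic (by norm_num)

theorem bumpPoly_ne_zero : bumpPoly ≠ 0 := by
  intro h
  have := natDegree_bumpPoly
  simp [h] at this

theorem eval_bumpPoly_nonneg {x : ℝ} (hx : x ∈ Set.Icc (0 : ℝ) 1) : 0 ≤ bumpPoly.eval x := by
  rw [eval_bumpPoly]; exact mul_nonneg hx.1 (by linarith [hx.2])

theorem bumpPoly_pow_mul_jacobi {l a : ℕ} (h : a ≤ l) :
    bumpPoly ^ a * jacobi l a = legendre l a := by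
  refine EuclideanDomain.mul_div_cancel' (pow_ne_zero _ bumpPoly_ne_zero) ?_
  have := pow_sub_dvd_iterate_derivative_pow bumpPoly l (l - a)
  rwa [Nat.sub_sub_self h] at this

theorem derivative_legendre {l a : ℕ} (h : a + 1 ≤ l) :
    derivative (legendre l (a + 1)) = legendre l a := by
  unfold legendre
  rw [← Function.iterate_succ_apply' derivative]
  congr 2
  omega

theorem eval_legendre_endpoint {l a : ℕ} (h : a ≤ l) (ha : 0 < a) {x : ℝ} (hx : x = 0 ∨ x = 1) :
    (legendre l a).eval x = 0 := by
  rw [← bumpPoly_pow_mul_jacobi h, eval_mul, eval_pow, eval_bumpPoly]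
  rcases hx with rfl | rfl <;> simp [ha.ne']

theorem intervalIntegrable_eval (f : ℝ[X]) (a b : ℝ) :
    IntervalIntegrable (fun x => f.eval x) volume a b :=
  f.continuous.intervalIntegrable _ _

theorem integral_eval_derivative (f : ℝ[X]) (x : ℝ) :
    ∫ t in (0 : ℝ)..x, (derivative f).eval t = f.eval x - f.eval 0 := by
  refine intervalIntegral.integral_eq_sub_of_hasDerivAt (fun t _ => f.hasDerivAt t)
    (intervalIntegrable_eval _ _ _)

/-- Integration by parts, `j` times: the boundary terms vanish, since the derivatives of order less
than `l` of `bumpPoly ^ l` vanish at the end points. -/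
theorem integral_mul_legendre (f : ℝ[X]) (l j : ℕ) (hj : j ≤ l) :
    ∫ x in (0 : ℝ)..1, (f * legendre l (l - j)).eval x =
      (-1) ^ j * ∫ x in (0 : ℝ)..1, (derivative^[j] f * bumpPoly ^ l).eval x := by
  induction j generalizing f with
  | zero => simp [legendre]
  | succ j ih =>
    have h1 := integral_eval_derivative (f * legendre l (l - j)) 1
    rw [eval_mul, eval_mul, eval_legendre_endpoint (by omega) (by omega) (Or.inl rfl),
      eval_legendre_endpoint (by omega) (by omega) (Or.inr rfl), derivative_mul,
      show l - j = l - (j + 1) + 1 by omega, derivative_legendre (by omega)] at h1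
    simp only [eval_add] at h1
    rw [intervalIntegral.integral_add (intervalIntegrable_eval _ _ _)
      (intervalIntegrable_eval _ _ _), show l - (j + 1) + 1 = l - j by omega,
      ih _ (by omega)] at h1
    rw [Function.iterate_succ_apply, pow_succ]
    linarith

theorem natDegree_bumpPoly_pow (l : ℕ) : (bumpPoly ^ l).natDegree = 2 * l := by
  rw [natDegree_pow, natDegree_bumpPoly, mul_comm]

theorem coeff_legendre {l a : ℕ} (h : a ≤ l) :
    (legendre l a).coeff (l + a) = (2 * l).descFactorial (l - a) * (-1) ^ l := by
  unfold legendre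
  rw [coeff_iterate_derivative, show l + a + (l - a) = 2 * l by omega, nsmul_eq_mul]
  congr 1
  rw [← natDegree_bumpPoly_pow l, coeff_natDegree, leadingCoeff_pow, leadingCoeff_bumpPoly]

theorem descFactorial_two_mul_pos (l a : ℕ) : 0 < (2 * l).descFactorial (l - a) :=
  Nat.pos_of_ne_zero fun h => by rw [Nat.descFactorial_eq_zero_iff_lt] at h; omega

theorem natDegree_legendre {l a : ℕ} (h : a ≤ l) : (legendre l a).natDegree = l + a := by
  refine natDegree_eq_of_le_of_coeff_ne_zero ?_ ?_
  · refine (natDegree_iterate_derivative _ _).trans ?_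
    rw [natDegree_bumpPoly_pow]; omega
  · rw [coeff_legendre h]
    have := descFactorial_two_mul_pos l a
    positivity

theorem legendre_ne_zero {l a : ℕ} (h : a ≤ l) : legendre l a ≠ 0 := by
  intro h0
  have h1 := coeff_legendre h
  have := descFactorial_two_mul_pos l a
  rw [h0, coeff_zero] at h1
  exact absurd h1.symm (by positivity)

theorem leadingCoeff_legendre {l a : ℕ} (h : a ≤ l) :
    (legendre l a).leadingCoeff = (2 * l).descFactorial (l - a) * (-1) ^ l := by
  rw [← coeff_legendre h, leadingCoeff, natDegree_legendre h]

theorem jacobi_ne_zero {l a : ℕ} (h : a ≤ l) : jacobi l a ≠ 0 := by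
  intro h0
  have h1 := bumpPoly_pow_mul_jacobi h
  rw [h0, mul_zero] at h1
  exact legendre_ne_zero h h1.symm

theorem natDegree_jacobi {l a : ℕ} (h : a ≤ l) : (jacobi l a).natDegree = l - a := by
  have h1 := congrArg natDegree (bumpPoly_pow_mul_jacobi h)
  rw [natDegree_mul (pow_ne_zero _ bumpPoly_ne_zero) (jacobi_ne_zero h), natDegree_bumpPoly_pow,
    natDegree_legendre h] at h1
  omega

theorem leadingCoeff_jacobi {l a : ℕ} (h : a ≤ l) :
    (jacobi l a).leadingCoeff = (2 * l).descFactorial (l - a) * (-1) ^ (l - a) := by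
  have h1 := congrArg leadingCoeff (bumpPoly_pow_mul_jacobi h)
  rw [leadingCoeff_mul, leadingCoeff_pow, leadingCoeff_bumpPoly, leadingCoeff_legendre h] at h1
  have h2 : ((-1 : ℝ) ^ l) = (-1) ^ (l - a) * (-1) ^ a := by rw [← pow_add, Nat.sub_add_cancel h]
  have h3 : ((-1 : ℝ) ^ a) * (-1) ^ a = 1 := by rw [← mul_pow]; norm_num
  calc (jacobi l a).leadingCoeff = ((-1 : ℝ) ^ a) * (-1) ^ a * (jacobi l a).leadingCoeff := by
        rw [h3, one_mul]
    _ = (-1) ^ a * ((2 * l).descFactorial (l - a) * ((-1) ^ (l - a) * (-1) ^ a)) := by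
        rw [mul_assoc, h1, h2]
    _ = ((-1 : ℝ) ^ a) * (-1) ^ a * ((2 * l).descFactorial (l - a) * (-1) ^ (l - a)) := by ring
    _ = _ := by rw [h3, one_mul]

theorem integral_jacobi_mul_legendre_of_lt {k l a : ℕ} (hk : a ≤ k) (hkl : k < l) :
    ∫ x in (0 : ℝ)..1, (jacobi k a * legendre l a).eval x = 0 := by
  have h := integral_mul_legendre (jacobi k a) l (l - a) (by omega)
  rw [Nat.sub_sub_self (by omega), iterate_derivative_eq_zero (by rw [natDegree_jacobi hk]; omega)]
    at h
  simpa using h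

/-- The Jacobi polynomials are orthogonal with respect to the weight `(x (1 - x))^a`. -/
theorem integral_jacobi_mul_jacobi {k l a : ℕ} (hk : a ≤ k) (hl : a ≤ l) :
    ∫ x in (0 : ℝ)..1, (bumpPoly ^ a * jacobi k a * jacobi l a).eval x =
      if k = l then jacobiNorm l a else 0 := by
  rcases lt_trichotomy k l with h | rfl | h
  · rw [if_neg h.ne]
    refine Eq.trans ?_ (integral_jacobi_mul_legendre_of_lt hk h)
    rw [← bumpPoly_pow_mul_jacobi hl]
    congr! 3; ring
  · rw [if_pos rfl]
    have h := integral_mul_legendre (jacobi k a) k (k - a) (by omega)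
    have hD : derivative^[k - a] (jacobi k a) =
        C ((k - a).factorial * ((2 * k).descFactorial (k - a) * (-1) ^ (k - a)) : ℝ) := by
      have h0 : (derivative^[k - a] (jacobi k a)).natDegree = 0 := by
        have := natDegree_iterate_derivative (jacobi k a) (k - a)
        rw [natDegree_jacobi hk] at this; omega
      rw [eq_C_of_natDegree_eq_zero h0, coeff_iterate_derivative, zero_add, nsmul_eq_mul,
        Nat.descFactorial_self]
      congr 2
      rw [← leadingCoeff_jacobi hk, leadingCoeff, natDegree_jacobi hk]
    rw [Nat.sub_sub_self hk, hD, ← bumpPoly_pow_mul_jacobi hk] at h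
    have e : ((-1 : ℝ) ^ (k - a)) * (-1) ^ (k - a) = 1 := by rw [← mul_pow]; norm_num
    calc _ = ∫ x in (0 : ℝ)..1, (jacobi k a * (bumpPoly ^ a * jacobi k a)).eval x := by
          congr! 3; ring
      _ = ((-1 : ℝ) ^ (k - a)) * (-1) ^ (k - a) * jacobiNorm k a := by
          rw [h]; simp only [eval_mul, eval_C, intervalIntegral.integral_const_mul, jacobiNorm]
          ring
      _ = _ := by rw [e, one_mul]
  · rw [if_neg h.ne']
    refine Eq.trans ?_ (integral_jacobi_mul_legendre_of_lt hl h)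
    rw [← bumpPoly_pow_mul_jacobi hk]
    congr! 3; ring

theorem jacobiNorm_pos (l a : ℕ) : 0 < jacobiNorm l a := by
  unfold jacobiNorm
  have h1 := descFactorial_two_mul_pos l a
  have h2 : 0 < ∫ x in (0 : ℝ)..1, (bumpPoly ^ l).eval x := by
    refine intervalIntegral.intervalIntegral_pos_of_pos_on (intervalIntegrable_eval _ _ _) ?_
      one_pos
    intro x hx
    rw [eval_pow, eval_bumpPoly]
    exact pow_pos (mul_pos hx.1 (by linarith [hx.2])) _
  have := Nat.factorial_pos (l - a)
  positivity

/-- The weighted norms of the Jacobi polynomials decay like `l ^ (-2 a)`; this is what converts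
smoothness into decay of Legendre coefficients. -/
theorem jacobiNorm_mul_pow_le {l a : ℕ} (h : a ≤ l) :
    jacobiNorm l a * ((l : ℝ) + 1) ^ (2 * a) ≤ ((a : ℝ) + 1) ^ (2 * a) * jacobiNorm l 0 := by
  have hI : 0 ≤ ∫ x in (0 : ℝ)..1, (bumpPoly ^ l).eval x := by
    refine intervalIntegral.integral_nonneg zero_le_one fun x hx => ?_
    rw [eval_pow]; exact pow_nonneg (eval_bumpPoly_nonneg hx) _
  have hN : (l - a).factorial * (2 * l).descFactorial (l - a) * (l + 1) ^ (2 * a) ≤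
      (a + 1) ^ (2 * a) * (l.factorial * (2 * l).descFactorial l) := by
    have e1 := Nat.factorial_mul_descFactorial (show l - a ≤ 2 * l by omega)
    have e2 := Nat.factorial_mul_descFactorial (show l ≤ 2 * l by omega)
    rw [show 2 * l - (l - a) = l + a by omega] at e1
    rw [show 2 * l - l = l by omega, ← e1] at e2
    rw [e2]
    have h1 := Nat.factorial_mul_pow_le_factorial (m := l - a) (n := 2 * a)
    rw [show l - a + 2 * a = l + a by omega] at h1
    have h2 : l + 1 ≤ (a + 1) * (l - a + 1) := by
      obtain ⟨m, rfl⟩ := Nat.exists_eq_add_of_le h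
      rw [Nat.add_sub_cancel_left]; nlinarith [Nat.zero_le (a * m)]
    calc (l - a).factorial * (2 * l).descFactorial (l - a) * (l + 1) ^ (2 * a)
        ≤ (l - a).factorial * (2 * l).descFactorial (l - a) *
          ((a + 1) * (l - a + 1)) ^ (2 * a) := by gcongr
      _ = (a + 1) ^ (2 * a) * (((l - a).factorial * (l - a + 1) ^ (2 * a)) *
          (2 * l).descFactorial (l - a)) := by rw [mul_pow]; ring
      _ ≤ _ := by gcongr
  have hN' : ((l - a).factorial : ℝ) * (2 * l).descFactorial (l - a) * ((l : ℝ) + 1) ^ (2 * a) ≤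
      ((a : ℝ) + 1) ^ (2 * a) * (l.factorial * (2 * l).descFactorial l) := by exact_mod_cast hN
  unfold jacobiNorm
  simp only [Nat.sub_zero]
  have := mul_le_mul_of_nonneg_right hN' hI
  linarith

/-- Every polynomial is in the span of the Legendre polynomials. -/
theorem mem_span_legendre (f : ℝ[X]) : f ∈ Submodule.span ℝ (Set.range fun l => legendre l 0) := by
  induction hn : f.natDegree using Nat.strong_induction_on generalizing f with
  | _ n ih =>
    have hc : (legendre n 0).leadingCoeff ≠ 0 := by
      simpa using legendre_ne_zero (Nat.zero_le n)
    have hmem : legendre n 0 ∈ Submodule.span ℝ (Set.range fun l => legendre l 0) :=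
      Submodule.subset_span ⟨n, rfl⟩
    set c := f.leadingCoeff / (legendre n 0).leadingCoeff with hcdef
    have hg : f - c • legendre n 0 ∈ Submodule.span ℝ (Set.range fun l => legendre l 0) := by
      have hcoeff : (f - c • legendre n 0).coeff n = 0 := by
        rw [coeff_sub, coeff_smul, smul_eq_mul]
        have e1 : (legendre n 0).coeff n = (legendre n 0).leadingCoeff := by
          rw [leadingCoeff, natDegree_legendre (Nat.zero_le n), add_zero]
        rw [e1, hcdef, div_mul_cancel₀ _ hc, leadingCoeff, hn, sub_self]
      have hle : (f - c • legendre n 0).natDegree ≤ n := by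
        have h2 : (c • legendre n 0).natDegree ≤ n := by
          refine (natDegree_smul_le c (legendre n 0)).trans ?_
          rw [natDegree_legendre (Nat.zero_le n), add_zero]
        simpa using natDegree_sub_le_of_le hn.le h2
      rcases Nat.eq_zero_or_pos n with h0 | hpos
      · have : f - c • legendre n 0 = 0 := by
          rw [eq_C_of_natDegree_eq_zero (by omega : (f - c • legendre n 0).natDegree = 0)]
          rw [h0] at hcoeff ⊢
          rw [hcoeff, C_0]
        rw [this]; exact Submodule.zero_mem _
      · refine ih _ ?_ _ rfl
        refine lt_of_le_of_ne hle fun h => ?_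
        have h1 : (f - c • legendre n 0).leadingCoeff = 0 := by rw [leadingCoeff, h, hcoeff]
        rw [leadingCoeff_eq_zero] at h1
        rw [h1] at h; simp at h; omega
    have := Submodule.add_mem _ hg (Submodule.smul_mem _ c hmem)
    simpa using this

end Legendre

/-! ### Test functions approximating Legendre polynomials -/

section LegendreApproximants

open Polynomial Filter Topology
open scoped ContDiff

/-- `φ` is smooth with compact support inside `(0,1)`. -/
structure IsUnitTest (φ : ℝ → ℝ) : Prop where
  contDiff : ContDiff ℝ ∞ φ
  support : ∃ a b : ℝ, 0 < a ∧ b < 1 ∧ ∀ x, x ∉ Set.Icc a b → φ x = 0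

/-- The test functions `φ n` converge to `u` and their derivatives of order `a` converge to `v`,
boundedly pointwise on `(0,1)`. -/
structure TestApprox (a : ℕ) (φ : ℕ → ℝ → ℝ) (u v : ℝ → ℝ) : Prop where
  isUnitTest : ∀ n, IsUnitTest (φ n)
  bound : ∃ C : ℝ, ∀ n, ∀ x ∈ Set.Icc (0 : ℝ) 1, |φ n x| ≤ C ∧ |iteratedDeriv a (φ n) x| ≤ C
  tendsto : ∀ x ∈ Set.Ioo (0 : ℝ) 1, Tendsto (fun n => φ n x) atTop (𝓝 (u x))
  tendsto_deriv : ∀ x ∈ Set.Ioo (0 : ℝ) 1,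
    Tendsto (fun n => iteratedDeriv a (φ n) x) atTop (𝓝 (v x))

theorem exists_contDiffBump (r R : ℝ) (hr : 0 < r) (hR : r < R) (hR1 : R < 1 / 2) :
    ∃ χ : ℝ → ℝ, IsUnitTest χ ∧ (∀ x, 0 ≤ χ x ∧ χ x ≤ 1) ∧
      ∀ x, |x - 1 / 2| ≤ r → χ x = 1 := by
  let χ : ContDiffBump (1 / 2 : ℝ) := ⟨r, R, hr, hR⟩
  refine ⟨χ, ⟨χ.contDiff, 1 / 2 - R, 1 / 2 + R, by linarith, by linarith, fun x hx => ?_⟩,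
    fun x => ⟨χ.nonneg, χ.le_one⟩, fun x hx => χ.one_of_mem_closedBall ?_⟩
  · refine χ.zero_of_le_dist ?_
    rw [Real.dist_eq]
    by_contra hlt
    rw [not_le, abs_lt] at hlt
    exact hx ⟨by linarith [hlt.1], by linarith [hlt.2]⟩
  · rwa [Metric.mem_closedBall, Real.dist_eq]

theorem IsUnitTest.intervalIntegrable {φ : ℝ → ℝ} (h : IsUnitTest φ) (a b : ℝ) :
    IntervalIntegrable φ volume a b := h.contDiff.continuous.intervalIntegrable _ _

theorem exists_isUnitTest_integral_eq_one :
    ∃ η : ℝ → ℝ, IsUnitTest η ∧ ∫ x in (0 : ℝ)..1, η x = 1 := by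
  obtain ⟨χ, hχ, h01, h1⟩ := exists_contDiffBump (1 / 8) (1 / 4) (by norm_num) (by norm_num)
    (by norm_num)
  have hpos : 0 < ∫ x in (0 : ℝ)..1, χ x := by
    have : ∫ x in (3 / 8 : ℝ)..(5 / 8), χ x ≤ ∫ x in (0 : ℝ)..1, χ x :=
      intervalIntegral.integral_mono_interval (by norm_num) (by norm_num) (by norm_num)
        (Eventually.of_forall fun x => (h01 x).1) (hχ.intervalIntegrable _ _)
    have h2 : ∫ x in (3 / 8 : ℝ)..(5 / 8), χ x = ∫ _x in (3 / 8 : ℝ)..(5 / 8), (1 : ℝ) := by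
      refine intervalIntegral.integral_congr fun x hx => h1 x ?_
      rw [Set.uIcc_of_le (by norm_num)] at hx
      rw [abs_le]; constructor <;> linarith [hx.1, hx.2]
    rw [h2] at this
    norm_num at this
    linarith
  refine ⟨fun x => (∫ x in (0 : ℝ)..1, χ x)⁻¹ * χ x, ⟨contDiff_const.mul hχ.contDiff, ?_⟩, ?_⟩
  · obtain ⟨a, b, ha, hb, hab⟩ := hχ.support
    exact ⟨a, b, ha, hb, fun x hx => by rw [hab x hx, mul_zero]⟩
  · rw [intervalIntegral.integral_const_mul, inv_mul_cancel₀ hpos.ne']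

/-- The antiderivative of a test function with mean value zero is a test function. -/
theorem IsUnitTest.primitive {g : ℝ → ℝ} (hg : IsUnitTest g) (h0 : ∫ x in (0 : ℝ)..1, g x = 0) :
    IsUnitTest (fun x => ∫ t in (0 : ℝ)..x, g t) ∧
      deriv (fun x => ∫ t in (0 : ℝ)..x, g t) = g := by
  have hc := hg.contDiff.continuous
  have hd : ∀ x, HasDerivAt (fun x => ∫ t in (0 : ℝ)..x, g t) (g x) x := fun x =>
    intervalIntegral.integral_hasDerivAt_right (hg.intervalIntegrable _ _)
      (hc.stronglyMeasurableAtFilter _ _) hc.continuousAt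
  have hderiv : deriv (fun x => ∫ t in (0 : ℝ)..x, g t) = g := funext fun x => (hd x).deriv
  refine ⟨⟨?_, ?_⟩, hderiv⟩
  · rw [contDiff_infty_iff_deriv]
    exact ⟨fun x => (hd x).differentiableAt, by rw [hderiv]; exact hg.contDiff⟩
  · obtain ⟨a, b, ha, hb, hab⟩ := hg.support
    refine ⟨a, b, ha, hb, fun x hx => ?_⟩
    rcases lt_or_ge x a with hxa | hxa
    · rw [intervalIntegral.integral_congr (g := fun _ => (0 : ℝ)) (fun t ht => hab t ?_)]
      · simp
      · intro h
        have := (Set.mem_uIcc.1 ht)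
        rcases this with h' | h' <;> linarith [h.1, h'.1, h'.2]
    · have hbx : b < x := by
        by_contra h; exact hx ⟨hxa, not_lt.1 h⟩
      have h1 : ∫ t in x..1, g t = 0 := by
        rw [intervalIntegral.integral_congr (g := fun _ => (0 : ℝ)) (fun t ht => hab t ?_)]
        · simp
        · intro h
          have := (Set.mem_uIcc.1 ht)
          rcases this with h' | h' <;> linarith [h.2, h'.1, h'.2]
      have h2 := intervalIntegral.integral_add_adjacent_intervals
        (hg.intervalIntegrable 0 x) (hg.intervalIntegrable x 1)
      rw [h1, h0, add_zero] at h2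
      exact h2

/-- Bounded pointwise convergence on `(0,1)` implies convergence of integrals. -/
theorem tendsto_integral_of_bounded {φ : ℕ → ℝ → ℝ} {u : ℝ → ℝ} {C : ℝ}
    (hc : ∀ n, Continuous (φ n)) (hb : ∀ n, ∀ x ∈ Set.Icc (0 : ℝ) 1, |φ n x| ≤ C)
    (hlim : ∀ x ∈ Set.Ioo (0 : ℝ) 1, Tendsto (fun n => φ n x) atTop (𝓝 (u x)))
    {x : ℝ} (hx : x ∈ Set.Icc (0 : ℝ) 1) :
    Tendsto (fun n => ∫ t in (0 : ℝ)..x, φ n t) atTop (𝓝 (∫ t in (0 : ℝ)..x, u t)) := by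
  refine intervalIntegral.tendsto_integral_filter_of_dominated_convergence (fun _ => C)
    (Eventually.of_forall fun n => (hc n).aestronglyMeasurable) ?_
    intervalIntegrable_const ?_
  · refine Eventually.of_forall fun n => Eventually.of_forall fun t ht => ?_
    rw [Set.uIoc_of_le hx.1] at ht
    exact hb n t ⟨ht.1.le, ht.2.trans hx.2⟩
  · have h1 : ∀ᵐ t : ℝ, t ≠ 1 := by simp [ae_iff]
    filter_upwards [h1] with t ht1 ht
    rw [Set.uIoc_of_le hx.1] at ht
    exact hlim t ⟨ht.1, lt_of_le_of_ne (ht.2.trans hx.2) ht1⟩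

/-- The antiderivatives of the Legendre polynomials are limits of test functions, together with
their derivatives. Hence the weak derivatives of a Sobolev function can be tested with them, and no
boundary terms occur. -/
theorem exists_testApprox_legendre (l a : ℕ) (h : a ≤ l) :
    ∃ φ : ℕ → ℝ → ℝ, TestApprox a φ (fun x => (legendre l a).eval x)
      (fun x => (legendre l 0).eval x) := by
  induction a with
  | zero =>
    have hex : ∀ n : ℕ, ∃ χ : ℝ → ℝ, IsUnitTest χ ∧ (∀ x, 0 ≤ χ x ∧ χ x ≤ 1) ∧
        ∀ x, |x - 1 / 2| ≤ 1 / 2 - 1 / ((n : ℝ) + 3) → χ x = 1 := by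
      intro n
      have h3 : 0 < 1 / ((n : ℝ) + 3) := by positivity
      have h4 : 1 / ((n : ℝ) + 3) ≤ 1 / 3 := by
        apply one_div_le_one_div_of_le <;> linarith [Nat.cast_nonneg (α := ℝ) n]
      exact exists_contDiffBump (1 / 2 - 1 / ((n : ℝ) + 3)) (1 / 2 - 1 / ((n : ℝ) + 3) / 2)
        (by linarith) (by linarith) (by linarith)
    choose χ hχ h01 h1 using hex
    obtain ⟨C, hC⟩ := (isCompact_Icc (a := (0 : ℝ)) (b := 1)).exists_bound_of_continuousOn
      (legendre l 0).continuous.continuousOn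
    have hb : ∀ n, ∀ x ∈ Set.Icc (0 : ℝ) 1, |(legendre l 0).eval x * χ n x| ≤ C := by
      intro n x hx
      rw [abs_mul, abs_of_nonneg (h01 n x).1]
      exact (mul_le_of_le_one_right (abs_nonneg _) (h01 n x).2).trans (hC x hx)
    have hl : ∀ x ∈ Set.Ioo (0 : ℝ) 1, Tendsto (fun n => (legendre l 0).eval x * χ n x) atTop
        (𝓝 ((legendre l 0).eval x)) := by
      intro x hx
      refine tendsto_const_nhds.congr' ?_
      have ht : Tendsto (fun n : ℕ => 1 / ((n : ℝ) + 3)) atTop (𝓝 0) := by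
        simpa using (tendsto_one_div_add_atTop_nhds_zero_nat (𝕜 := ℝ)).comp (tendsto_add_atTop_nat 2)
          |>.congr fun n => by simp only [Function.comp]; push_cast; ring_nf
      have hlt : |x - 1 / 2| < 1 / 2 := by
        rw [abs_lt]; constructor <;> linarith [hx.1, hx.2]
      filter_upwards [ht.eventually_lt_const (sub_pos.2 hlt)] with n hn
      rw [h1 n x (by linarith), mul_one]
    refine ⟨fun n x => (legendre l 0).eval x * χ n x, ⟨fun n => ⟨?_, ?_⟩, ⟨C, fun n x hx => ?_⟩,
      hl, ?_⟩⟩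
    · exact ((legendre l 0).contDiff_aeval ∞).mul (hχ n).contDiff
    · obtain ⟨a, b, ha, hb, hab⟩ := (hχ n).support
      exact ⟨a, b, ha, hb, fun x hx => by rw [hab x hx, mul_zero]⟩
    · rw [iteratedDeriv_zero]; exact ⟨hb n x hx, hb n x hx⟩
    · simp only [iteratedDeriv_zero]; exact hl
  | succ a ih =>
    obtain ⟨φ, hφ⟩ := ih (by omega)
    obtain ⟨η, hη, hη1⟩ := exists_isUnitTest_integral_eq_one
    obtain ⟨C, hC⟩ := hφ.bound
    obtain ⟨C', hC'⟩ := (isCompact_Icc (a := (0 : ℝ)) (b := 1)).exists_bound_of_continuousOn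
      hη.contDiff.continuous.continuousOn
    obtain ⟨C'', hC''⟩ := (isCompact_Icc (a := (0 : ℝ)) (b := 1)).exists_bound_of_continuousOn
      (hη.contDiff.continuous_iteratedDeriv a (by exact_mod_cast le_top)).continuousOn
    have h00 : (0 : ℝ) ∈ Set.Icc (0 : ℝ) 1 := ⟨le_rfl, zero_le_one⟩
    have hC0 : 0 ≤ C := (abs_nonneg _).trans (hC 0 0 h00).1
    have hC'0 : 0 ≤ C' := (norm_nonneg _).trans (hC' 0 h00)
    have hC''0 : 0 ≤ C'' := (norm_nonneg _).trans (hC'' 0 h00)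
    set m : ℕ → ℝ := fun n => ∫ x in (0 : ℝ)..1, φ n x with hm
    have hconv : ∀ x ∈ Set.Icc (0 : ℝ) 1, Tendsto (fun n => ∫ t in (0 : ℝ)..x, φ n t) atTop
        (𝓝 (∫ t in (0 : ℝ)..x, (legendre l a).eval t)) := fun x hx =>
      tendsto_integral_of_bounded (fun n => (hφ.isUnitTest n).contDiff.continuous)
        (fun n x hx => (hC n x hx).1) hφ.tendsto hx
    have hprim : ∀ x, ∫ t in (0 : ℝ)..x, (legendre l a).eval t = (legendre l (a + 1)).eval x := by
      intro x
      rw [← derivative_legendre h, integral_eval_derivative,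
        eval_legendre_endpoint h (by omega) (Or.inl rfl), sub_zero]
    have hm0 : Tendsto m atTop (𝓝 0) := by
      have := hconv 1 ⟨zero_le_one, le_rfl⟩
      rwa [hprim, eval_legendre_endpoint h (by omega) (Or.inr rfl)] at this
    have hint : ∀ (f : ℝ → ℝ) (B : ℝ), (∀ x ∈ Set.Icc (0 : ℝ) 1, |f x| ≤ B) → 0 ≤ B →
        ∀ x ∈ Set.Icc (0 : ℝ) 1, |∫ t in (0 : ℝ)..x, f t| ≤ B := by
      intro f B hf hB x hx
      have := intervalIntegral.norm_integral_le_of_norm_le_const (a := 0) (b := x) (f := f)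
        (C := B) (fun t ht => by
          rw [Set.uIoc_of_le hx.1] at ht
          exact hf t ⟨ht.1.le, ht.2.trans hx.2⟩)
      rw [sub_zero, abs_of_nonneg hx.1] at this
      exact this.trans (mul_le_of_le_one_right hB hx.2)
    have hmC : ∀ n, |m n| ≤ C := fun n =>
      hint (φ n) C (fun x hx => (hC n x hx).1) hC0 1 ⟨zero_le_one, le_rfl⟩
    -- subtracting a multiple of `η` makes the mean value zero
    set g : ℕ → ℝ → ℝ := fun n x => φ n x - m n * η x with hg
    have hgt : ∀ n, IsUnitTest (g n) := by
      intro n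
      refine ⟨(hφ.isUnitTest n).contDiff.sub (contDiff_const.mul hη.contDiff), ?_⟩
      obtain ⟨a, b, ha, hb, hab⟩ := (hφ.isUnitTest n).support
      obtain ⟨a', b', ha', hb', hab'⟩ := hη.support
      refine ⟨min a a', max b b', lt_min ha ha', max_lt hb hb', fun x hx => ?_⟩
      have h1 : x ∉ Set.Icc a b := fun h =>
        hx ⟨(min_le_left _ _).trans h.1, h.2.trans (le_max_left _ _)⟩
      have h2 : x ∉ Set.Icc a' b' := fun h =>
        hx ⟨(min_le_right _ _).trans h.1, h.2.trans (le_max_right _ _)⟩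
      simp only [hg]
      rw [hab x h1, hab' x h2, mul_zero, sub_zero]
    have hgi : ∀ n x, ∫ t in (0 : ℝ)..x, g n t =
        (∫ t in (0 : ℝ)..x, φ n t) - m n * ∫ t in (0 : ℝ)..x, η t := by
      intro n x
      simp only [hg]
      rw [intervalIntegral.integral_sub ((hφ.isUnitTest n).intervalIntegrable _ _)
        ((hη.intervalIntegrable _ _).const_mul _), intervalIntegral.integral_const_mul]
    have hg0 : ∀ n, ∫ t in (0 : ℝ)..1, g n t = 0 := by
      intro n; rw [hgi, hη1, mul_one, hm]; simp
    have hiter : ∀ n x, iteratedDeriv (a + 1) (fun x => ∫ t in (0 : ℝ)..x, g n t) x =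
        iteratedDeriv a (φ n) x - m n * iteratedDeriv a η x := by
      intro n x
      have hs1 : ContDiffAt ℝ a (φ n) x := ((hφ.isUnitTest n).contDiff.of_le
        (by exact_mod_cast le_top)).contDiffAt
      have hs2 : ContDiffAt ℝ a η x := (hη.contDiff.of_le (by exact_mod_cast le_top)).contDiffAt
      rw [iteratedDeriv_succ', ((hgt n).primitive (hg0 n)).2]
      have : g n = φ n - fun x => m n * η x := rfl
      rw [this, iteratedDeriv_sub hs1 (contDiffAt_const.mul hs2), iteratedDeriv_const_mul _ hs2]
    refine ⟨fun n x => ∫ t in (0 : ℝ)..x, g n t, ⟨fun n => ((hgt n).primitive (hg0 n)).1,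
      ⟨(C + C * C') + (C + C * C''), fun n x hx => ⟨?_, ?_⟩⟩, fun x hx => ?_, fun x hx => ?_⟩⟩
    · refine (hint (g n) (C + C * C') (fun t ht => ?_) (by positivity) x hx).trans ?_
      · simp only [hg]
        refine (abs_sub _ _).trans (add_le_add (hC n t ht).1 ?_)
        rw [abs_mul]
        exact mul_le_mul (hmC n) (hC' t ht) (abs_nonneg _) hC0
      · have : 0 ≤ C + C * C'' := by positivity
        linarith
    · rw [hiter]
      have h1 : |iteratedDeriv a (φ n) x - m n * iteratedDeriv a η x| ≤ C + C * C'' := by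
        refine (abs_sub _ _).trans (add_le_add (hC n x hx).2 ?_)
        rw [abs_mul]
        exact mul_le_mul (hmC n) (hC'' x hx) (abs_nonneg _) hC0
      have : 0 ≤ C + C * C' := by positivity
      linarith
    · simp only [hgi]
      have := (hconv x ⟨hx.1.le, hx.2.le⟩).sub (hm0.mul_const (∫ t in (0 : ℝ)..x, η t))
      rwa [zero_mul, sub_zero, hprim] at this
    · simp only [hiter]
      have := (hφ.tendsto_deriv x hx).sub (hm0.mul_const (iteratedDeriv a η x))
      rwa [zero_mul, sub_zero] at this

end LegendreApproximants

/-! ### Tensor products and exponentials -/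

section TensorProducts

open Filter Topology
open scoped ContDiff

variable {d : ℕ}

/-- The tensor product of functions of one variable. -/
noncomputable def tensor (g : Fin d → ℝ → ℂ) : (Fin d → ℝ) → ℂ := fun x => ∏ i, g i (x i)

theorem contDiff_tensor {g : Fin d → ℝ → ℂ} (hg : ∀ i, ContDiff ℝ ∞ (g i)) :
    ContDiff ℝ ∞ (tensor g) :=
  contDiff_prod fun i _ => (hg i).comp (contDiff_apply ℝ ℝ i)

theorem partialDeriv_apply {φ : (Fin d → ℝ) → ℂ} {x : Fin d → ℝ} {i : Fin d}
    (h : DifferentiableAt ℝ φ x) :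
    HasDerivAt (fun t => φ (Function.update x i t)) (partialDeriv i φ x) (x i) := by
  have h1 : HasFDerivAt φ (fderiv ℝ φ x) (Function.update x i (x i)) := by
    rw [Function.update_eq_self]; exact h.hasFDerivAt
  exact h1.comp_hasDerivAt (x i) (hasDerivAt_update x i (x i))

theorem tensor_update (g : Fin d → ℝ → ℂ) (x : Fin d → ℝ) (i : Fin d) (t : ℝ) :
    tensor g (Function.update x i t) = g i t * ∏ j ∈ Finset.univ.erase i, g j (x j) := by
  unfold tensor
  rw [← Finset.mul_prod_erase _ _ (Finset.mem_univ i), Function.update_self]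
  congr 1
  refine Finset.prod_congr rfl fun j hj => ?_
  rw [Function.update_of_ne (Finset.ne_of_mem_erase hj)]

theorem partialDeriv_tensor {g : Fin d → ℝ → ℂ} (hg : ∀ i, ContDiff ℝ ∞ (g i)) (i : Fin d) :
    partialDeriv i (tensor g) = tensor (Function.update g i (deriv (g i))) := by
  funext x
  have h1 := partialDeriv_apply (i := i)
    ((contDiff_tensor hg).differentiable (by simp) x)
  have h2 : HasDerivAt (fun t => tensor g (Function.update x i t))
      (deriv (g i) (x i) * ∏ j ∈ Finset.univ.erase i, g j (x j)) (x i) := by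
    simp only [tensor_update]
    exact (((hg i).differentiable (by simp)) (x i)).hasDerivAt.mul_const _
  rw [h1.unique h2]
  have h3 := tensor_update (Function.update g i (deriv (g i))) x i (x i)
  rw [Function.update_eq_self, Function.update_self] at h3
  rw [h3]
  congr 1
  refine Finset.prod_congr rfl fun j hj => ?_
  rw [Function.update_of_ne (Finset.ne_of_mem_erase hj)]

theorem contDiff_iteratedDeriv {g : ℝ → ℂ} (hg : ContDiff ℝ ∞ g) (k : ℕ) :
    ContDiff ℝ ∞ (iteratedDeriv k g) := by
  induction k with
  | zero => simpa using hg
  | succ k ih =>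
    rw [iteratedDeriv_succ]
    exact (contDiff_infty_iff_deriv.1 ih).2

theorem iterate_partialDeriv_tensor {g : Fin d → ℝ → ℂ} (hg : ∀ i, ContDiff ℝ ∞ (g i))
    (i : Fin d) (k : ℕ) :
    (partialDeriv i)^[k] (tensor g) = tensor (Function.update g i (iteratedDeriv k (g i))) := by
  induction k with
  | zero => simp
  | succ k ih =>
    rw [Function.iterate_succ_apply', ih, partialDeriv_tensor, Function.update_idem,
      Function.update_self, iteratedDeriv_succ]
    intro j
    rcases eq_or_ne j i with rfl | h
    · rw [Function.update_self]; exact contDiff_iteratedDeriv (hg j) k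
    · rw [Function.update_of_ne h]; exact hg j

theorem multiDeriv_tensor {g : Fin d → ℝ → ℂ} (hg : ∀ i, ContDiff ℝ ∞ (g i)) (α : Fin d → ℕ) :
    multiDeriv α (tensor g) = tensor fun i => iteratedDeriv (α i) (g i) := by
  have key : ∀ l : List (Fin d), l.Nodup →
      l.foldr (fun i g => (partialDeriv i)^[α i] g) (tensor g) =
        tensor fun i => if i ∈ l then iteratedDeriv (α i) (g i) else g i := by
    intro l
    induction l with
    | nil => intro _; simp
    | cons j l ih =>
      intro hl
      rw [List.nodup_cons] at hl
      rw [List.foldr_cons, ih hl.2, iterate_partialDeriv_tensor]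
      · congr 1
        funext i
        rcases eq_or_ne i j with rfl | h
        · simp [hl.1]
        · simp [h]
      · intro i
        split_ifs
        · exact contDiff_iteratedDeriv (hg i) _
        · exact hg i
  unfold multiDeriv
  rw [key _ (List.nodup_finRange d)]
  simp

theorem iteratedDeriv_ofReal {φ : ℝ → ℝ} (h : ContDiff ℝ ∞ φ) (k : ℕ) :
    iteratedDeriv k (fun x => (φ x : ℂ)) = fun x => ((iteratedDeriv k φ x : ℝ) : ℂ) := by
  induction k with
  | zero => simp
  | succ k ih =>
    rw [iteratedDeriv_succ, ih]
    funext x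
    have h1 : DifferentiableAt ℝ (iteratedDeriv k φ) x :=
      h.differentiable_iteratedDeriv k (by exact_mod_cast WithTop.coe_lt_top _) x
    rw [iteratedDeriv_succ]
    exact h1.hasDerivAt.ofReal_comp.deriv

/-- The periodic extension of a test function is smooth. -/
theorem IsUnitTest.exists_periodic {φ : ℝ → ℝ} (hφ : IsUnitTest φ) :
    ∃ h : ℝ → ℝ, ContDiff ℝ ∞ h ∧ (∀ x, h (x + 1) = h x) ∧
      ∀ x ∈ Set.Ico (0 : ℝ) 1, h =ᶠ[𝓝 x] φ := by
  obtain ⟨a, b, ha, hb, hab⟩ := hφ.support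
  have hper : ∀ x, φ (Int.fract (x + 1)) = φ (Int.fract x) := fun x => by rw [Int.fract_add_one]
  have hloc : ∀ x ∈ Set.Ico (0 : ℝ) 1, (fun y => φ (Int.fract y)) =ᶠ[𝓝 x] φ := by
    intro x hx
    rcases hx.1.eq_or_lt with rfl | h0
    · have hmem : Set.Ioo (b - 1) a ∈ 𝓝 (0 : ℝ) := Ioo_mem_nhds (by linarith) ha
      have hmem' : Set.Ioo (-1 : ℝ) 1 ∈ 𝓝 (0 : ℝ) := Ioo_mem_nhds (by norm_num) (by norm_num)
      filter_upwards [hmem, hmem'] with y hy hy'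
      rcases le_or_gt 0 y with h | h
      · rw [Int.fract_eq_self.2 ⟨h, hy'.2⟩]
      · have : Int.fract y = y + 1 := by
          rw [← Int.fract_add_one]
          exact Int.fract_eq_self.2 ⟨by linarith [hy'.1], by linarith⟩
        rw [this, hab _ (fun h' => by linarith [h'.2, hy.1]),
          hab _ (fun h' => by linarith [h'.1])]
    · filter_upwards [Ioo_mem_nhds h0 hx.2] with y hy
      rw [Int.fract_eq_self.2 ⟨hy.1.le, hy.2⟩]
  refine ⟨fun x => φ (Int.fract x), ?_, hper, hloc⟩
  rw [contDiff_iff_contDiffAt]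
  intro x
  have hx : Int.fract x ∈ Set.Ico (0 : ℝ) 1 := ⟨Int.fract_nonneg x, Int.fract_lt_one x⟩
  have hshift : ContDiffAt ℝ ∞ (fun y : ℝ => y - ⌊x⌋) x := contDiffAt_id.sub contDiffAt_const
  have h1 : ContDiffAt ℝ ∞ (fun y => φ (y - ⌊x⌋)) x :=
    hφ.contDiff.contDiffAt.comp x hshift
  refine h1.congr_of_eventuallyEq ?_
  have hc : Tendsto (fun y : ℝ => y - ⌊x⌋) (𝓝 x) (𝓝 (Int.fract x)) := hshift.continuousAt
  filter_upwards [hc.eventually (hloc _ hx)] with y hy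
  rw [← hy, Int.fract_sub_intCast]

/-- The exponential `exp (2 π i k · x)`. -/
noncomputable def expo (k : Fin d → ℕ) : (Fin d → ℝ) → ℂ :=
  tensor fun i t => Complex.exp (2 * Real.pi * Complex.I * k i * t)

/-- The factor by which the derivative of order `α` multiplies `expo k`. -/
noncomputable def expoSymbol (k α : Fin d → ℕ) : ℂ := ∏ i, (2 * Real.pi * Complex.I * k i) ^ α i

theorem contDiff_cexp_mul (c : ℂ) : ContDiff ℝ ∞ (fun t : ℝ => Complex.exp (c * t)) :=
  (contDiff_const.mul Complex.ofRealCLM.contDiff).cexp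

theorem contDiff_expo (k : Fin d → ℕ) : ContDiff ℝ ∞ (expo k) :=
  contDiff_tensor fun _ => contDiff_cexp_mul _

theorem partialDeriv_expo (k : Fin d → ℕ) (i : Fin d) :
    partialDeriv i (expo k) = fun x => (2 * Real.pi * Complex.I * k i) * expo k x := by
  unfold expo
  rw [partialDeriv_tensor fun _ => contDiff_cexp_mul _]
  funext x
  have hd : deriv (fun t : ℝ => Complex.exp (2 * Real.pi * Complex.I * k i * t)) =
      fun t : ℝ => (2 * Real.pi * Complex.I * k i) *
        Complex.exp (2 * Real.pi * Complex.I * k i * t) := by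
    funext t
    have h1 : HasDerivAt (fun t : ℝ => 2 * Real.pi * Complex.I * k i * (t : ℂ))
        (2 * Real.pi * Complex.I * k i) t := by
      simpa using (hasDerivAt_id t).ofReal_comp.const_mul (2 * Real.pi * Complex.I * k i)
    rw [h1.cexp.deriv, mul_comm]
  rw [hd]
  have h3 := tensor_update (Function.update (fun (i : Fin d) (t : ℝ) =>
    Complex.exp (2 * Real.pi * Complex.I * k i * t)) i (fun t : ℝ => (2 * Real.pi * Complex.I * k i) *
        Complex.exp (2 * Real.pi * Complex.I * k i * t))) x i (x i)
  rw [Function.update_eq_self, Function.update_self] at h3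
  have h4 := tensor_update (fun (i : Fin d) (t : ℝ) =>
    Complex.exp (2 * Real.pi * Complex.I * k i * t)) x i (x i)
  rw [Function.update_eq_self] at h4
  rw [h3, h4, mul_assoc]
  congr 2
  refine Finset.prod_congr rfl fun j hj => ?_
  rw [Function.update_of_ne (Finset.ne_of_mem_erase hj)]

theorem expo_add_single (k : Fin d → ℕ) (x : Fin d → ℝ) (i : Fin d) :
    expo k (x + Pi.single i 1) = expo k x := by
  unfold expo tensor
  refine Finset.prod_congr rfl fun j _ => ?_
  rcases eq_or_ne j i with rfl | h
  · have : 2 * Real.pi * Complex.I * k j * ((x + Pi.single j 1 : Fin d → ℝ) j : ℂ) =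
        2 * Real.pi * Complex.I * k j * (x j : ℂ) + (k j : ℕ) * (2 * Real.pi * Complex.I) := by
      simp only [Pi.add_apply, Pi.single_eq_same]
      push_cast
      ring
    simp only [this]
    rw [Complex.exp_periodic.nat_mul (k j)]
  · simp [Pi.single_eq_of_ne h]

end TensorProducts

/-! ### The torus and the cube -/

section UnitCubeDomains

open Filter Topology
open scoped ContDiff

variable {d : ℕ} {D : Type*} [MeasurableSpace D]

/-- Lebesgue measure on the unit cube. -/
noncomputable def unitCubeMeasure (d : ℕ) : Measure (Fin d → ℝ) :=
  Measure.pi fun _ => volume.restrict (Set.Icc 0 1)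

theorem unitCubeMeasure_eq (d : ℕ) :
    unitCubeMeasure d = volume.restrict (Set.Icc (0 : Fin d → ℝ) 1) := by
  unfold unitCubeMeasure
  rw [← Measure.restrict_pi_pi, Set.pi_univ_Icc]
  rfl

instance : IsProbabilityMeasure (volume.restrict (Set.Icc (0 : ℝ) 1)) := ⟨by simp⟩

instance (d : ℕ) : IsProbabilityMeasure (unitCubeMeasure d) := by
  unfold unitCubeMeasure; infer_instance

/-- The properties common to the torus and the cube: up to null sets, both are the unit cube with
Lebesgue measure, the test functions comprise tensor products of test functions on `(0,1)`, and
integration by parts against the exponentials produces no boundary terms. -/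
structure IsUnitCubeDomain (E : SobolevDomain d D) (μ : Measure D) : Prop where
  emb : MeasurableEmbedding E.coord
  map : μ.map E.coord = unitCubeMeasure d
  exists_tensor : ∀ φ : Fin d → ℝ → ℝ, (∀ i, IsUnitTest (φ i)) → ∃ Φ ∈ E.test,
    ∀ (α : Fin d → ℕ) (x : D), multiDeriv α Φ (E.coord x) =
      ((∏ i, iteratedDeriv (α i) (φ i) (E.coord x i) : ℝ) : ℂ)
  partialDeriv_mem : ∀ φ ∈ E.test, ∀ i, partialDeriv i φ ∈ E.test
  face : ∀ φ ∈ E.test, ∀ (x : Fin d → ℝ) (i : Fin d), x i = 0 →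
    φ (x + Pi.single i 1) = φ x

theorem IsUnitCubeDomain.integral_comp {E : SobolevDomain d D} {μ : Measure D}
    (h : IsUnitCubeDomain E μ) (f : (Fin d → ℝ) → ℂ) :
    ∫ x, f (E.coord x) ∂μ = ∫ y, f y ∂(unitCubeMeasure d) := by
  rw [← h.map, h.emb.integral_map]

theorem IsUnitCubeDomain.measurePreserving {E : SobolevDomain d D} {μ : Measure D}
    (h : IsUnitCubeDomain E μ) : MeasurePreserving E.coord μ (unitCubeMeasure d) :=
  ⟨h.emb.measurable, h.map⟩

/-- A smooth function that agrees on opposite faces of the cube has partial derivatives of mean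
value zero. -/
theorem integral_partialDeriv_eq_zero {G : (Fin d → ℝ) → ℂ} (hG : ContDiff ℝ ∞ G) (i : Fin d)
    (hface : ∀ x : Fin d → ℝ, x i = 0 → G (x + Pi.single i 1) = G x) :
    ∫ x, partialDeriv i G x ∂(unitCubeMeasure d) = 0 := by
  rw [unitCubeMeasure_eq]
  obtain _ | n := d
  · exact i.elim0
  have key := integral_divergence_of_hasFDerivAt_off_countable' (E := ℂ) (0 : Fin (n + 1) → ℝ) 1
    zero_le_one (fun j => if j = i then G else 0) (fun j => if j = i then fderiv ℝ G else 0) ∅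
    Set.countable_empty (fun j => ?_) (fun x _ j => ?_) ?_
  · have h1 : ∀ x, ∑ j, (if j = i then fderiv ℝ G else 0) x (Pi.single j 1) =
        partialDeriv i G x := by
      intro x
      rw [Finset.sum_eq_single i (fun j _ hj => by simp [hj]) (by simp)]
      simp [partialDeriv]
    simp only [h1] at key
    rw [key]
    refine Finset.sum_eq_zero fun j _ => ?_
    rw [sub_eq_zero]
    congr 1
    funext y
    split_ifs with hj
    · subst hj
      rw [← hface (j.insertNth ((0 : Fin (n + 1) → ℝ) j) y) (by simp)]
      congr 1
      funext l
      rcases eq_or_ne l j with rfl | hl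
      · simp
      · obtain ⟨m, rfl⟩ := Fin.exists_succAbove_eq hl
        simp
    · rfl
  · split_ifs
    · exact hG.continuous.continuousOn
    · exact continuousOn_const
  · split_ifs
    · exact (hG.differentiable (by simp) x).hasFDerivAt
    · exact hasFDerivAt_const _ _
  · refine ContinuousOn.integrableOn_compact isCompact_Icc (Continuous.continuousOn ?_)
    refine continuous_finsetSum _ fun j _ => ?_
    split_ifs
    · exact (hG.continuous_fderiv (by simp)).clm_apply continuous_const
    · exact continuous_const

theorem partialDeriv_mul {f g : (Fin d → ℝ) → ℂ} (hf : ContDiff ℝ ∞ f) (hg : ContDiff ℝ ∞ g)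
    (i : Fin d) : partialDeriv i (fun x => f x * g x) =
      fun x => f x * partialDeriv i g x + partialDeriv i f x * g x := by
  funext x
  unfold partialDeriv
  rw [fderiv_fun_mul (hf.differentiable (by simp) x) (hg.differentiable (by simp) x)]
  simp [mul_comm]

theorem integrable_unitCubeMeasure {f : (Fin d → ℝ) → ℂ} (hf : Continuous f) :
    Integrable f (unitCubeMeasure d) := by
  rw [unitCubeMeasure_eq]
  exact hf.continuousOn.integrableOn_compact isCompact_Icc

theorem IsUnitCubeDomain.integral_expo_mul_partialDeriv {E : SobolevDomain d D} {μ : Measure D}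
    (h : IsUnitCubeDomain E μ) (k : Fin d → ℕ) (i : Fin d) {φ : (Fin d → ℝ) → ℂ}
    (hφ : φ ∈ E.test) :
    ∫ x, expo k x * partialDeriv i φ x ∂(unitCubeMeasure d) =
      -(2 * Real.pi * Complex.I * k i) * ∫ x, expo k x * φ x ∂(unitCubeMeasure d) := by
  have hs := E.smooth φ hφ
  have h1 := integral_partialDeriv_eq_zero ((contDiff_expo k).mul hs) i (fun x hx => by
    rw [expo_add_single, h.face φ hφ x i hx])
  rw [partialDeriv_mul (contDiff_expo k) hs, partialDeriv_expo] at h1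
  rw [integral_add (f := fun x => expo k x * partialDeriv i φ x)
    (g := fun x => 2 * Real.pi * Complex.I * k i * expo k x * φ x)
    (integrable_unitCubeMeasure ((contDiff_expo k).continuous.mul
      (contDiff_partialDeriv i hs).continuous)) (integrable_unitCubeMeasure
      ((continuous_const.mul (contDiff_expo k).continuous).mul hs.continuous))] at h1
  have h2 : ∫ x, 2 * Real.pi * Complex.I * k i * expo k x * φ x ∂(unitCubeMeasure d) =
      2 * Real.pi * Complex.I * k i * ∫ x, expo k x * φ x ∂(unitCubeMeasure d) := by
    rw [← integral_const_mul]; simp only [mul_assoc]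
  rw [h2] at h1
  linear_combination h1

theorem IsUnitCubeDomain.integral_expo_mul_multiDeriv {E : SobolevDomain d D} {μ : Measure D}
    (h : IsUnitCubeDomain E μ) (k α : Fin d → ℕ) {φ : (Fin d → ℝ) → ℂ} (hφ : φ ∈ E.test) :
    ∫ x, expo k x * multiDeriv α φ x ∂(unitCubeMeasure d) =
      (-1) ^ (∑ i, α i) * (expoSymbol k α * ∫ x, expo k x * φ x ∂(unitCubeMeasure d)) := by
  have hiter : ∀ (i : Fin d) (m : ℕ) (g), g ∈ E.test → (partialDeriv i)^[m] g ∈ E.test ∧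
      ∫ x, expo k x * (partialDeriv i)^[m] g x ∂(unitCubeMeasure d) =
        (-(2 * Real.pi * Complex.I * k i)) ^ m * ∫ x, expo k x * g x ∂(unitCubeMeasure d) := by
    intro i m g hg
    induction m with
    | zero => simpa using hg
    | succ m ih =>
      rw [Function.iterate_succ_apply']
      refine ⟨h.partialDeriv_mem _ ih.1 i, ?_⟩
      rw [h.integral_expo_mul_partialDeriv k i ih.1, ih.2, pow_succ]
      ring
  have key : ∀ l : List (Fin d), l.foldr (fun i g => (partialDeriv i)^[α i] g) φ ∈ E.test ∧
      ∫ x, expo k x * l.foldr (fun i g => (partialDeriv i)^[α i] g) φ x ∂(unitCubeMeasure d) =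
        (l.map fun i => (-(2 * Real.pi * Complex.I * k i)) ^ α i).prod *
          ∫ x, expo k x * φ x ∂(unitCubeMeasure d) := by
    intro l
    induction l with
    | nil => simpa using hφ
    | cons i l ih =>
      simp only [List.foldr_cons, List.map_cons, List.prod_cons]
      refine ⟨(hiter i _ _ ih.1).1, ?_⟩
      rw [(hiter i _ _ ih.1).2, ih.2, ← mul_assoc]
  unfold multiDeriv
  rw [(key _).2, ← mul_assoc]
  congr 1
  rw [← List.ofFn_eq_map, List.prod_ofFn, expoSymbol, ← Finset.prod_pow_eq_pow_sum,
    ← Finset.prod_mul_distrib]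
  refine Finset.prod_congr rfl fun i _ => ?_
  rw [← mul_pow]
  ring

theorem isUnitCubeDomain_cube (d : ℕ) : IsUnitCubeDomain (cubeDomain d) (cubeMeasure d) where
  emb := MeasurableEmbedding.subtype_coe measurableSet_Icc
  map := by
    rw [unitCubeMeasure_eq]
    exact map_comap_subtype_coe measurableSet_Icc volume
  exists_tensor φ hφ := by
    have hsm : ∀ i, ContDiff ℝ ∞ (fun t => (φ i t : ℂ)) := fun i =>
      Complex.ofRealCLM.contDiff.comp (hφ i).contDiff
    choose a b ha hb hab using fun i => (hφ i).support
    have hsupp : Function.support (tensor fun i t => (φ i t : ℂ)) ⊆ Set.Icc a b := by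
      intro x hx
      by_contra hx'
      refine hx ?_
      have : ∃ i, x i ∉ Set.Icc (a i) (b i) := by
        by_contra! hall
        exact hx' ⟨fun i => (hall i).1, fun i => (hall i).2⟩
      obtain ⟨i, hi⟩ := this
      exact Finset.prod_eq_zero (Finset.mem_univ i) (by simp only [hab i _ hi, Complex.ofReal_zero])
    have hts : tsupport (tensor fun i t => (φ i t : ℂ)) ⊆ Set.Icc a b :=
      closure_minimal hsupp isClosed_Icc
    refine ⟨tensor fun i t => (φ i t : ℂ), ⟨contDiff_tensor hsm, ?_, ?_⟩, fun α x => ?_⟩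
    · exact isCompact_Icc.of_isClosed_subset (isClosed_tsupport _) hts
    · intro x hx i
      have := hts hx
      exact ⟨(ha i).trans_le (this.1 i), (this.2 i).trans_lt (hb i)⟩
    · rw [multiDeriv_tensor hsm]
      simp only [tensor, iteratedDeriv_ofReal (hφ _).contDiff, Complex.ofReal_prod]
  partialDeriv_mem φ hφ i := by
    obtain ⟨h1, h2, h3⟩ := hφ
    have hsub : tsupport (partialDeriv i φ) ⊆ tsupport φ := by
      refine closure_minimal (fun x hx => ?_) (isClosed_tsupport _)
      by_contra hx'
      refine hx ?_
      have : fderiv ℝ φ x = 0 := by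
        by_contra h0
        exact hx' (tsupport_fderiv_subset ℝ (subset_tsupport _ h0))
      simp [partialDeriv, this]
    exact ⟨contDiff_partialDeriv i h1,
      h2.of_isClosed_subset (isClosed_tsupport _) hsub, hsub.trans h3⟩
  face φ hφ x i hx := by
    obtain ⟨-, -, h3⟩ := hφ
    have hz : ∀ y : Fin d → ℝ, ¬ (0 < y i ∧ y i < 1) → φ y = 0 := fun y hy => by
      by_contra h0
      exact hy (h3 (subset_tsupport _ h0) i)
    rw [hz _ (by simp [hx]), hz _ (by simp [hx])]

theorem map_equivIco_volume :
    Measure.map (fun x : UnitAddCircle => (AddCircle.equivIco 1 0 x : ℝ)) volume =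
      volume.restrict (Set.Icc 0 1) := by
  have hm : Measurable fun x : UnitAddCircle => (AddCircle.equivIco 1 0 x : ℝ) :=
    measurable_subtype_coe.comp (AddCircle.measurableEquivIco 1 0).measurable
  have hmk := AddCircle.measurePreserving_mk 1 0
  rw [← hmk.map_eq, Measure.map_map hm hmk.measurable,
    Measure.restrict_congr_set Ioc_ae_eq_Icc]
  have e : Set.Icc (0 : ℝ) (0 + 1) = Set.Icc 0 1 := by rw [zero_add]
  rw [e]
  conv_rhs => rw [← Measure.map_id (μ := volume.restrict (Set.Icc (0 : ℝ) 1))]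
  refine Measure.map_congr ?_
  rw [Filter.EventuallyEq, ← Measure.restrict_congr_set Ico_ae_eq_Icc]
  filter_upwards [ae_restrict_mem measurableSet_Ico] with x hx
  have : AddCircle.equivIco 1 0 (x : UnitAddCircle) = ⟨x, by simpa using hx⟩ :=
    AddCircle.equivIco_coe_eq (by simpa using hx)
  simp [this]

theorem torus_coord_mem (x : Fin d → UnitAddCircle) (i : Fin d) :
    (torusDomain d).coord x i ∈ Set.Ico (0 : ℝ) 1 := by
  have := (AddCircle.equivIco (1 : ℝ) 0 (x i)).2
  simpa [torusDomain] using this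

theorem isUnitCubeDomain_torus (d : ℕ) :
    IsUnitCubeDomain (torusDomain d) (volume : Measure (Fin d → UnitAddCircle)) where
  emb := by
    refine MeasurableEmbedding.of_measurable_inverse (g := fun y i => (y i : UnitAddCircle))
      (torusDomain d).measurable_coord ?_ ?_ ?_
    · have : Set.range (torusDomain d).coord = Set.pi Set.univ fun _ => Set.Ico (0 : ℝ) 1 := by
        ext y
        constructor
        · rintro ⟨x, rfl⟩ i _
          exact torus_coord_mem x i
        · intro hy
          refine ⟨fun i => (y i : UnitAddCircle), funext fun i => ?_⟩
          have hyi : y i ∈ Set.Ico (0 : ℝ) (0 + 1) := by simpa using hy i trivial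
          have : AddCircle.equivIco 1 0 (y i : UnitAddCircle) = ⟨y i, hyi⟩ :=
            AddCircle.equivIco_coe_eq hyi
          simp [torusDomain, this]
      rw [this]
      exact MeasurableSet.univ_pi fun _ => measurableSet_Ico
    · exact measurable_pi_lambda _ fun i => AddCircle.measurable_mk'.comp (measurable_pi_apply i)
    · intro x
      funext i
      exact (AddCircle.equivIco (1 : ℝ) 0).symm_apply_apply (x i)
  map := by
    have h1 : ∀ i : Fin d, MeasurePreserving
        (fun x : UnitAddCircle => (AddCircle.equivIco 1 0 x : ℝ)) volume
        (volume.restrict (Set.Icc 0 1)) := fun i =>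
      ⟨measurable_subtype_coe.comp (AddCircle.measurableEquivIco 1 0).measurable,
        map_equivIco_volume⟩
    exact (measurePreserving_pi _ _ h1).map_eq
  exists_tensor φ hφ := by
    choose h hh hper hloc using fun i => (hφ i).exists_periodic
    have hsm : ∀ i, ContDiff ℝ ∞ (fun t => (h i t : ℂ)) := fun i =>
      Complex.ofRealCLM.contDiff.comp (hh i)
    refine ⟨tensor fun i t => (h i t : ℂ), ⟨contDiff_tensor hsm, fun x i => ?_⟩, fun α x => ?_⟩
    · unfold tensor
      refine Finset.prod_congr rfl fun j _ => ?_
      rcases eq_or_ne j i with rfl | hj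
      · simp [hper]
      · simp [Pi.single_eq_of_ne hj]
    · rw [multiDeriv_tensor hsm]
      simp only [tensor, iteratedDeriv_ofReal (hh _), Complex.ofReal_prod]
      refine Finset.prod_congr rfl fun i _ => ?_
      rw [(hloc i _ (torus_coord_mem x i)).iteratedDeriv_eq]
  partialDeriv_mem φ hφ i := by
    refine ⟨contDiff_partialDeriv i hφ.1, fun x j => ?_⟩
    have : (fun y => φ (y + Pi.single j 1)) = φ := funext fun y => hφ.2 y j
    unfold partialDeriv
    rw [← fderiv_comp_add_right, this]
  face φ hφ x i _ := hφ.2 x i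

end UnitCubeDomains

/-! ### Weak derivatives and Jacobi coefficients -/

section JacobiExpansion

open Polynomial Filter Topology
open scoped ContDiff ComplexConjugate

variable {d : ℕ} {D : Type*} [MeasurableSpace D] {E : SobolevDomain d D} {μ : Measure D}

theorem ae_mem_Ioo_unitCubeMeasure (d : ℕ) :
    ∀ᵐ y ∂(unitCubeMeasure d), ∀ i, y i ∈ Set.Ioo (0 : ℝ) 1 := by
  have h : (Set.pi Set.univ fun i => Set.Ioo ((0 : Fin d → ℝ) i) ((1 : Fin d → ℝ) i)) =ᵐ[volume]
      Set.Icc (0 : Fin d → ℝ) 1 := Measure.univ_pi_Ioo_ae_eq_Icc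
  rw [unitCubeMeasure_eq, ← Measure.restrict_congr_set h]
  filter_upwards [ae_restrict_mem (MeasurableSet.univ_pi fun _ => measurableSet_Ioo)] with y hy i
  exact hy i trivial

/-- A weak derivative may be tested with limits of test functions. -/
theorem integral_mul_tensor_of_isWeakDeriv [IsFiniteMeasure μ] (h : IsUnitCubeDomain E μ)
    {α : Fin d → ℕ} {u v : Lp ℂ 2 μ} (huv : IsWeakDeriv E μ α u v)
    {φ : Fin d → ℕ → ℝ → ℝ} {f g : Fin d → ℝ → ℝ}
    (hφ : ∀ i, TestApprox (α i) (φ i) (f i) (g i)) :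
    ∫ x, u x * ((∏ i, g i (E.coord x i) : ℝ) : ℂ) ∂μ =
      (-1) ^ (∑ i, α i) * ∫ x, v x * ((∏ i, f i (E.coord x i) : ℝ) : ℂ) ∂μ := by
  have hex := fun n => h.exists_tensor (fun i => φ i n) (fun i => (hφ i).isUnitTest n)
  choose Φ hΦ hΦd using hex
  have hΦ0 : ∀ n x, Φ n (E.coord x) = ((∏ i, φ i n (E.coord x i) : ℝ) : ℂ) := by
    intro n x
    have h0 := hΦd n 0 x
    have h1 : multiDeriv 0 (Φ n) = Φ n := by
      unfold multiDeriv
      induction List.finRange d with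
      | nil => rfl
      | cons i l ih => simp
    rw [h1] at h0
    simpa using h0
  choose C hC using fun i => (hφ i).bound
  have hae : ∀ᵐ x ∂μ, ∀ i, E.coord x i ∈ Set.Ioo (0 : ℝ) 1 :=
    h.measurePreserving.quasiMeasurePreserving.ae (ae_mem_Ioo_unitCubeMeasure d)
  have hIcc : ∀ x i, E.coord x i ∈ Set.Icc (0 : ℝ) 1 := fun x i =>
    ⟨(E.coord_mem x).1 i, (E.coord_mem x).2 i⟩
  have hint : ∀ w : Lp ℂ 2 μ, Integrable (fun x => ‖w x‖ * ∏ i, C i) μ := fun w =>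
    ((Lp.memLp w).integrable (by norm_num)).norm.mul_const _
  have hmeas : ∀ (w : Lp ℂ 2 μ) {ψ : (Fin d → ℝ) → ℂ}, Continuous ψ →
      AEStronglyMeasurable (fun x => w x * ψ (E.coord x)) μ := fun w ψ hψ =>
    (integrable_mul_coord E μ hψ w).aestronglyMeasurable
  have hL : Tendsto (fun n => ∫ x, u x * multiDeriv α (Φ n) (E.coord x) ∂μ) atTop
      (𝓝 (∫ x, u x * ((∏ i, g i (E.coord x i) : ℝ) : ℂ) ∂μ)) := by
    refine tendsto_integral_of_dominated_convergence (fun x => ‖u x‖ * ∏ i, C i)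
      (fun n => hmeas u (contDiff_multiDeriv α (E.smooth _ (hΦ n))).continuous) (hint u)
      (fun n => Eventually.of_forall fun x => ?_) ?_
    · rw [norm_mul, hΦd, Complex.norm_real, Real.norm_eq_abs, Finset.abs_prod]
      refine mul_le_mul_of_nonneg_left ?_ (norm_nonneg _)
      exact Finset.prod_le_prod (fun i _ => abs_nonneg _) fun i _ => (hC i n _ (hIcc x i)).2
    · filter_upwards [hae] with x hx
      simp only [hΦd]
      refine Tendsto.const_mul _ ((Complex.continuous_ofReal.tendsto _).comp ?_)
      exact tendsto_finsetProd _ fun i _ => (hφ i).tendsto_deriv _ (hx i)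
  have hR : Tendsto (fun n => (-1 : ℂ) ^ (∑ i, α i) * ∫ x, v x * Φ n (E.coord x) ∂μ) atTop
      (𝓝 ((-1) ^ (∑ i, α i) * ∫ x, v x * ((∏ i, f i (E.coord x i) : ℝ) : ℂ) ∂μ)) := by
    refine Tendsto.const_mul _ ?_
    refine tendsto_integral_of_dominated_convergence (fun x => ‖v x‖ * ∏ i, C i)
      (fun n => hmeas v (E.smooth _ (hΦ n)).continuous) (hint v)
      (fun n => Eventually.of_forall fun x => ?_) ?_
    · rw [norm_mul, hΦ0, Complex.norm_real, Real.norm_eq_abs, Finset.abs_prod]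
      refine mul_le_mul_of_nonneg_left ?_ (norm_nonneg _)
      exact Finset.prod_le_prod (fun i _ => abs_nonneg _) fun i _ => (hC i n _ (hIcc x i)).1
    · filter_upwards [hae] with x hx
      simp only [hΦ0]
      refine Tendsto.const_mul _ ((Complex.continuous_ofReal.tendsto _).comp ?_)
      exact tendsto_finsetProd _ fun i _ => (hφ i).tendsto _ (hx i)
  refine tendsto_nhds_unique hL (hR.congr fun n => ?_)
  exact (huv _ (hΦ n)).symm

/-- The normalized Jacobi polynomial times the square root of its weight; for `a = 0` this is the
normalized Legendre polynomial. -/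
noncomputable def jacobiFun (l a : ℕ) (t : ℝ) : ℝ :=
  √(bumpPoly.eval t) ^ a * (jacobi l a).eval t / √(jacobiNorm l a)

theorem continuous_jacobiFun (l a : ℕ) : Continuous (jacobiFun l a) := by
  unfold jacobiFun
  exact ((bumpPoly.continuous.sqrt.pow a).mul (jacobi l a).continuous).div_const _

theorem integral_jacobiFun_mul {k l a : ℕ} (hk : a ≤ k) (hl : a ≤ l) :
    ∫ t in Set.Icc (0 : ℝ) 1, jacobiFun k a t * jacobiFun l a t = if k = l then 1 else 0 := by
  have h1 : ∀ t ∈ Set.Icc (0 : ℝ) 1, jacobiFun k a t * jacobiFun l a t =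
      (bumpPoly ^ a * jacobi k a * jacobi l a).eval t / (√(jacobiNorm k a) * √(jacobiNorm l a)) := by
    intro t ht
    have h2 : √(bumpPoly.eval t) ^ a * √(bumpPoly.eval t) ^ a = bumpPoly.eval t ^ a := by
      rw [← mul_pow, Real.mul_self_sqrt (eval_bumpPoly_nonneg ht)]
    unfold jacobiFun
    rw [eval_mul, eval_mul, eval_pow, ← h2, div_mul_div_comm]
    ring
  rw [setIntegral_congr_fun measurableSet_Icc h1, integral_div, integral_Icc_eq_integral_Ioc,
    ← intervalIntegral.integral_of_le zero_le_one, integral_jacobi_mul_jacobi hk hl]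
  split_ifs with hkl
  · subst hkl
    rw [Real.mul_self_sqrt (jacobiNorm_pos k a).le, div_self (jacobiNorm_pos k a).ne']
  · rw [zero_div]

/-- Tensor products of the functions `jacobiFun`. -/
noncomputable def jacobiTensor (l α : Fin d → ℕ) : C(Fin d → ℝ, ℂ) where
  toFun x := ((∏ i, jacobiFun (l i) (α i) (x i) : ℝ) : ℂ)
  continuous_toFun := Complex.continuous_ofReal.comp
    (continuous_finsetProd _ fun i _ => (continuous_jacobiFun _ _).comp (continuous_apply i))

/-- The class in `L²(μ)` of a continuous function of the coordinates. -/
noncomputable def coordLp (E : SobolevDomain d D) (μ : Measure D) [IsFiniteMeasure μ]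
    (f : C(Fin d → ℝ, ℂ)) : Lp ℂ 2 μ :=
  MemLp.toLp (fun x => f (E.coord x)) <| by
    obtain ⟨C, hC⟩ := (isCompact_Icc (a := (0 : Fin d → ℝ)) (b := 1)).exists_bound_of_continuousOn
      f.continuous.continuousOn
    exact MemLp.of_bound (f.continuous.measurable.comp E.measurable_coord).aestronglyMeasurable C
      (Eventually.of_forall fun x => hC _ (E.coord_mem x))

theorem coeFn_coordLp [IsFiniteMeasure μ] (f : C(Fin d → ℝ, ℂ)) :
    coordLp E μ f =ᵐ[μ] fun x => f (E.coord x) := MemLp.coeFn_toLp _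

theorem inner_coordLp [IsFiniteMeasure μ] (f : C(Fin d → ℝ, ℂ)) (u : Lp ℂ 2 μ) :
    inner ℂ (coordLp E μ f) u = ∫ x, u x * conj (f (E.coord x)) ∂μ := by
  rw [L2.inner_def]
  refine integral_congr_ae ?_
  filter_upwards [coeFn_coordLp (E := E) (μ := μ) f] with x hx
  rw [hx]; rfl

theorem inner_coordLp_coordLp [IsFiniteMeasure μ] (h : IsUnitCubeDomain E μ)
    (f g : C(Fin d → ℝ, ℂ)) :
    inner ℂ (coordLp E μ f) (coordLp E μ g) = ∫ y, g y * conj (f y) ∂(unitCubeMeasure d) := by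
  rw [inner_coordLp, ← h.integral_comp]
  refine integral_congr_ae ?_
  filter_upwards [coeFn_coordLp (E := E) (μ := μ) g] with x hx
  rw [hx]

theorem inner_jacobiTensor [IsFiniteMeasure μ] (h : IsUnitCubeDomain E μ) {k l α : Fin d → ℕ}
    (hk : α ≤ k) (hl : α ≤ l) :
    inner ℂ (coordLp E μ (jacobiTensor k α)) (coordLp E μ (jacobiTensor l α)) =
      if k = l then 1 else 0 := by
  rw [inner_coordLp_coordLp h]
  have h1 : ∀ y : Fin d → ℝ, jacobiTensor l α y * conj (jacobiTensor k α y) =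
      ((∏ i, jacobiFun (k i) (α i) (y i) * jacobiFun (l i) (α i) (y i) : ℝ) : ℂ) := by
    intro y
    simp only [jacobiTensor, ContinuousMap.coe_mk, Complex.conj_ofReal]
    rw [← Complex.ofReal_mul, ← Finset.prod_mul_distrib]
    congr 1
    exact Finset.prod_congr rfl fun i _ => mul_comm _ _
  simp only [h1]
  rw [integral_complex_ofReal, unitCubeMeasure, integral_fintype_prod_eq_prod
    (fun i t => jacobiFun (k i) (α i) t * jacobiFun (l i) (α i) t)]
  simp only [integral_jacobiFun_mul (hk _) (hl _)]
  split_ifs with hkl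
  · simp [hkl]
  · obtain ⟨i, hi⟩ := Function.ne_iff.1 hkl
    rw [Finset.prod_eq_zero (Finset.mem_univ i) (by simp [hi]), Complex.ofReal_zero]

theorem orthonormal_jacobiTensor [IsFiniteMeasure μ] (h : IsUnitCubeDomain E μ) (α : Fin d → ℕ) :
    Orthonormal ℂ fun l : {l : Fin d → ℕ // α ≤ l} => coordLp E μ (jacobiTensor l.1 α) := by
  classical
  rw [orthonormal_iff_ite]
  intro k l
  rw [inner_jacobiTensor h k.2 l.2]
  simp [Subtype.ext_iff]

/-- The tensor products of normalized Legendre polynomials, as elements of `L²(μ)`. -/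
noncomputable def legendreLp (E : SobolevDomain d D) (μ : Measure D) [IsFiniteMeasure μ]
    (l : Fin d → ℕ) : Lp ℂ 2 μ := coordLp E μ (jacobiTensor l 0)

theorem orthonormal_legendreLp [IsFiniteMeasure μ] (h : IsUnitCubeDomain E μ) :
    Orthonormal ℂ (legendreLp E μ) := by
  classical
  rw [orthonormal_iff_ite]
  intro k l
  exact inner_jacobiTensor h (fun i => Nat.zero_le _) (fun i => Nat.zero_le _)

/-- Bessel's inequality in the Jacobi system, translated into Legendre coefficients. -/
theorem sum_jacobiNorm_div_mul_inner_sq_le [IsFiniteMeasure μ] (h : IsUnitCubeDomain E μ)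
    {α : Fin d → ℕ} {u v : Lp ℂ 2 μ} (huv : IsWeakDeriv E μ α u v) (s : Finset (Fin d → ℕ))
    (hs : ∀ l ∈ s, α ≤ l) :
    ∑ l ∈ s, (∏ i, jacobiNorm (l i) 0 / jacobiNorm (l i) (α i)) *
      ‖(inner ℂ (legendreLp E μ l) u : ℂ)‖ ^ 2 ≤ ‖v‖ ^ 2 := by
  classical
  set m : (Fin d → ℝ) → ℝ := fun y => ∏ i, √(bumpPoly.eval (y i)) ^ α i with hm
  have hmc : Continuous m := continuous_finsetProd _ fun i _ =>
    (bumpPoly.continuous.comp (continuous_apply i)).sqrt.pow _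
  have hm1 : ∀ x, |m (E.coord x)| ≤ 1 := by
    intro x
    rw [hm, Finset.abs_prod]
    refine Finset.prod_le_one (fun i _ => abs_nonneg _) fun i _ => ?_
    rw [abs_of_nonneg (by positivity)]
    refine pow_le_one₀ (Real.sqrt_nonneg _) (Real.sqrt_le_one.2 ?_)
    rw [eval_bumpPoly]
    nlinarith [(E.coord_mem x).1 i, (E.coord_mem x).2 i, sq_nonneg (E.coord x i)]
  have hle : ∀ x, ‖v x * (m (E.coord x) : ℂ)‖ ≤ ‖v x‖ := by
    intro x
    rw [norm_mul, Complex.norm_real]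
    exact mul_le_of_le_one_right (norm_nonneg _) (hm1 x)
  have hw : MemLp (fun x => v x * (m (E.coord x) : ℂ)) 2 μ :=
    (Lp.memLp v).mono (integrable_mul_coord E μ (Complex.continuous_ofReal.comp hmc)
      v).aestronglyMeasurable (Eventually.of_forall hle)
  have hnorm : ‖hw.toLp‖ ≤ ‖v‖ := by
    refine Lp.norm_le_norm_of_ae_le ?_
    filter_upwards [hw.coeFn_toLp] with x hx
    rw [hx]; exact hle x
  have hcoef : ∀ l, α ≤ l → ‖(inner ℂ (coordLp E μ (jacobiTensor l α)) hw.toLp : ℂ)‖ ^ 2 =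
      (∏ i, jacobiNorm (l i) 0 / jacobiNorm (l i) (α i)) *
        ‖(inner ℂ (legendreLp E μ l) u : ℂ)‖ ^ 2 := by
    intro l hl
    choose φ hφ using fun i => exists_testApprox_legendre (l i) (α i) (hl i)
    have hweak := integral_mul_tensor_of_isWeakDeriv h huv hφ
    have e1 : (inner ℂ (coordLp E μ (jacobiTensor l α)) hw.toLp : ℂ) =
        ((∏ i, √(jacobiNorm (l i) (α i)) : ℝ) : ℂ)⁻¹ *
          ∫ x, v x * ((∏ i, (legendre (l i) (α i)).eval (E.coord x i) : ℝ) : ℂ) ∂μ := by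
      rw [inner_coordLp, ← integral_const_mul]
      refine integral_congr_ae ?_
      filter_upwards [hw.coeFn_toLp] with x hx
      rw [hx]
      simp only [jacobiTensor, ContinuousMap.coe_mk, Complex.conj_ofReal]
      have : m (E.coord x) * ∏ i, jacobiFun (l i) (α i) (E.coord x i) =
          (∏ i, √(jacobiNorm (l i) (α i)))⁻¹ * ∏ i, (legendre (l i) (α i)).eval (E.coord x i) := by
        rw [hm, ← Finset.prod_mul_distrib, ← Finset.prod_inv_distrib, ← Finset.prod_mul_distrib]
        refine Finset.prod_congr rfl fun i _ => ?_
        have hb : 0 ≤ bumpPoly.eval (E.coord x i) :=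
          eval_bumpPoly_nonneg ⟨(E.coord_mem x).1 i, (E.coord_mem x).2 i⟩
        have h2 : √(bumpPoly.eval (E.coord x i)) ^ α i * √(bumpPoly.eval (E.coord x i)) ^ α i =
            bumpPoly.eval (E.coord x i) ^ α i := by
          rw [← mul_pow, Real.mul_self_sqrt hb]
        rw [← bumpPoly_pow_mul_jacobi (hl i), eval_mul, eval_pow, ← h2, jacobiFun]
        ring
      calc v x * (m (E.coord x) : ℂ) * ((∏ i, jacobiFun (l i) (α i) (E.coord x i) : ℝ) : ℂ)
          = v x * ((m (E.coord x) * ∏ i, jacobiFun (l i) (α i) (E.coord x i) : ℝ) : ℂ) := by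
            rw [Complex.ofReal_mul]; ring
        _ = _ := by rw [this, Complex.ofReal_mul, Complex.ofReal_inv]; ring
    have e2 : (inner ℂ (legendreLp E μ l) u : ℂ) =
        ((∏ i, √(jacobiNorm (l i) 0) : ℝ) : ℂ)⁻¹ *
          ∫ x, u x * ((∏ i, (legendre (l i) 0).eval (E.coord x i) : ℝ) : ℂ) ∂μ := by
      rw [legendreLp, inner_coordLp, ← integral_const_mul]
      refine integral_congr_ae (Eventually.of_forall fun x => ?_)
      simp only [jacobiTensor, ContinuousMap.coe_mk, Complex.conj_ofReal]
      have : ∏ i, jacobiFun (l i) ((0 : Fin d → ℕ) i) (E.coord x i) =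
          (∏ i, √(jacobiNorm (l i) 0))⁻¹ * ∏ i, (legendre (l i) 0).eval (E.coord x i) := by
        rw [← Finset.prod_inv_distrib, ← Finset.prod_mul_distrib]
        refine Finset.prod_congr rfl fun i _ => ?_
        rw [← bumpPoly_pow_mul_jacobi (Nat.zero_le _), jacobiFun]
        simp only [Pi.zero_apply, pow_zero, one_mul]
        ring
      rw [this, Complex.ofReal_mul, Complex.ofReal_inv]; ring
    have hsq : ∀ β : Fin d → ℕ, (∏ i, √(jacobiNorm (l i) (β i))) ^ 2 =
        ∏ i, jacobiNorm (l i) (β i) := by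
      intro β
      rw [← Finset.prod_pow]
      exact Finset.prod_congr rfl fun i _ => Real.sq_sqrt (jacobiNorm_pos _ _).le
    have hpos : ∀ β : Fin d → ℕ, 0 < ∏ i, jacobiNorm (l i) (β i) := fun β =>
      Finset.prod_pos fun i _ => jacobiNorm_pos _ _
    have hs0 := hsq 0
    have hp0 := hpos 0
    simp only [Pi.zero_apply] at hs0 hp0
    rw [e1, e2, hweak]
    simp only [norm_mul, norm_inv, Complex.norm_real, norm_pow, norm_neg, norm_one, one_pow,
      one_mul, mul_pow, inv_pow, Real.norm_eq_abs, sq_abs]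
    rw [hsq, hs0, Finset.prod_div_distrib]
    have := hpos α
    field_simp
  have hB := (orthonormal_jacobiTensor (E := E) (μ := μ) h α).sum_inner_products_le hw.toLp
    (s := s.subtype fun l => α ≤ l)
  rw [Finset.sum_subtype_of_mem (fun l => ‖(inner ℂ (coordLp E μ (jacobiTensor l α)) hw.toLp : ℂ)‖ ^ 2)
    hs] at hB
  rw [Finset.sum_congr rfl fun l hl => (hcoef l (hs l hl)).symm]
  exact hB.trans (pow_le_pow_left₀ (norm_nonneg _) hnorm 2)

end JacobiExpansion

/-! ### Completeness of the Legendre system and decay of coefficients -/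

section LegendreCompleteness

open Polynomial Filter Topology
open scoped ContDiff ComplexConjugate

variable {d : ℕ} {D : Type*} [MeasurableSpace D] {E : SobolevDomain d D} {μ : Measure D}

/-- The value at a point of the unit cube of a tensor product of polynomials. -/
noncomputable def polyTensor (f : Fin d → ℝ[X]) (y : Fin d → ℝ) : ℝ := ∏ i, (f i).eval (y i)

theorem polyTensor_update (f : Fin d → ℝ[X]) (i : Fin d) (p : ℝ[X]) (y : Fin d → ℝ) :
    polyTensor (Function.update f i p) y =
      p.eval (y i) * ∏ j ∈ Finset.univ.erase i, (f j).eval (y j) := by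
  unfold polyTensor
  rw [← Finset.mul_prod_erase _ _ (Finset.mem_univ i), Function.update_self]
  congr 1
  refine Finset.prod_congr rfl fun j hj => ?_
  rw [Function.update_of_ne (Finset.ne_of_mem_erase hj)]

theorem continuous_polyTensor (f : Fin d → ℝ[X]) : Continuous (polyTensor f) :=
  continuous_finsetProd _ fun i _ => (f i).continuous.comp (continuous_apply i)

theorem integrable_mul_real [IsFiniteMeasure μ] (u : Lp ℂ 2 μ) {ψ : (Fin d → ℝ) → ℝ}
    (hψ : Continuous ψ) : Integrable (fun x => u x * (ψ (E.coord x) : ℂ)) μ :=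
  integrable_mul_coord E μ (Complex.continuous_ofReal.comp hψ) u

theorem integral_mul_polyTensor_eq_zero [IsFiniteMeasure μ] {u : Lp ℂ 2 μ}
    (hu : ∀ l, (inner ℂ (legendreLp E μ l) u : ℂ) = 0) (f : Fin d → ℝ[X]) :
    ∫ x, u x * (polyTensor f (E.coord x) : ℂ) ∂μ = 0 := by
  -- pass from Legendre polynomials to all polynomials in one coordinate after the other
  have key : ∀ (s : Finset (Fin d)) (f : Fin d → ℝ[X]),
      (∀ i, i ∉ s → f i ∈ Set.range fun l => legendre l 0) →
      ∫ x, u x * (polyTensor f (E.coord x) : ℂ) ∂μ = 0 := by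
    intro s
    induction s using Finset.induction_on with
    | empty =>
      intro f hf
      choose l hl using fun i => hf i (Finset.notMem_empty i)
      have h1 : ∀ x, polyTensor f (E.coord x) = (∏ i, √(jacobiNorm (l i) 0)) *
          ∏ i, jacobiFun (l i) 0 (E.coord x i) := by
        intro x
        unfold polyTensor
        rw [← Finset.prod_mul_distrib]
        refine Finset.prod_congr rfl fun i _ => ?_
        have : √(jacobiNorm (l i) 0) ≠ 0 := (Real.sqrt_pos.2 (jacobiNorm_pos _ _)).ne'
        rw [← hl i]
        simp only [jacobiFun]
        rw [← bumpPoly_pow_mul_jacobi (Nat.zero_le _), pow_zero, pow_zero, one_mul, one_mul]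
        field_simp
      have h2 := hu l
      rw [legendreLp, inner_coordLp] at h2
      calc ∫ x, u x * (polyTensor f (E.coord x) : ℂ) ∂μ
          = ∫ x, ((∏ i, √(jacobiNorm (l i) 0) : ℝ) : ℂ) *
              (u x * conj (jacobiTensor l 0 (E.coord x))) ∂μ := by
            refine integral_congr_ae (Eventually.of_forall fun x => ?_)
            simp only [jacobiTensor, ContinuousMap.coe_mk, Complex.conj_ofReal, Pi.zero_apply]
            rw [h1 x, Complex.ofReal_mul]; ring
        _ = 0 := by rw [integral_const_mul, h2, mul_zero]
    | insert a s ha ih =>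
      intro f hf
      have hp : ∀ p ∈ Submodule.span ℝ (Set.range fun l => legendre l 0),
          ∫ x, u x * (polyTensor (Function.update f a p) (E.coord x) : ℂ) ∂μ = 0 := by
        intro p hp
        induction hp using Submodule.span_induction with
        | mem p hp =>
          refine ih _ fun i hi => ?_
          rcases eq_or_ne i a with rfl | hia
          · rwa [Function.update_self]
          · rw [Function.update_of_ne hia]
            exact hf i (by simp [hia, hi])
        | zero => simp [polyTensor_update]
        | add p q _ _ h1 h2 =>
          have : ∀ x, u x * (polyTensor (Function.update f a (p + q)) (E.coord x) : ℂ) =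
              u x * (polyTensor (Function.update f a p) (E.coord x) : ℂ) +
              u x * (polyTensor (Function.update f a q) (E.coord x) : ℂ) := by
            intro x
            simp only [polyTensor_update, eval_add]
            push_cast; ring
          simp only [this]
          rw [integral_add (integrable_mul_real u (continuous_polyTensor _))
            (integrable_mul_real u (continuous_polyTensor _)), h1, h2, add_zero]
        | smul c p _ h1 =>
          have : ∀ x, u x * (polyTensor (Function.update f a (c • p)) (E.coord x) : ℂ) =
              c * (u x * (polyTensor (Function.update f a p) (E.coord x) : ℂ)) := by
            intro x
            simp only [polyTensor_update, eval_smul, smul_eq_mul]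
            push_cast; ring
          simp only [this]
          rw [integral_const_mul, h1, mul_zero]
      have := hp (f a) (mem_span_legendre _)
      rwa [Function.update_eq_self] at this
  exact key Finset.univ f fun i hi => absurd (Finset.mem_univ i) hi

/-- A function orthogonal to all Legendre tensor products is orthogonal to all continuous functions
of the coordinates, by the Stone-Weierstrass theorem. -/
theorem integral_mul_continuous_eq_zero [IsFiniteMeasure μ] {u : Lp ℂ 2 μ}
    (hu : ∀ l, (inner ℂ (legendreLp E μ l) u : ℂ) = 0) {ψ : (Fin d → ℝ) → ℝ}
    (hψ : Continuous ψ) : ∫ x, u x * (ψ (E.coord x) : ℂ) ∂μ = 0 := by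
  let Q := ↥(Set.Icc (0 : Fin d → ℝ) 1)
  let π : Fin d → C(Q, ℝ) := fun i =>
    ⟨fun y => y.1 i, (continuous_apply i).comp continuous_subtype_val⟩
  let A : Subalgebra ℝ C(Q, ℝ) := Algebra.adjoin ℝ (Set.range π)
  have hA : A.SeparatesPoints := by
    intro x y hxy
    have : x.1 ≠ y.1 := fun h => hxy (Subtype.ext h)
    obtain ⟨i, hi⟩ := Function.ne_iff.1 this
    exact ⟨π i, ⟨π i, Algebra.subset_adjoin ⟨i, rfl⟩, rfl⟩, hi⟩
  have htop := ContinuousMap.subalgebra_topologicalClosure_eq_top_of_separatesPoints A hA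
  let ext : C(Q, ℝ) → D → ℝ := fun f x => f ⟨E.coord x, E.coord_mem x⟩
  have hmeas : ∀ f : C(Q, ℝ), Integrable (fun x => u x * (ext f x : ℂ)) μ := by
    intro f
    refine ((Lp.memLp u).integrable (by norm_num)).mul_bdd (c := ‖f‖) ?_
      (Eventually.of_forall fun x => ?_)
    · refine (Complex.measurable_ofReal.comp ?_).aestronglyMeasurable
      exact f.continuous.measurable.comp (E.measurable_coord.subtype_mk)
    · rw [Complex.norm_real]; exact f.norm_coe_le_norm _
  have hspan : ∀ f ∈ Submodule.span ℝ (Submonoid.closure (Set.range π) : Set C(Q, ℝ)),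
      ∫ x, u x * (ext f x : ℂ) ∂μ = 0 := by
    intro f hf
    induction hf using Submodule.span_induction with
    | mem f hf =>
      have hmon : ∃ n : Fin d → ℕ, ∀ y : Q, f y = ∏ i, y.1 i ^ n i := by
        induction hf using Submonoid.closure_induction with
        | mem f hf =>
          obtain ⟨i, rfl⟩ := hf
          refine ⟨Pi.single i 1, fun y => ?_⟩
          rw [Finset.prod_eq_single i (fun j _ hj => by simp [Pi.single_eq_of_ne hj]) (by simp)]
          simp [π]
        | one => exact ⟨0, fun y => by simp⟩
        | mul f g _ _ h1 h2 =>
          obtain ⟨n, hn⟩ := h1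
          obtain ⟨m, hm⟩ := h2
          refine ⟨n + m, fun y => ?_⟩
          rw [ContinuousMap.mul_apply, hn, hm, ← Finset.prod_mul_distrib]
          simp only [Pi.add_apply, pow_add]
      obtain ⟨n, hn⟩ := hmon
      refine Eq.trans ?_ (integral_mul_polyTensor_eq_zero hu fun i => Polynomial.X ^ n i)
      refine integral_congr_ae (Eventually.of_forall fun x => ?_)
      simp [ext, hn, polyTensor]
    | zero => simp [ext]
    | add f g _ _ h1 h2 =>
      have e : ∀ x, u x * (ext (f + g) x : ℂ) = u x * (ext f x : ℂ) + u x * (ext g x : ℂ) := by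
        intro x; simp only [ext, ContinuousMap.add_apply]; push_cast; ring
      simp only [e]
      rw [integral_add (hmeas f) (hmeas g), h1, h2, add_zero]
    | smul c f _ h1 =>
      have e : ∀ x, u x * (ext (c • f) x : ℂ) = c * (u x * (ext f x : ℂ)) := by
        intro x; simp only [ext, ContinuousMap.smul_apply, smul_eq_mul]; push_cast; ring
      simp only [e]
      rw [integral_const_mul, h1, mul_zero]
  have hAzero : ∀ f ∈ A, ∫ x, u x * (ext f x : ℂ) ∂μ = 0 := fun f hf => hspan f <| by
    rw [← Algebra.adjoin_eq_span]; exact hf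
  set f₀ : C(Q, ℝ) := ⟨fun y => ψ y.1, hψ.comp continuous_subtype_val⟩ with hf₀
  have hf₀mem : f₀ ∈ closure (A : Set C(Q, ℝ)) := by
    have : f₀ ∈ A.topologicalClosure := by rw [htop]; trivial
    exact this
  set M := ∫ x, ‖u x‖ ∂μ with hM
  have hM0 : 0 ≤ M := integral_nonneg fun _ => norm_nonneg _
  have hu1 : Integrable (fun x => ‖u x‖) μ := ((Lp.memLp u).integrable (by norm_num)).norm
  have hsmall : ∀ ε > 0, ‖∫ x, u x * (ψ (E.coord x) : ℂ) ∂μ‖ ≤ ε * M := by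
    intro ε hε
    obtain ⟨g, hg, hgd⟩ := Metric.mem_closure_iff.1 hf₀mem ε hε
    have h1 : ∫ x, u x * (ψ (E.coord x) : ℂ) ∂μ = ∫ x, u x * (ext (f₀ - g) x : ℂ) ∂μ := by
      have e : ∀ x, u x * (ext (f₀ - g) x : ℂ) = u x * (ext f₀ x : ℂ) - u x * (ext g x : ℂ) := by
        intro x; simp only [ext, ContinuousMap.sub_apply]; push_cast; ring
      simp only [e]
      rw [integral_sub (hmeas f₀) (hmeas g), hAzero g hg, sub_zero]
      rfl
    rw [h1, hM, ← integral_const_mul]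
    refine norm_integral_le_of_norm_le (hu1.const_mul _) (Eventually.of_forall fun x => ?_)
    rw [norm_mul, mul_comm, Complex.norm_real]
    refine mul_le_mul_of_nonneg_right (((f₀ - g).norm_coe_le_norm _).trans ?_) (norm_nonneg _)
    rw [← dist_eq_norm]; exact hgd.le
  rw [← norm_le_zero_iff]
  refine le_of_forall_pos_le_add fun ε hε => ?_
  rw [zero_add]
  refine (hsmall (ε / (M + 1)) (by positivity)).trans ?_
  rw [div_mul_eq_mul_div, div_le_iff₀ (by positivity)]
  nlinarith

/-- The Legendre tensor products form a complete system in `L²(μ)`. -/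
theorem eq_zero_of_inner_legendreLp [IsFiniteMeasure μ] (h : IsUnitCubeDomain E μ)
    {u : Lp ℂ 2 μ} (hu : ∀ l, (inner ℂ (legendreLp E μ l) u : ℂ) = 0) : u = 0 := by
  set G : (Fin d → ℝ) → ℂ := Function.extend E.coord u 0 with hG
  have hGu : ∀ x, G (E.coord x) = u x := fun x => h.emb.injective.extend_apply _ _ x
  have hGi : Integrable G (unitCubeMeasure d) := by
    rw [← h.map, h.emb.integrable_map_iff]
    refine ((Lp.memLp u).integrable (by norm_num)).congr (Eventually.of_forall fun x => ?_)
    exact (hGu x).symm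
  have hG0 := ae_eq_zero_of_integral_contDiff_smul_eq_zero hGi.locallyIntegrable
    (fun g hg _ => by
      rw [← h.integral_comp, ← integral_mul_continuous_eq_zero hu hg.continuous]
      refine integral_congr_ae (Eventually.of_forall fun x => ?_)
      simp only [hGu, Complex.real_smul, mul_comm])
  rw [← h.map, h.emb.ae_map_iff] at hG0
  refine Lp.ext ?_
  filter_upwards [hG0, Lp.coeFn_zero ℂ 2 μ] with x hx h0
  rw [h0, ← hGu, hx]; rfl

/-- If the Legendre coefficients outside a finite set satisfy a Bessel inequality with constant
`B`, then this bounds the error of the corresponding orthogonal projection. -/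
theorem norm_sub_sum_legendreLp_le [IsFiniteMeasure μ] (h : IsUnitCubeDomain E μ)
    (u : Lp ℂ 2 μ) (Λ : Finset (Fin d → ℕ)) {B : ℝ} (hB0 : 0 ≤ B)
    (hB : ∀ s : Finset (Fin d → ℕ), Disjoint s Λ →
      ∑ l ∈ s, ‖(inner ℂ (legendreLp E μ l) u : ℂ)‖ ^ 2 ≤ B ^ 2) :
    ‖u - ∑ l ∈ Λ, (inner ℂ (legendreLp E μ l) u : ℂ) • legendreLp E μ l‖ ≤ B := by
  classical
  have horth := orthonormal_legendreLp h
  have hbot : (Submodule.span ℂ (Set.range (legendreLp E μ)))ᗮ = ⊥ := by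
    rw [Submodule.eq_bot_iff]
    intro u hu
    refine eq_zero_of_inner_legendreLp h fun l => ?_
    exact (Submodule.mem_orthogonal _ _).1 hu _ (Submodule.subset_span ⟨l, rfl⟩)
  let b := HilbertBasis.mkOfOrthogonalEqBot horth hbot
  have hsum : HasSum (fun l => (inner ℂ (legendreLp E μ l) u : ℂ) • legendreLp E μ l) u := by
    have := b.hasSum_repr u
    simpa [HilbertBasis.repr_apply_apply, b] using this
  have hsum' : Tendsto (fun s : Finset (Fin d → ℕ) => ∑ l ∈ s,
      (inner ℂ (legendreLp E μ l) u : ℂ) • legendreLp E μ l) atTop (𝓝 u) := by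
    simpa [HasSum] using hsum
  have hlim := (hsum'.sub_const
    (∑ l ∈ Λ, (inner ℂ (legendreLp E μ l) u : ℂ) • legendreLp E μ l)).norm
  refine le_of_tendsto hlim ?_
  filter_upwards [eventually_ge_atTop Λ] with s hs
  rw [← Finset.sum_sdiff hs, add_sub_cancel_right]
  refine le_of_sq_le_sq ?_ hB0
  rw [horth.norm_sq_sum_smul]
  exact hB _ Finset.sdiff_disjoint

/-- The derivative used for the Legendre coefficient with index `l`: order `r` in the coordinates
with `r ≤ l i`, and no derivative in the others. -/
def derivOrder (r : ℕ) (l : Fin d → ℕ) : Fin d → Fin (r + 1) :=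
  fun i => if r ≤ l i then Fin.last r else 0

theorem derivOrder_le (r : ℕ) (l : Fin d → ℕ) : (fun i => (derivOrder r l i : ℕ)) ≤ l := by
  intro i
  simp only [derivOrder]
  split_ifs with h
  · simpa using h
  · simp

theorem pow_div_le_prod_jacobiNorm_div (r : ℕ) (l : Fin d → ℕ) :
    ((∏ i, ((l i : ℝ) + 1)) / ((r : ℝ) + 1) ^ d) ^ (2 * r) ≤
      ∏ i, jacobiNorm (l i) 0 / jacobiNorm (l i) (derivOrder r l i) := by
  have e : ((r : ℝ) + 1) ^ d = ∏ _i : Fin d, ((r : ℝ) + 1) := by simp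
  rw [e, ← Finset.prod_div_distrib, ← Finset.prod_pow]
  refine Finset.prod_le_prod (fun i _ => by positivity) fun i _ => ?_
  have hr : (0 : ℝ) < (r : ℝ) + 1 := by positivity
  simp only [derivOrder]
  split_ifs with h
  · rw [Fin.val_last, div_pow, div_le_div_iff₀ (by positivity) (jacobiNorm_pos _ _)]
    have := jacobiNorm_mul_pow_le h
    linarith
  · rw [Fin.val_zero, div_self (jacobiNorm_pos _ _).ne']
    refine pow_le_one₀ (by positivity) ?_
    rw [div_le_one hr]
    have : (l i : ℝ) < r := by exact_mod_cast not_le.1 h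
    linarith

/-- Smoothness controls the decay of the Legendre coefficients. -/
theorem sum_pow_mul_inner_legendreLp_sq_le [IsFiniteMeasure μ] (h : IsUnitCubeDomain E μ) {r : ℕ}
    (u : mixedSobolev E μ r) (s : Finset (Fin d → ℕ)) :
    ∑ l ∈ s, ((∏ i, ((l i : ℝ) + 1)) / ((r : ℝ) + 1) ^ d) ^ (2 * r) *
      ‖(inner ℂ (legendreLp E μ l) (mixedEmbedding E μ r u) : ℂ)‖ ^ 2 ≤ ‖u‖ ^ 2 := by
  classical
  rw [← Finset.sum_fiberwise s (derivOrder r), Submodule.coe_norm, PiLp.norm_sq_eq_of_L2]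
  refine Finset.sum_le_sum fun α _ => ?_
  have hα : ∀ l ∈ s.filter (fun l => derivOrder r l = α), (fun i => (α i : ℕ)) ≤ l := by
    intro l hl
    rw [← (Finset.mem_filter.1 hl).2]
    exact derivOrder_le r l
  refine le_trans ?_ (sum_jacobiNorm_div_mul_inner_sq_le h (u.2 α) _ hα)
  refine Finset.sum_le_sum fun l hl => mul_le_mul_of_nonneg_right ?_ (sq_nonneg _)
  rw [← (Finset.mem_filter.1 hl).2]
  exact pow_div_le_prod_jacobiNorm_div r l

/-- The error of the Legendre projection for a Sobolev function of mixed smoothness. -/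
theorem norm_mixedEmbedding_sub_sum_le [IsFiniteMeasure μ] (h : IsUnitCubeDomain E μ) {r : ℕ}
    (Λ : Finset (Fin d → ℕ)) {T : ℝ} (hT : 0 < T) (hΛ : ∀ l ∉ Λ, T ≤ ∏ i, ((l i : ℝ) + 1))
    (u : mixedSobolev E μ r) :
    ‖mixedEmbedding E μ r u - ∑ l ∈ Λ, (inner ℂ (legendreLp E μ l) (mixedEmbedding E μ r u) : ℂ) •
      legendreLp E μ l‖ ≤ (((r : ℝ) + 1) ^ d / T) ^ r * ‖u‖ := by
  refine norm_sub_sum_legendreLp_le h _ Λ (by positivity) fun s hs => ?_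
  have hr : (0 : ℝ) < ((r : ℝ) + 1) ^ d := by positivity
  have h1 := sum_pow_mul_inner_legendreLp_sq_le h u s
  have h2 : (T / ((r : ℝ) + 1) ^ d) ^ (2 * r) *
      ∑ l ∈ s, ‖(inner ℂ (legendreLp E μ l) (mixedEmbedding E μ r u) : ℂ)‖ ^ 2 ≤ ‖u‖ ^ 2 := by
    refine le_trans ?_ h1
    rw [Finset.mul_sum]
    refine Finset.sum_le_sum fun l hl => mul_le_mul_of_nonneg_right ?_ (sq_nonneg _)
    have := hΛ l (Finset.disjoint_left.1 hs hl)
    gcongr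
  have e : (((r : ℝ) + 1) ^ d / T) ^ r * (((r : ℝ) + 1) ^ d / T) ^ r *
      (T / ((r : ℝ) + 1) ^ d) ^ (2 * r) = 1 := by
    rw [← mul_pow, two_mul, pow_add, ← mul_pow, ← mul_pow]
    have : ((r : ℝ) + 1) ^ d / T * (((r : ℝ) + 1) ^ d / T) *
        (T / ((r : ℝ) + 1) ^ d * (T / ((r : ℝ) + 1) ^ d)) = 1 := by
      generalize ((r : ℝ) + 1) ^ d = q at hr
      field_simp
    rw [this, one_pow]
  calc ∑ l ∈ s, ‖(inner ℂ (legendreLp E μ l) (mixedEmbedding E μ r u) : ℂ)‖ ^ 2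
      = (((r : ℝ) + 1) ^ d / T) ^ r * (((r : ℝ) + 1) ^ d / T) ^ r *
        ((T / ((r : ℝ) + 1) ^ d) ^ (2 * r) *
        ∑ l ∈ s, ‖(inner ℂ (legendreLp E μ l) (mixedEmbedding E μ r u) : ℂ)‖ ^ 2) := by
        rw [← mul_assoc, e, one_mul]
    _ ≤ (((r : ℝ) + 1) ^ d / T) ^ r * (((r : ℝ) + 1) ^ d / T) ^ r * ‖u‖ ^ 2 :=
        mul_le_mul_of_nonneg_left h2 (by positivity)
    _ = _ := by ring

end LegendreCompleteness

/-! ### Exponentials in the Sobolev space -/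

section Exponentials

open Filter Topology
open scoped ContDiff ComplexConjugate

variable {d : ℕ} {D : Type*} [MeasurableSpace D] {E : SobolevDomain d D} {μ : Measure D}

/-- The exponential as a bundled continuous function. -/
noncomputable def expoMap (k : Fin d → ℕ) : C(Fin d → ℝ, ℂ) := ⟨expo k, (contDiff_expo k).continuous⟩

theorem integral_cexp_unit (m : ℤ) :
    ∫ t in Set.Icc (0 : ℝ) 1, Complex.exp (2 * Real.pi * Complex.I * m * t) =
      if m = 0 then 1 else 0 := by
  rw [integral_Icc_eq_integral_Ioc, ← intervalIntegral.integral_of_le zero_le_one]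
  split_ifs with h
  · simp [h]
  · have hc : 2 * Real.pi * Complex.I * m ≠ 0 :=
      mul_ne_zero Complex.two_pi_I_ne_zero (by exact_mod_cast h)
    rw [integral_exp_mul_complex hc]
    have : 2 * Real.pi * Complex.I * m * ((1 : ℝ) : ℂ) = m * (2 * Real.pi * Complex.I) := by
      push_cast; ring
    rw [this, Complex.exp_int_mul_two_pi_mul_I]
    simp

theorem inner_expo [IsFiniteMeasure μ] (h : IsUnitCubeDomain E μ) (k l : Fin d → ℕ) :
    inner ℂ (coordLp E μ (expoMap k)) (coordLp E μ (expoMap l)) = if k = l then 1 else 0 := by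
  rw [inner_coordLp_coordLp h]
  have h1 : ∀ y : Fin d → ℝ, expoMap l y * conj (expoMap k y) =
      ∏ i, Complex.exp (2 * Real.pi * Complex.I * ((l i - k i : ℤ) : ℂ) * y i) := by
    intro y
    simp only [expoMap, ContinuousMap.coe_mk, expo, tensor, map_prod, ← Complex.exp_conj]
    rw [← Finset.prod_mul_distrib]
    refine Finset.prod_congr rfl fun i _ => ?_
    rw [← Complex.exp_add]
    congr 1
    simp only [map_mul, Complex.conj_ofReal, Complex.conj_I, map_natCast, map_ofNat]
    push_cast; ring
  simp only [h1]
  rw [unitCubeMeasure, integral_fintype_prod_eq_prod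
    (fun i (t : ℝ) => Complex.exp (2 * Real.pi * Complex.I * ((l i - k i : ℤ) : ℂ) * t))]
  simp only [integral_cexp_unit]
  split_ifs with hkl
  · simp [hkl]
  · obtain ⟨i, hi⟩ := Function.ne_iff.1 hkl
    refine Finset.prod_eq_zero (Finset.mem_univ i) (if_neg ?_)
    omega

theorem expoSymbol_zero (k : Fin d → ℕ) : expoSymbol k 0 = 1 := by simp [expoSymbol]

/-- The exponentials as elements of the Sobolev space. -/
noncomputable def expoSobolev [IsFiniteMeasure μ] (h : IsUnitCubeDomain E μ) (r : ℕ)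
    (k : Fin d → ℕ) : mixedSobolev E μ r :=
  ⟨WithLp.toLp 2 fun α => expoSymbol k (fun i => (α i : ℕ)) • coordLp E μ (expoMap k), by
    intro α φ hφ
    have hs := E.smooth φ hφ
    have h0 : expoSymbol k (fun i => (((0 : Fin d → Fin (r + 1)) i : ℕ))) = 1 :=
      expoSymbol_zero k
    simp only [h0, one_smul]
    have e1 : ∫ x, coordLp E μ (expoMap k) x * multiDeriv (fun i => (α i : ℕ)) φ (E.coord x) ∂μ =
        ∫ y, expo k y * multiDeriv (fun i => (α i : ℕ)) φ y ∂(unitCubeMeasure d) := by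
      rw [← h.integral_comp]
      refine integral_congr_ae ?_
      filter_upwards [coeFn_coordLp (E := E) (μ := μ) (expoMap k)] with x hx
      rw [hx]; rfl
    have e2 : ∫ x, (expoSymbol k (fun i => (α i : ℕ)) • coordLp E μ (expoMap k) : Lp ℂ 2 μ) x *
        φ (E.coord x) ∂μ =
        expoSymbol k (fun i => (α i : ℕ)) * ∫ y, expo k y * φ y ∂(unitCubeMeasure d) := by
      rw [← h.integral_comp, ← integral_const_mul]
      refine integral_congr_ae ?_
      filter_upwards [coeFn_coordLp (E := E) (μ := μ) (expoMap k),
        Lp.coeFn_smul (expoSymbol k (fun i => (α i : ℕ))) (coordLp E μ (expoMap k))] with x hx hx2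
      rw [hx2, Pi.smul_apply, hx, smul_eq_mul, mul_assoc]; rfl
    rw [e1, e2, h.integral_expo_mul_multiDeriv k _ hφ]⟩

theorem mixedEmbedding_expoSobolev [IsFiniteMeasure μ] (h : IsUnitCubeDomain E μ) (r : ℕ)
    (k : Fin d → ℕ) :
    mixedEmbedding E μ r (expoSobolev h r k) = coordLp E μ (expoMap k) := by
  have h0 : expoSymbol k (fun i => (((0 : Fin d → Fin (r + 1)) i : ℕ))) = 1 := expoSymbol_zero k
  change expoSymbol k (fun i => (((0 : Fin d → Fin (r + 1)) i : ℕ))) • coordLp E μ (expoMap k) = _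
  rw [h0, one_smul]

theorem norm_coordLp_expoMap [IsFiniteMeasure μ] (h : IsUnitCubeDomain E μ) (k : Fin d → ℕ) :
    ‖coordLp E μ (expoMap k)‖ = 1 := by
  have h2 := inner_self_eq_norm_sq (𝕜 := ℂ) (coordLp E μ (expoMap k))
  rw [inner_expo h, if_pos rfl, RCLike.one_re] at h2
  nlinarith [norm_nonneg (coordLp E μ (expoMap k))]

theorem inner_expoSobolev_of_ne [IsFiniteMeasure μ] (h : IsUnitCubeDomain E μ) (r : ℕ)
    {k l : Fin d → ℕ} (hkl : k ≠ l) :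
    inner ℂ (expoSobolev h r k) (expoSobolev h r l) = 0 := by
  rw [Submodule.coe_inner, PiLp.inner_apply]
  refine Finset.sum_eq_zero fun α _ => ?_
  change inner ℂ (expoSymbol k (fun i => (α i : ℕ)) • coordLp E μ (expoMap k))
    (expoSymbol l (fun i => (α i : ℕ)) • coordLp E μ (expoMap l)) = 0
  rw [inner_smul_left, inner_smul_right, inner_expo h, if_neg hkl, mul_zero, mul_zero]

theorem norm_expoSobolev_pos [IsFiniteMeasure μ] (h : IsUnitCubeDomain E μ) (r : ℕ)
    (k : Fin d → ℕ) : 0 < ‖expoSobolev h r k‖ := by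
  rw [norm_pos_iff]
  intro h0
  have h1 := norm_coordLp_expoMap h k
  rw [← mixedEmbedding_expoSobolev h r k, h0, map_zero, norm_zero] at h1
  exact zero_ne_one h1

theorem norm_expoSobolev_le [IsFiniteMeasure μ] (h : IsUnitCubeDomain E μ) (r : ℕ)
    (k : Fin d → ℕ) :
    ‖expoSobolev h r k‖ ≤ ((r : ℝ) + 1) ^ d * ((2 * Real.pi) ^ d * ∏ i, ((k i : ℝ) + 1)) ^ r := by
  have hpi : 1 ≤ 2 * Real.pi := by linarith [Real.pi_gt_three]
  set B := ((2 * Real.pi) ^ d * ∏ i, ((k i : ℝ) + 1)) ^ r with hB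
  have hB0 : 0 ≤ B := by positivity
  have hsym : ∀ α : Fin d → Fin (r + 1), ‖expoSymbol k (fun i => (α i : ℕ))‖ ≤ B := by
    intro α
    have e : (2 * Real.pi) ^ d * ∏ i, ((k i : ℝ) + 1) = ∏ i, (2 * Real.pi * ((k i : ℝ) + 1)) := by
      rw [Finset.prod_mul_distrib]; simp
    rw [hB, e, ← Finset.prod_pow, expoSymbol, norm_prod]
    refine Finset.prod_le_prod (fun i _ => norm_nonneg _) fun i _ => ?_
    have hk : (0 : ℝ) ≤ k i := Nat.cast_nonneg _
    have h1 : ‖(2 * Real.pi * Complex.I * k i : ℂ)‖ = 2 * Real.pi * k i := by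
      simp [abs_of_pos Real.pi_pos]
    rw [norm_pow, h1]
    calc (2 * Real.pi * (k i : ℝ)) ^ (α i : ℕ) ≤ (2 * Real.pi * ((k i : ℝ) + 1)) ^ (α i : ℕ) := by
          gcongr; linarith
      _ ≤ (2 * Real.pi * ((k i : ℝ) + 1)) ^ r := by
          refine pow_le_pow_right₀ ?_ (Nat.lt_succ_iff.1 (α i).2)
          nlinarith
  have hcard : ‖expoSobolev h r k‖ ^ 2 ≤ ((r : ℝ) + 1) ^ d * B ^ 2 := by
    rw [Submodule.coe_norm, PiLp.norm_sq_eq_of_L2]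
    have : ∀ α ∈ (Finset.univ : Finset (Fin d → Fin (r + 1))),
        ‖(expoSobolev h r k : PiLp 2 (fun _ : Fin d → Fin (r + 1) => Lp ℂ 2 μ)) α‖ ^ 2 ≤ B ^ 2 := by
      intro α _
      change ‖expoSymbol k (fun i => (α i : ℕ)) • coordLp E μ (expoMap k)‖ ^ 2 ≤ _
      rw [norm_smul, norm_coordLp_expoMap h, mul_one]
      exact pow_le_pow_left₀ (norm_nonneg _) (hsym α) 2
    refine (Finset.sum_le_card_nsmul _ _ _ this).trans_eq ?_
    simp
  have h1 : (1 : ℝ) ≤ ((r : ℝ) + 1) ^ d := one_le_pow₀ (by linarith [Nat.cast_nonneg (α := ℝ) r])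
  refine le_of_sq_le_sq (hcard.trans ?_) (by positivity)
  rw [mul_pow]
  refine mul_le_mul_of_nonneg_right ?_ (sq_nonneg _)
  nlinarith

/-- From `4 n` different frequencies with `∏ i, (k i + 1) ≤ T`, the normalized exponentials yield a
lower bound of order `T ^ (-r)` for the error of all algorithms of cost `n`. -/
theorem le_minError_mixedEmbedding {D : Type} [MeasurableSpace D] {E : SobolevDomain d D}
    {μ : Measure D} [IsFiniteMeasure μ] (h : IsUnitCubeDomain E μ) (r : ℕ) {n : ℕ} (hn : 1 ≤ n)
    {k : Fin (4 * n) → Fin d → ℕ} (hk : Function.Injective k) {T : ℝ} (hT : 0 < T)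
    (hkT : ∀ j, ∏ i, ((k j i : ℝ) + 1) ≤ T) :
    let σ := (((r : ℝ) + 1) ^ d * ((2 * Real.pi) ^ d * T) ^ r)⁻¹
    ENNReal.ofReal (σ / 64) ≤ (linDetProblem (mixedEmbedding E μ r)).minError n ∧
    ENNReal.ofReal (σ / 64) ≤ (linRanProblem.{0} (mixedEmbedding E μ r)).minError n ∧
    ∀ 𝓕 : Submodule ℂ (D → ℂ), (∀ k, (fun x => expo k (E.coord x)) ∈ 𝓕) →
      ENNReal.ofReal (σ / 64) ≤
        (stdRanProblem.{0} (mixedEmbedding E μ r) (𝓕 : Set (D → ℂ))).minError n := by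
  intro σ
  have hpi := Real.pi_pos
  have hσ : 0 < σ := by positivity
  let c : Fin (4 * n) → ℂ := fun j => ((‖expoSobolev h r (k j)‖⁻¹ : ℝ) : ℂ)
  have hc : ∀ j, ‖c j‖ = ‖expoSobolev h r (k j)‖⁻¹ := fun j => by
    simp only [c]
    rw [Complex.norm_real, norm_inv, norm_norm]
  let v : Fin (4 * n) → mixedSobolev E μ r := fun j => c j • expoSobolev h r (k j)
  have hv : Orthonormal ℂ v := by
    refine ⟨fun j => ?_, fun i j hij => ?_⟩
    · simp only [v]
      rw [norm_smul, hc, inv_mul_cancel₀ (norm_expoSobolev_pos h r (k j)).ne']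
    · simp only [v]
      rw [Submodule.coe_inner, Submodule.coe_smul, Submodule.coe_smul, inner_smul_left,
        inner_smul_right, ← Submodule.coe_inner, inner_expoSobolev_of_ne h r (fun e => hij (hk e)), mul_zero, mul_zero]
  have hJv : ∀ j, mixedEmbedding E μ r (v j) = c j • coordLp E μ (expoMap (k j)) := fun j => by
    simp only [v]
    rw [map_smul, mixedEmbedding_expoSobolev]
  have hJ : ∀ i j, i ≠ j → inner ℂ (mixedEmbedding E μ r (v i)) (mixedEmbedding E μ r (v j)) = 0 := by
    intro i j hij
    rw [hJv, hJv, inner_smul_left, inner_smul_right, inner_expo h,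
      if_neg (fun e => hij (hk e)), mul_zero, mul_zero]
  have hσv : ∀ i, σ ≤ ‖mixedEmbedding E μ r (v i)‖ := by
    intro i
    rw [hJv, norm_smul, hc, norm_coordLp_expoMap h, mul_one]
    refine inv_anti₀ (norm_expoSobolev_pos h r (k i)) ((norm_expoSobolev_le h r (k i)).trans ?_)
    have := hkT i
    gcongr
  refine ⟨le_minError_linDetProblem hn hv hJ hσ hσv, le_minError_linRanProblem hn hv hJ hσ hσv,
    fun 𝓕 h𝓕 => ?_⟩
  refine le_minError_stdRanProblem hn hv hJ hσ hσv
    (g := fun j => c j • fun x => expo (k j) (E.coord x)) (fun j => 𝓕.smul_mem _ (h𝓕 _))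
    (fun j => ?_) fun j => ?_
  · rw [hJv]
    filter_upwards [Lp.coeFn_smul (c j) (coordLp E μ (expoMap (k j))),
      coeFn_coordLp (E := E) (μ := μ) (expoMap (k j))] with x h1 h2
    rw [h1, Pi.smul_apply, Pi.smul_apply, h2]; rfl
  · exact ((contDiff_expo (k j)).continuous.measurable.comp E.measurable_coord).const_smul (c j)

theorem continuous_expo_cube (k : Fin d → ℕ) :
    Continuous fun x => expo k ((cubeDomain d).coord x) :=
  (contDiff_expo k).continuous.comp continuous_subtype_val

theorem continuous_expo_torus (k : Fin d → ℕ) :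
    Continuous fun x => expo k ((torusDomain d).coord x) := by
  have : (fun x => expo k ((torusDomain d).coord x)) =
      fun x : Fin d → UnitAddCircle => ∏ i, fourier (k i : ℤ) (x i) := by
    funext x
    unfold expo tensor
    refine Finset.prod_congr rfl fun i _ => ?_
    have h1 : (((AddCircle.equivIco 1 0 (x i) : ℝ)) : UnitAddCircle) = x i :=
      (AddCircle.equivIco (1 : ℝ) 0).symm_apply_apply (x i)
    conv_rhs => rw [← h1, fourier_coe_apply]
    simp [torusDomain]
  rw [this]
  fun_prop

end Exponentials

/-! ### Hyperbolic crosses -/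

section HyperbolicCross

/-- The (dyadic) hyperbolic cross of level `k` in `ℕ^d`. -/
def hyperbolicCross (d k : ℕ) : Finset (Fin d → ℕ) :=
  (Fintype.piFinset fun _ => Finset.range (2 ^ (k + 1))).filter
    fun l => ∑ i, Nat.log 2 (l i + 1) ≤ k

theorem mem_hyperbolicCross {d k : ℕ} {l : Fin d → ℕ} :
    l ∈ hyperbolicCross d k ↔ ∑ i, Nat.log 2 (l i + 1) ≤ k := by
  unfold hyperbolicCross
  rw [Finset.mem_filter, and_iff_right_iff_imp]
  intro h
  rw [Fintype.mem_piFinset]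
  intro i
  rw [Finset.mem_range]
  have h1 : Nat.log 2 (l i + 1) ≤ k :=
    (Finset.single_le_sum (f := fun i => Nat.log 2 (l i + 1)) (fun _ _ => Nat.zero_le _)
      (Finset.mem_univ i)).trans h
  have h2 := Nat.lt_pow_succ_log_self (b := 2) one_lt_two (l i + 1)
  have h3 : 2 ^ (Nat.log 2 (l i + 1) + 1) ≤ 2 ^ (k + 1) := Nat.pow_le_pow_right two_pos (by omega)
  exact (Nat.lt_succ_self _).trans (h2.trans_le h3)

theorem monotone_hyperbolicCross (d : ℕ) : Monotone (hyperbolicCross d) := by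
  intro k k' h l hl
  rw [mem_hyperbolicCross] at hl ⊢
  exact hl.trans h

theorem zero_mem_hyperbolicCross (d k : ℕ) : 0 ∈ hyperbolicCross d k := by
  simp [mem_hyperbolicCross]

theorem two_pow_le_prod_of_notMem {d k : ℕ} {l : Fin d → ℕ} (hl : l ∉ hyperbolicCross d k) :
    (2 : ℝ) ^ k ≤ ∏ i, ((l i : ℝ) + 1) := by
  rw [mem_hyperbolicCross, not_le] at hl
  have h1 : 2 ^ k ≤ ∏ i, (l i + 1) := by
    calc 2 ^ k ≤ 2 ^ ∑ i, Nat.log 2 (l i + 1) := Nat.pow_le_pow_right two_pos hl.le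
      _ = ∏ i, 2 ^ Nat.log 2 (l i + 1) := (Finset.prod_pow_eq_pow_sum _ _ _).symm
      _ ≤ _ := Finset.prod_le_prod' fun i _ => Nat.pow_log_le_self 2 (Nat.succ_ne_zero _)
  exact_mod_cast h1

theorem prod_le_two_pow_of_mem {d k : ℕ} {l : Fin d → ℕ} (hl : l ∈ hyperbolicCross d k) :
    ∏ i, ((l i : ℝ) + 1) ≤ 2 ^ (k + d) := by
  rw [mem_hyperbolicCross] at hl
  have h1 : ∏ i, (l i + 1) ≤ 2 ^ (k + d) := by
    calc ∏ i, (l i + 1) ≤ ∏ i, 2 ^ (Nat.log 2 (l i + 1) + 1) :=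
          Finset.prod_le_prod' fun i _ => (Nat.lt_pow_succ_log_self one_lt_two _).le
      _ = 2 ^ (∑ i, Nat.log 2 (l i + 1) + d) := by
          rw [Finset.prod_pow_eq_pow_sum, Finset.sum_add_distrib]; simp
      _ ≤ _ := Nat.pow_le_pow_right two_pos (by omega)
  exact_mod_cast h1

theorem log_two_succ_eq_iff (a j : ℕ) :
    Nat.log 2 (a + 1) = j ↔ a ∈ Finset.Ico (2 ^ j - 1) (2 ^ (j + 1) - 1) := by
  rw [Nat.log_eq_iff (Or.inr ⟨one_lt_two, Nat.succ_ne_zero a⟩), Finset.mem_Ico]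
  have := Nat.one_le_two_pow (n := j)
  have := Nat.one_le_two_pow (n := j + 1)
  omega

/-- The hyperbolic cross is the disjoint union of dyadic blocks. -/
theorem card_hyperbolicCross (d k : ℕ) :
    (hyperbolicCross d k).card =
      ∑ j ∈ (Fintype.piFinset fun _ : Fin d => Finset.range (k + 1)).filter (fun j => ∑ i, j i ≤ k),
        2 ^ ∑ i, j i := by
  rw [Finset.card_eq_sum_card_fiberwise (f := fun l i => Nat.log 2 (l i + 1))
    (t := (Fintype.piFinset fun _ : Fin d => Finset.range (k + 1)).filter (fun j => ∑ i, j i ≤ k))]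
  · refine Finset.sum_congr rfl fun j hj => ?_
    have hjk := (Finset.mem_filter.1 hj).2
    have : (hyperbolicCross d k).filter (fun l => (fun i => Nat.log 2 (l i + 1)) = j) =
        Fintype.piFinset fun i => Finset.Ico (2 ^ j i - 1) (2 ^ (j i + 1) - 1) := by
      ext l
      rw [Finset.mem_filter, mem_hyperbolicCross, Fintype.mem_piFinset]
      constructor
      · rintro ⟨-, h⟩ i
        exact (log_two_succ_eq_iff _ _).1 (congrFun h i)
      · intro h
        have h' : ∀ i, Nat.log 2 (l i + 1) = j i := fun i => (log_two_succ_eq_iff _ _).2 (h i)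
        exact ⟨by simpa only [h'] using hjk, funext h'⟩
    rw [this, Fintype.card_piFinset, ← Finset.prod_pow_eq_pow_sum]
    refine Finset.prod_congr rfl fun i _ => ?_
    rw [Nat.card_Ico, pow_succ]
    have := Nat.one_le_two_pow (n := j i)
    omega
  · intro l hl
    have hl' := mem_hyperbolicCross.1 (Finset.mem_coe.1 hl)
    rw [Finset.mem_coe, Finset.mem_filter, Fintype.mem_piFinset]
    refine ⟨fun i => ?_, hl'⟩
    rw [Finset.mem_range, Nat.lt_succ_iff]
    exact (Finset.single_le_sum (f := fun i => Nat.log 2 (l i + 1)) (fun _ _ => Nat.zero_le _)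
      (Finset.mem_univ i)).trans hl'

theorem card_hyperbolicCross_le (m k : ℕ) :
    (hyperbolicCross (m + 1) k).card ≤ 2 * (2 ^ k * (k + 1) ^ m) := by
  rw [card_hyperbolicCross]
  set J := (Fintype.piFinset fun _ : Fin (m + 1) => Finset.range (k + 1)).filter
    (fun j => ∑ i, j i ≤ k)
  have hinj : Set.InjOn (fun j : Fin (m + 1) → ℕ => (Fin.tail j, ∑ i, j i)) J := by
    intro j _ j' _ h
    simp only [Prod.mk.injEq] at h
    have h0 := h.2
    rw [Fin.sum_univ_succ, Fin.sum_univ_succ] at h0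
    have ht : ∀ i : Fin m, j i.succ = j' i.succ := fun i => congrFun h.1 i
    simp only [ht] at h0
    funext i
    refine Fin.cases ?_ ht i
    omega
  have hsub : J.image (fun j : Fin (m + 1) → ℕ => (Fin.tail j, ∑ i, j i)) ⊆
      (Fintype.piFinset fun _ : Fin m => Finset.range (k + 1)) ×ˢ Finset.range (k + 1) := by
    intro p hp
    obtain ⟨j, hj, rfl⟩ := Finset.mem_image.1 hp
    obtain ⟨h1, h2⟩ := Finset.mem_filter.1 hj
    rw [Finset.mem_product, Fintype.mem_piFinset]
    exact ⟨fun i => Fintype.mem_piFinset.1 h1 i.succ, Finset.mem_range.2 (Nat.lt_succ_of_le h2)⟩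
  calc ∑ j ∈ J, 2 ^ ∑ i, j i
      = ∑ p ∈ J.image (fun j : Fin (m + 1) → ℕ => (Fin.tail j, ∑ i, j i)), 2 ^ p.2 :=
        (Finset.sum_image (f := fun p : (Fin m → ℕ) × ℕ => 2 ^ p.2) hinj).symm
    _ ≤ ∑ p ∈ (Fintype.piFinset fun _ : Fin m => Finset.range (k + 1)) ×ˢ Finset.range (k + 1),
          2 ^ p.2 := Finset.sum_le_sum_of_subset hsub
    _ = (k + 1) ^ m * ∑ s ∈ Finset.range (k + 1), 2 ^ s := by
        simp [Finset.sum_product, Fintype.card_piFinset]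
    _ ≤ (k + 1) ^ m * 2 ^ (k + 1) := by
        gcongr
        rw [Nat.geomSum_eq le_rfl]
        simp
    _ = _ := by rw [pow_succ]; ring

theorem sum_card_hyperbolicCross_le (m k : ℕ) :
    ∑ i ∈ Finset.range (k + 1), (hyperbolicCross (m + 1) i).card ≤ 4 * (2 ^ k * (k + 1) ^ m) := by
  calc ∑ i ∈ Finset.range (k + 1), (hyperbolicCross (m + 1) i).card
      ≤ ∑ i ∈ Finset.range (k + 1), 2 * (k + 1) ^ m * 2 ^ i := by
        refine Finset.sum_le_sum fun i hi => (card_hyperbolicCross_le m i).trans ?_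
        have hik : i + 1 ≤ k + 1 := Finset.mem_range.1 hi
        have : (i + 1) ^ m ≤ (k + 1) ^ m := Nat.pow_le_pow_left hik m
        calc 2 * (2 ^ i * (i + 1) ^ m) ≤ 2 * (2 ^ i * (k + 1) ^ m) := by gcongr
          _ = _ := by ring
    _ = 2 * (k + 1) ^ m * ∑ i ∈ Finset.range (k + 1), 2 ^ i := by rw [Finset.mul_sum]
    _ ≤ 2 * (k + 1) ^ m * 2 ^ (k + 1) := by
        gcongr
        rw [Nat.geomSum_eq le_rfl]
        simp
    _ = _ := by rw [pow_succ]; ring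

theorem le_card_hyperbolicCross (m k : ℕ) :
    2 ^ k * (k + 1) ^ m ≤ (m + 1) ^ m * (hyperbolicCross (m + 1) k).card := by
  rw [card_hyperbolicCross]
  set J := (Fintype.piFinset fun _ : Fin (m + 1) => Finset.range (k + 1)).filter
    (fun j => ∑ i, j i ≤ k)
  set S := J.filter fun j => ∑ i, j i = k
  have hS : (k / (m + 1) + 1) ^ m ≤ S.card := by
    have hc : (Fintype.piFinset fun _ : Fin m => Finset.range (k / (m + 1) + 1)).card =
        (k / (m + 1) + 1) ^ m := by rw [Fintype.card_piFinset]; simp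
    rw [← hc]
    -- the first coordinate is chosen such that the sum is `k`
    refine Finset.card_le_card_of_injOn (fun j => Fin.cons (k - ∑ i, j i) j) (fun j hj => ?_)
      fun j _ j' _ h => ?_
    · have hj' := Fintype.mem_piFinset.1 (Finset.mem_coe.1 hj)
      have hsum : ∑ i, j i ≤ k := by
        calc ∑ i, j i ≤ ∑ _i : Fin m, k / (m + 1) :=
              Finset.sum_le_sum fun i _ => Nat.lt_succ_iff.1 (Finset.mem_range.1 (hj' i))
          _ = m * (k / (m + 1)) := by simp
          _ ≤ (m + 1) * (k / (m + 1)) := by gcongr; omega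
          _ ≤ k := Nat.mul_div_le _ _
      have hk : ∑ i, (Fin.cons (k - ∑ i, j i) j : Fin (m + 1) → ℕ) i = k := by
        rw [Fin.sum_univ_succ]
        simp only [Fin.cons_zero, Fin.cons_succ]
        omega
      rw [Finset.mem_coe, Finset.mem_filter, Finset.mem_filter, Fintype.mem_piFinset]
      refine ⟨⟨fun i => ?_, hk.le⟩, hk⟩
      rw [Finset.mem_range, Nat.lt_succ_iff]
      refine (Finset.single_le_sum (fun _ _ => Nat.zero_le _) (Finset.mem_univ i)).trans hk.le
    · exact (Fin.cons_injective2 h).2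
  have hdiv : k + 1 ≤ (m + 1) * (k / (m + 1) + 1) := by
    have := Nat.lt_mul_div_succ k (Nat.succ_pos m)
    simpa using this
  calc 2 ^ k * (k + 1) ^ m ≤ 2 ^ k * ((m + 1) * (k / (m + 1) + 1)) ^ m := by gcongr
    _ = (m + 1) ^ m * ((k / (m + 1) + 1) ^ m * 2 ^ k) := by rw [mul_pow]; ring
    _ ≤ (m + 1) ^ m * (S.card * 2 ^ k) := by gcongr
    _ = (m + 1) ^ m * ∑ j ∈ S, 2 ^ ∑ i, j i := by
        congr 1
        rw [Finset.sum_congr rfl fun j hj => by rw [(Finset.mem_filter.1 hj).2]]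
        rw [Finset.sum_const, smul_eq_mul]
    _ ≤ _ := Nat.mul_le_mul_left _ (Finset.sum_le_sum_of_subset (Finset.filter_subset _ J))

end HyperbolicCross

/-! ### From dyadic levels to the rate of convergence -/

section Rates

/-- The rate of mixed smoothness as a real number. -/
noncomputable def logRate (m r n : ℕ) : ℝ := ((n : ℝ) ^ r)⁻¹ * Real.log n ^ (r * m)

theorem logRate_eq (m r n : ℕ) : logRate m r n = (Real.log n ^ m / n) ^ r := by
  rw [logRate, div_pow, ← pow_mul, mul_comm m r, div_eq_inv_mul]

/-- If a sequence is bounded from above and below by `2 ^ (-k r)` at arguments of the size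
`2 ^ k (k + 1) ^ m`, then it is of order `n ^ (-r) (log n) ^ (r m)`. -/
theorem hasOrder_logRate {a : ℕ → ℝ≥0∞} {m r : ℕ} {C₀ : ℝ} (hC₀ : 0 < C₀)
    (h0 : ∀ n, a n ≤ ENNReal.ofReal C₀)
    (hU : ∃ (A : ℕ) (C : ℝ), 0 < A ∧ 0 < C ∧ ∀ k n, A * (2 ^ k * (k + 1) ^ m) ≤ n →
      a n ≤ ENNReal.ofReal (C * ((2 : ℝ) ^ k)⁻¹ ^ r))
    (hL : ∃ (A : ℕ) (c : ℝ), 0 < A ∧ 0 < c ∧ ∀ k n, 1 ≤ n → A * n ≤ 2 ^ k * (k + 1) ^ m →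
      ENNReal.ofReal (c * ((2 : ℝ) ^ k)⁻¹ ^ r) ≤ a n) :
    HasOrder 2 a (logRate m r) := by
  obtain ⟨A, C, hA, hC, hU⟩ := hU
  obtain ⟨A', c, hA', hc, hL⟩ := hL
  have hAr : (0 : ℝ) < A := by exact_mod_cast hA
  have hA'r : (0 : ℝ) < A' := by exact_mod_cast hA'
  have hlog2 : 0 < Real.log 2 := Real.log_pos one_lt_two
  set K : ℝ := A * 2 ^ (m + 1) * (2 / Real.log 2) ^ m with hK
  have hK0 : 0 < K := by positivity
  set L : ℝ := 2 * A' * ((m + 1) * Real.log 2) ^ m with hLdef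
  have hL0 : 0 < L := by positivity
  set s₀ : ℝ := (Real.log 2 ^ m / A) ^ r with hs₀
  have hs₀0 : 0 < s₀ := by positivity
  have hM : ∀ n : ℕ, n < 2 ^ n * (n + 1) ^ m := fun n =>
    Nat.lt_two_pow_self.trans_le (Nat.le_mul_of_pos_right _ (by positivity))
  refine ⟨c * L⁻¹ ^ r, C * K ^ r + C₀ / s₀, by positivity, by positivity, fun n hn => ⟨?_, ?_⟩⟩
  · have hn0 : (0 : ℝ) < n := by exact_mod_cast (by omega : 0 < n)
    have hlogn : 0 ≤ Real.log n := Real.log_natCast_nonneg n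
    -- the smallest level whose cross is large enough
    have hex : ∃ k, A' * n ≤ 2 ^ k * (k + 1) ^ m := ⟨A' * n, (hM _).le⟩
    classical
    have hspec := Nat.find_spec hex
    have hmin := fun j => Nat.find_min hex (m := j)
    generalize Nat.find hex = k at hspec hmin
    have hk : 1 ≤ k := by
      rcases Nat.eq_zero_or_pos k with rfl | h
      · exfalso
        simp at hspec
        nlinarith
      · exact h
    obtain ⟨j, rfl⟩ := Nat.exists_eq_add_of_le' hk
    have h1 := hmin j (Nat.lt_succ_self j)
    rw [not_le] at h1
    refine le_trans (ENNReal.ofReal_le_ofReal ?_) (hL _ n (by omega) hspec)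
    rw [logRate_eq, mul_assoc]
    refine mul_le_mul_of_nonneg_left ?_ hc.le
    rw [← mul_pow]
    refine pow_le_pow_left₀ (by positivity) ?_ r
    have h1r : (2 : ℝ) ^ j * ((j : ℝ) + 1) ^ m ≤ A' * n := by exact_mod_cast h1.le
    have h2 : Real.log n ≤ ((j : ℝ) + 1) * ((m + 1) * Real.log 2) := by
      have h3 : n ≤ 2 ^ ((j + 1) * (m + 1)) := by
        calc n ≤ A' * n := Nat.le_mul_of_pos_left _ hA'
          _ ≤ 2 ^ (j + 1) * (j + 1 + 1) ^ m := hspec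
          _ ≤ 2 ^ (j + 1) * (2 ^ (j + 1)) ^ m := by
              gcongr
              exact Nat.lt_two_pow_self
          _ = _ := by rw [← pow_mul, ← pow_add]; ring_nf
      have h4 : (n : ℝ) ≤ 2 ^ ((j + 1) * (m + 1)) := by exact_mod_cast h3
      have h5 := Real.log_le_log hn0 h4
      rw [Real.log_pow] at h5
      push_cast at h5
      linarith
    have h3 : Real.log n ^ m ≤ ((j : ℝ) + 1) ^ m * ((m + 1) * Real.log 2) ^ m := by
      rw [← mul_pow]; exact pow_le_pow_left₀ hlogn h2 m
    rw [← one_div, ← one_div, div_mul_div_comm, one_mul, div_le_div_iff₀ (by positivity)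
      (by positivity), one_mul, hLdef, pow_succ]
    calc Real.log n ^ m * (2 ^ j * 2)
        ≤ ((j : ℝ) + 1) ^ m * ((m + 1) * Real.log 2) ^ m * (2 ^ j * 2) := by gcongr
      _ = (2 ^ j * ((j : ℝ) + 1) ^ m) * (2 * ((m + 1) * Real.log 2) ^ m) := by ring
      _ ≤ (A' * n) * (2 * ((m + 1) * Real.log 2) ^ m) := by gcongr
      _ = _ := by ring
  · have hn0 : (0 : ℝ) < n := by exact_mod_cast (by omega : 0 < n)
    have hlogn : Real.log 2 ≤ Real.log n :=
      Real.log_le_log two_pos (by exact_mod_cast hn)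
    have hlogn0 : 0 < Real.log n := hlog2.trans_le hlogn
    have hs0 : 0 ≤ logRate m r n := by rw [logRate_eq]; positivity
    rcases lt_or_ge n A with hnA | hnA
    · refine (h0 n).trans (ENNReal.ofReal_le_ofReal ?_)
      have h1 : s₀ ≤ logRate m r n := by
        rw [logRate_eq, hs₀]
        have : (n : ℝ) ≤ A := by exact_mod_cast hnA.le
        gcongr
      calc C₀ = C₀ / s₀ * s₀ := by field_simp
        _ ≤ C₀ / s₀ * logRate m r n := by gcongr
        _ ≤ _ := by
          refine mul_le_mul_of_nonneg_right ?_ hs0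
          have : 0 ≤ C * K ^ r := by positivity
          linarith
    · -- the largest level whose cross is not too large
      have hex : ∃ k, n < A * (2 ^ k * (k + 1) ^ m) :=
        ⟨n, (hM n).trans_le (Nat.le_mul_of_pos_left _ hA)⟩
      classical
      have hspec := Nat.find_spec hex
      have hmin := fun j => Nat.find_min hex (m := j)
      generalize Nat.find hex = k at hspec hmin
      have hk : 1 ≤ k := by
        rcases Nat.eq_zero_or_pos k with rfl | h
        · exfalso; simp at hspec; omega
        · exact h
      obtain ⟨j, rfl⟩ := Nat.exists_eq_add_of_le' hk
      have h1 := hmin j (Nat.lt_succ_self j)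
      rw [not_lt] at h1
      refine (hU j n h1).trans (ENNReal.ofReal_le_ofReal ?_)
      have h2 : (j : ℝ) + 1 ≤ 2 / Real.log 2 * Real.log n := by
        have h3 : 2 ^ j ≤ n := by
          refine le_trans ?_ h1
          calc 2 ^ j ≤ 2 ^ j * (j + 1) ^ m := Nat.le_mul_of_pos_right _ (by positivity)
            _ ≤ _ := Nat.le_mul_of_pos_left _ hA
        have h4 : (2 : ℝ) ^ j ≤ n := by exact_mod_cast h3
        have h5 := Real.log_le_log (by positivity) h4
        rw [Real.log_pow] at h5
        rw [div_mul_eq_mul_div, le_div_iff₀ hlog2]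
        linarith
      have h3 : (n : ℝ) ≤ A * (2 ^ (j + 1) * ((j : ℝ) + 1 + 1) ^ m) := by exact_mod_cast hspec.le
      have h4 : ((2 : ℝ) ^ j)⁻¹ ≤ K * (Real.log n ^ m / n) := by
        rw [← mul_div_assoc, ← one_div, div_le_div_iff₀ (by positivity) hn0, one_mul]
        calc (n : ℝ) ≤ A * (2 ^ (j + 1) * ((j : ℝ) + 1 + 1) ^ m) := h3
          _ ≤ A * (2 ^ (j + 1) * (2 * (2 / Real.log 2 * Real.log n)) ^ m) := by
              have : (0 : ℝ) ≤ j := Nat.cast_nonneg j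
              gcongr
              linarith
          _ = _ := by rw [hK, mul_pow, mul_pow, pow_succ, pow_succ]; ring
      have h5 : ((2 : ℝ) ^ j)⁻¹ ^ r ≤ K ^ r * logRate m r n := by
        rw [logRate_eq, ← mul_pow]
        exact pow_le_pow_left₀ (by positivity) h4 r
      calc C * ((2 : ℝ) ^ j)⁻¹ ^ r ≤ C * (K ^ r * logRate m r n) := by gcongr
        _ = C * K ^ r * logRate m r n := by ring
        _ ≤ _ := by
          refine mul_le_mul_of_nonneg_right ?_ hs0
          have : 0 ≤ C₀ / s₀ := by positivity
          linarith

end Rates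

/-! ### Mixed smoothness -/

section MixedOrder

variable {m : ℕ} {D : Type} [MeasurableSpace D] {E : SobolevDomain (m + 1) D}
  {μ : Measure D} [IsFiniteMeasure μ]

theorem norm_sub_sum_hyperbolicCross_le (h : IsUnitCubeDomain E μ) (r k : ℕ)
    (f : mixedSobolev E μ r) :
    ‖mixedEmbedding E μ r f - ∑ l ∈ hyperbolicCross (m + 1) k,
      (inner ℂ (legendreLp E μ l) (mixedEmbedding E μ r f) : ℂ) • legendreLp E μ l‖ ≤
      (((r : ℝ) + 1) ^ (m + 1)) ^ r * ((2 : ℝ) ^ k)⁻¹ ^ r * ‖f‖ := by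
  rw [← mul_pow, ← div_eq_mul_inv]
  exact norm_mixedEmbedding_sub_sum_le h _ (by positivity)
    (fun l hl => two_pow_le_prod_of_notMem hl) f

theorem exists_frequencies {n k : ℕ} (hn : 4 * n ≤ (hyperbolicCross (m + 1) k).card) :
    ∃ K : Fin (4 * n) → Fin (m + 1) → ℕ, Function.Injective K ∧
      ∀ j, K j ∈ hyperbolicCross (m + 1) k := by
  obtain ⟨s, hs, hcard⟩ := Finset.exists_subset_card_eq hn
  let φ := s.equivFinOfCardEq hcard
  exact ⟨fun j => (φ.symm j).1, Subtype.val_injective.comp φ.symm.injective,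
    fun j => hs (φ.symm j).2⟩

/-- The order of convergence for mixed smoothness: upper bounds come from the Legendre projections
onto hyperbolic crosses, lower bounds from the exponentials with frequencies in these crosses. -/
theorem mixedOrder_of_isUnitCubeDomain [TopologicalSpace D] [Nonempty D]
    (h : IsUnitCubeDomain E μ) (hcont : ∀ k, Continuous fun x => expo k (E.coord x)) (r : ℕ) :
    MixedOrder E μ r := by
  set Q : ℝ := (((r : ℝ) + 1) ^ (m + 1)) ^ r with hQ
  have hQ0 : 0 < Q := by positivity
  set c : ℝ := (((r : ℝ) + 1) ^ (m + 1) * ((2 * Real.pi) ^ (m + 1) * 2 ^ (m + 1)) ^ r)⁻¹ / 64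
    with hc
  have hpi := Real.pi_pos
  have hc0 : 0 < c := by positivity
  have hcrate : ∀ k : ℕ, c * ((2 : ℝ) ^ k)⁻¹ ^ r =
      (((r : ℝ) + 1) ^ (m + 1) * ((2 * Real.pi) ^ (m + 1) * 2 ^ (k + (m + 1))) ^ r)⁻¹ / 64 := by
    intro k
    rw [hc, inv_pow, div_mul_eq_mul_div, ← mul_inv, pow_add]
    congr 2
    rw [mul_assoc, ← mul_pow]
    ring_nf
  have hlow : ∀ k n, 1 ≤ n → (4 * (m + 1) ^ m) * n ≤ 2 ^ k * (k + 1) ^ m →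
      ENNReal.ofReal (c * ((2 : ℝ) ^ k)⁻¹ ^ r) ≤
        (linDetProblem (mixedEmbedding E μ r)).minError n ∧
      ENNReal.ofReal (c * ((2 : ℝ) ^ k)⁻¹ ^ r) ≤
        (linRanProblem.{0} (mixedEmbedding E μ r)).minError n ∧
      ∀ 𝓕 : Submodule ℂ (D → ℂ), (∀ k, (fun x => expo k (E.coord x)) ∈ 𝓕) →
        ENNReal.ofReal (c * ((2 : ℝ) ^ k)⁻¹ ^ r) ≤
          (stdRanProblem.{0} (mixedEmbedding E μ r) (𝓕 : Set (D → ℂ))).minError n := by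
    intro k n hn hkn
    have hcard : 4 * n ≤ (hyperbolicCross (m + 1) k).card := by
      have h1 := hkn.trans (le_card_hyperbolicCross m k)
      have h2 : (m + 1) ^ m * (4 * n) ≤ (m + 1) ^ m * (hyperbolicCross (m + 1) k).card := by
        linarith
      exact Nat.le_of_mul_le_mul_left h2 (by positivity)
    obtain ⟨K, hK, hKmem⟩ := exists_frequencies hcard
    rw [hcrate]
    exact le_minError_mixedEmbedding h r hn hK (T := 2 ^ (k + (m + 1))) (by positivity)
      fun j => prod_le_two_pow_of_mem (hKmem j)
  have hproj := norm_sub_sum_hyperbolicCross_le h r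
  have hzero : ∀ f : mixedSobolev E μ r, ‖mixedEmbedding E μ r f -
      ∑ l ∈ (∅ : Finset (Fin (m + 1) → ℕ)), (inner ℂ (legendreLp E μ l)
        (mixedEmbedding E μ r f) : ℂ) • legendreLp E μ l‖ ≤ (‖mixedEmbedding E μ r‖ + 1) * ‖f‖ := by
    intro f
    rw [Finset.sum_empty, sub_zero]
    refine ((mixedEmbedding E μ r).le_opNorm f).trans ?_
    gcongr
    linarith
  have hC₀ : 0 < ‖mixedEmbedding E μ r‖ + 1 := by positivity
  have hA : 0 < 4 * (m + 1) ^ m := by positivity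
  have hup : ∀ k n, 2 * (2 ^ k * (k + 1) ^ m) ≤ n → (hyperbolicCross (m + 1) k).card ≤ n :=
    fun k n hn => (card_hyperbolicCross_le m k).trans hn
  have hrate : mixedRate (m + 1) r = fun n => ENNReal.ofReal (logRate m r n) := rfl
  have hord := hasOrder_ofReal 2 (logRate m r)
  unfold MixedOrder
  rw [hrate]
  refine ⟨fun 𝓕 h𝓕c h𝓕m => ?_, ?_, ?_⟩
  · refine HasOrder.weakEquiv (hasOrder_logRate hC₀ (fun n => ?_) ?_ ?_) hord
    · refine (minError_stdRanProblem_le_norm h𝓕m n).trans (ENNReal.ofReal_le_ofReal ?_)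
      linarith
    · obtain ⟨A, C, hA, hC, hstd⟩ := exists_minError_stdRanProblem_le
        (J := mixedEmbedding E μ r) (𝓕 := (𝓕 : Set (D → ℂ))) h𝓕m (orthonormal_legendreLp h)
        (Λ := hyperbolicCross (m + 1)) (τ := fun k => Q * ((2 : ℝ) ^ k)⁻¹ ^ r) (B := 2 ^ r)
        (monotone_hyperbolicCross _) ⟨0, zero_mem_hyperbolicCross _ _⟩ (fun k => by positivity)
        (fun k => le_of_eq (by
          have : ((2 : ℝ) ^ k)⁻¹ = 2 * (2 ^ (k + 1))⁻¹ := by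
            rw [pow_succ]; field_simp
          rw [this, mul_pow]; ring)) hproj
      refine ⟨A * 4, C * Q, by positivity, by positivity, fun k n hn => ?_⟩
      rw [mul_assoc]
      refine hstd k n (le_trans ?_ hn)
      rw [mul_assoc]
      exact Nat.mul_le_mul_left _ (sum_card_hyperbolicCross_le m k)
    · exact ⟨_, c, hA, hc0, fun k n hn hkn =>
        (hlow k n hn hkn).2.2 𝓕 fun k => h𝓕c _ (hcont k)⟩
  · refine HasOrder.weakEquiv (hasOrder_logRate hC₀ (fun n => ?_) ?_ ?_) hord
    · exact minError_linDetProblem_le hC₀.le hzero (by simp)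
    · exact ⟨2, Q, two_pos, hQ0, fun k n hn =>
        minError_linDetProblem_le (by positivity) (hproj k) (hup k n hn)⟩
    · exact ⟨_, c, hA, hc0, fun k n hn hkn => (hlow k n hn hkn).1⟩
  · refine HasOrder.weakEquiv (hasOrder_logRate hC₀ (fun n => ?_) ?_ ?_) hord
    · exact minError_linRanProblem_le hC₀.le hzero (by simp)
    · exact ⟨2, Q, two_pos, hQ0, fun k n hn =>
        minError_linRanProblem_le (by positivity) (hproj k) (hup k n hn)⟩
    · exact ⟨_, c, hA, hc0, fun k n hn hkn => (hlow k n hn hkn).2.1⟩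

end MixedOrder
theorem mainTheorem7 :
    -- mixed smoothness on the torus
    (∀ d r : ℕ, 1 ≤ d → 1 ≤ r → MixedOrder (torusDomain d) volume r) ∧
    -- mixed smoothness on the cube
    (∀ d r : ℕ, 1 ≤ d → 1 ≤ r → MixedOrder (cubeDomain d) (cubeMeasure d) r) ∧
    -- Hilbert spaces compactly embedded into an `L²`-space
    (∀ (𝕂 : Type k₀) [RCLike 𝕂] (D : Type u₀) [MeasurableSpace D] (μ : Measure D)
      (H : Type h₀) [NormedAddCommGroup H] [InnerProductSpace 𝕂 H] [CompleteSpace H]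
      (J : H →L[𝕂] Lp 𝕂 2 μ),
      ¬ FiniteDimensional 𝕂 H → Function.Injective J → IsCompactOperator J →
      WeakEquiv 1 (fun n => ENNReal.ofReal (singularValue J (2 * n)))
        (fun n => ENNReal.ofReal (singularValue J n)) →
      ∀ 𝓕 : Submodule 𝕂 (D → 𝕂), (∀ g ∈ 𝓕, Measurable g) →
        (∀ f : H, ∃ g ∈ 𝓕, g =ᵐ[μ] J f) →
        WeakEquiv 1 (linRanProblem.{u₀} J).minError (linDetProblem J).minError ∧
        WeakEquiv 1 (linDetProblem J).minError
          (stdRanProblem.{u₀} J (𝓕 : Set (D → 𝕂))).minError) := by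
  refine ⟨?_, ?_, ?_⟩
  · intro d r hd _
    obtain ⟨m, rfl⟩ := Nat.exists_eq_add_of_le' hd
    exact mixedOrder_of_isUnitCubeDomain (isUnitCubeDomain_torus _) continuous_expo_torus r
  · intro d r hd _
    obtain ⟨m, rfl⟩ := Nat.exists_eq_add_of_le' hd
    have : Nonempty ↥(Set.Icc (0 : Fin (m + 1) → ℝ) 1) := ⟨⟨0, le_rfl, zero_le_one⟩⟩
    exact mixedOrder_of_isUnitCubeDomain (isUnitCubeDomain_cube _) continuous_expo_cube r
  · intro 𝕂 _ D _ μ H _ _ _ J hH hinj hJ hdouble 𝓕 h𝓕 hrep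
    have h := hasOrder_singularValue hH hinj hJ hdouble 𝓕 h𝓕 hrep
    exact ⟨h.1.weakEquiv h.2.1, h.2.1.weakEquiv h.2.2⟩
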